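/- Let $G$ be a connected finite simple graph of order $n\ge 4$, and let $L(G)=D(G)-A(G)$ be its Laplacian matrix, where $D(G)$ is the diagonal matrix of vertex degrees and $A(G)$ is the adjacency matrix. Suppose that some eigenvalue of $L(G)$ has multiplicity exactly $n-3$. Then $G$ is determined by its Laplacian spectrum: every finite simple graph $H$ (connected or not) for which $L(H)$ and $L(G)$ have the same eigenvalues with the same multiplicities is isomorphic to $G$. -/

import Mathlib

universe u v

open Classical in
/-- The Laplacian spectrum of a finite simple graph: the multiset of eigenvalues of the Laplacian
matrix `D - A` over `ℝ`, each repeated according to its multiplicity as a root of the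
characteristic polynomial. The matrix is real symmetric, so all its eigenvalues are real, and
algebraic and geometric multiplicities agree. -/
noncomputable def laplacianSpectrum {V : Type*} [Fintype V] (G : SimpleGraph V) : Multiset ℝ :=
  (G.lapMatrix ℝ).charpoly.roots

/-- Membership in `𝒢(n, k)`: `G` is a connected graph of order `n`, and one of its Laplacian
eigenvalues has multiplicity (exactly) `k`. -/
def HasLaplacianMultiplicity {V : Type*} [Fintype V] (G : SimpleGraph V) (n k : ℕ) : Prop :=
  G.Connected ∧ Fintype.card V = n ∧
    ∃ μ ∈ laplacianSpectrum G, (laplacianSpectrum G).count μ = k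

/-- `G` is determined by its Laplacian spectrum: every finite simple graph `H` (connected or not,
on any finite vertex type) with the same Laplacian spectrum is isomorphic to `G`. -/
def IsDLS {V : Type u} [Fintype V] (G : SimpleGraph V) : Prop :=
  ∀ (W : Type v) [Fintype W] (H : SimpleGraph W),
    laplacianSpectrum H = laplacianSpectrum G → Nonempty (H ≃g G)

/-!
Let `μ` be a Laplacian eigenvalue of multiplicity `n - 3`. As `G` is connected, `0` has
multiplicity one (`count_zero_laplacianSpectrum`), so `μ ≠ 0` for `n ≥ 5`. The matrix
`M = L - μ I + (μ / n) J` has rank at most two (`exists_isRankTwo`): it annihilates the all-ones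
vector and the eigenspace of `μ`. Its off-diagonal entries take only the two values `α` and
`α - 1`, where `α = μ / n`, and its row sums vanish. These conditions are so restrictive that all
graphs satisfying them for `n ≥ 6`, connected or not, can be listed. Complementation replaces `M`
by `-M` and `α` by `1 - α`, so `α ≤ 1 / 2` may be assumed.

* For `α = 0` the matrix `M` is the Laplacian matrix, and any three vertices contain a component
  (`IsRankTwo.zeroCase`).
* For `0 ≠ α < 1 / 2`, if two different rows are proportional, then `G` is a star with possibly an
  edge added. Otherwise any two different rows form a basis of the row space, so
  every row is determined by its entries in two columns. If three different rows occur outside a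
  triple of vertices with three different rows, then `α = 1 / 3` and the rows of the triple add up
  to zero (`IsRankTwo.SpecialTriple.thirdCase`). If there is no such triple, then either all but one
  vertex lie in two classes of vertices with equal rows
  (`IsRankTwo.halfOddCase_of_two_classes`), or all but three vertices lie in one class
  (`IsRankTwo.smallCase_of_one_class`).
* For `α = 1 / 2` the off-diagonal entries are `± 1 / 2`, and the same kind of argument applies to
  the rows up to sign (`IsRankTwo.halfCase`).

In each case `G` is a blow-up of one of a few patterns, that is, it is described by a colouring of
its vertices such that adjacency depends only on the colours. Pattern and class sizes determine
the graph up to isomorphism (`IsBlowup.nonempty_iso`), and graphs in the list with the same `n` and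
`α` are told apart by the sums of their degrees and of the squares of their degrees, which are
spectral invariants since they are determined by the traces of `L` and `L ^ 2`. A graph `H` with the
spectrum of `G` satisfies the same conditions with the same `α`, so it is isomorphic to `G`
(`IsRankTwo.nonempty_iso`).

For `n = 4` and `n = 5` all graphs are determined by their Laplacian spectra, which is a finite
check: the traces of the first three powers of `L` determine the graph
(`nonempty_iso_of_codeCheck`).
-/

/-! ### Blow-ups of small patterns -/

/-- `G` is a blow-up of the pattern `P` with class sizes `m`: the vertices can be coloured with
`k` colours so that exactly `m x` of them have colour `x`, and two distinct vertices are adjacent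
precisely when `P` relates their colours. A colour class is thus a clique if `P x x` holds and
a coclique otherwise; classes may be empty. -/
def IsBlowup {V : Type*} [Fintype V] (G : SimpleGraph V) {k : ℕ} (P : Fin k → Fin k → Bool)
    (m : Fin k → ℕ) : Prop :=
  ∃ c : V → Fin k, (∀ v w, v ≠ w → (G.Adj v w ↔ P (c v) (c w) = true)) ∧
    ∀ x, Nat.card {v // c v = x} = m x

/-- Class sizes and pattern determine a blow-up up to isomorphism. -/
theorem IsBlowup.nonempty_iso {V W : Type*} [Fintype V] [Fintype W] {G : SimpleGraph V}
    {H : SimpleGraph W} {k : ℕ} {P : Fin k → Fin k → Bool} {m : Fin k → ℕ}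
    (hG : IsBlowup G P m) (hH : IsBlowup H P m) : Nonempty (G ≃g H) := by
  obtain ⟨c, hc, hcm⟩ := hG
  obtain ⟨d, hd, hdm⟩ := hH
  have e : ∀ x, {v // c v = x} ≃ {w // d w = x} := fun x =>
    (Finite.card_eq.1 (by rw [hcm, hdm])).some
  let f : V ≃ W := ((Equiv.sigmaFiberEquiv c).symm.trans (Equiv.sigmaCongrRight e)).trans
    (Equiv.sigmaFiberEquiv d)
  have hf : ∀ v, d (f v) = c v := fun v => (e (c v) ⟨v, rfl⟩).2
  refine ⟨⟨f, ?_⟩⟩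
  intro v w
  rcases eq_or_ne v w with rfl | hvw
  · simp
  · rw [hd _ _ (f.injective.ne hvw), hc _ _ hvw, hf, hf]

theorem IsBlowup.of_compl {V : Type*} [Fintype V] {G : SimpleGraph V} {k : ℕ}
    {P : Fin k → Fin k → Bool} {m : Fin k → ℕ} (h : IsBlowup Gᶜ P m) :
    IsBlowup G (fun x y => !P x y) m := by
  obtain ⟨c, hc, hcm⟩ := h
  refine ⟨c, fun v w hvw => ?_, hcm⟩
  have := hc v w hvw
  rw [SimpleGraph.compl_adj] at this
  simp only [Bool.not_eq_eq_eq_not, Bool.not_true]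
  rw [← Bool.not_eq_true, ← this]
  tauto

theorem sum_comp_coloring {V R : Type*} [Fintype V] [NonAssocSemiring R] {k : ℕ} (c : V → Fin k)
    {m : Fin k → ℕ} (hc : ∀ x, Nat.card {v // c v = x} = m x) (f : Fin k → R) :
    ∑ v, f (c v) = ∑ x, m x * f x := by
  classical
  rw [← Finset.sum_fiberwise_of_maps_to (s := Finset.univ) (t := Finset.univ) (g := c)
    (fun _ _ => Finset.mem_univ _)]
  refine Finset.sum_congr rfl fun x _ => ?_
  rw [Finset.sum_congr rfl (g := fun _ => f x) (fun v hv => by rw [(Finset.mem_filter.1 hv).2]),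
    Finset.sum_const, nsmul_eq_mul, ← hc x, Nat.card_eq_fintype_card, Fintype.card_subtype]

theorem IsBlowup.card_eq {V : Type*} [Fintype V] {G : SimpleGraph V} {k : ℕ}
    {P : Fin k → Fin k → Bool} {m : Fin k → ℕ} (h : IsBlowup G P m) :
    Fintype.card V = ∑ x, m x := by
  obtain ⟨c, -, hc⟩ := h
  simpa using sum_comp_coloring c hc (fun _ => (1 : ℕ))

open Classical in
/-- In a blow-up, degrees are given by the colour: `d x` is the degree in each nonempty class. -/
theorem IsBlowup.sum_degree {V : Type*} [Fintype V] {G : SimpleGraph V} {k : ℕ}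
    {P : Fin k → Fin k → Bool} {m d : Fin k → ℕ} (h : IsBlowup G P m)
    (hd : ∀ x, m x ≠ 0 → d x + (if P x x then 1 else 0) = ∑ y, m y * (if P x y then 1 else 0))
    (f : ℕ → ℕ) : ∑ v, f (G.degree v) = ∑ x, m x * f (d x) := by
  obtain ⟨c, hP, hc⟩ := h
  have key := sum_comp_coloring c hc (fun x => f (d x))
  simp only [Nat.cast_id] at key
  rw [← key]
  refine Finset.sum_congr rfl fun v _ => congrArg f ?_
  have hm : m (c v) ≠ 0 := by
    rw [← hc, Nat.card_ne_zero]
    exact ⟨⟨⟨v, rfl⟩⟩, inferInstance⟩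
  have h1 := hd _ hm
  have key' := sum_comp_coloring c hc (fun y => if P (c v) y then 1 else 0)
  simp only [Nat.cast_id] at key'
  rw [← key'] at h1
  have h2 : G.degree v = ∑ w, if G.Adj v w then 1 else 0 := by
    simpa using G.degree_eq_sum_if_adj (R := ℕ) v
  have h3 : ∀ w, (if P (c v) (c w) then 1 else 0) =
      (if G.Adj v w then 1 else 0) + (if w = v then (if P (c v) (c v) then 1 else 0) else 0) := by
    intro w
    by_cases hw : w = v
    · subst hw; simp
    · simp [hP v w (Ne.symm hw), hw]
  rw [Finset.sum_congr rfl (fun w _ => h3 w), Finset.sum_add_distrib, ← h2] at h1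
  simp only [Finset.sum_ite_eq', Finset.mem_univ, if_true] at h1
  omega

/-! ### From the spectrum to the matrix -/

/-- The symmetric matrix `M` has entries `α - 1` at adjacent and `α` at non-adjacent pairs of
distinct vertices, zero row sums, and rank at most two. For `α = μ / n` it is `L(G) - μ I + (μ / n) J`,
whose kernel contains the all-ones vector and all eigenvectors of `L(G)` for the eigenvalue
`μ ≠ 0`. The rank condition is phrased as linear dependence of any three rows. -/
structure IsRankTwo {V : Type*} [Fintype V] (G : SimpleGraph V) (α : ℝ) (M : V → V → ℝ) :
    Prop where
  apply_adj : ∀ {i j}, G.Adj i j → M i j = α - 1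
  apply_not_adj : ∀ {i j}, i ≠ j → ¬G.Adj i j → M i j = α
  sum_row : ∀ i, ∑ j, M i j = 0
  dep : ∀ i j k, ∃ r s t : ℝ, (r ≠ 0 ∨ s ≠ 0 ∨ t ≠ 0) ∧
    ∀ x, r * M i x + s * M j x + t * M k x = 0

/-- Complementation changes the sign of the matrix. -/
theorem IsRankTwo.compl {V : Type*} [Fintype V] {G : SimpleGraph V} {α : ℝ} {M : V → V → ℝ}
    (h : IsRankTwo G α M) : IsRankTwo Gᶜ (1 - α) (fun i j => -M i j) where
  apply_adj := fun {i j} hij => by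
    rw [SimpleGraph.compl_adj] at hij
    rw [h.apply_not_adj hij.1 hij.2]; ring
  apply_not_adj := fun {i j} hij h' => by
    rw [SimpleGraph.compl_adj] at h'
    rw [h.apply_adj (by tauto)]; ring
  sum_row := fun i => by rw [Finset.sum_neg_distrib, h.sum_row, neg_zero]
  dep := fun i j k => by
    obtain ⟨r, s, t, h0, h1⟩ := h.dep i j k
    exact ⟨r, s, t, h0, fun x => by linear_combination -(h1 x)⟩

open Classical in
theorem card_eq_card_laplacianSpectrum {V : Type*} [Fintype V] (G : SimpleGraph V) :
    Multiset.card (laplacianSpectrum G) = Fintype.card V := by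
  unfold laplacianSpectrum
  rw [(G.isHermitian_lapMatrix ℝ).roots_charpoly_eq_eigenvalues]
  simp

open Classical in
theorem trace_lapMatrix_pow {V : Type*} [Fintype V] (G : SimpleGraph V) (k : ℕ) :
    (G.lapMatrix ℝ ^ k).trace = ((laplacianSpectrum G).map (· ^ k)).sum := by
  have hA := G.isHermitian_lapMatrix ℝ
  unfold laplacianSpectrum
  rw [hA.roots_charpoly_eq_eigenvalues]
  conv_lhs => rw [hA.spectral_theorem, ← map_pow, Matrix.diagonal_pow]
  rw [Unitary.conjStarAlgAut_apply, Matrix.trace_mul_comm, ← mul_assoc]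
  simp [Matrix.trace]

open Classical in
theorem rank_lapMatrix_sub {V : Type*} [Fintype V] (G : SimpleGraph V) (μ : ℝ) :
    (G.lapMatrix ℝ - μ • 1).rank + (laplacianSpectrum G).count μ = Fintype.card V := by
  have hA := G.isHermitian_lapMatrix ℝ
  unfold laplacianSpectrum
  rw [hA.roots_charpoly_eq_eigenvalues]
  have h : G.lapMatrix ℝ - μ • 1 = Unitary.conjStarAlgAut ℝ _ hA.eigenvectorUnitary
      (Matrix.diagonal (fun i => hA.eigenvalues i - μ)) := by
    have : (Matrix.diagonal (fun i => hA.eigenvalues i - μ)) =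
      Matrix.diagonal (RCLike.ofReal ∘ hA.eigenvalues) - μ • (1 : Matrix V V ℝ) := by
      ext i j
      by_cases hij : i = j <;> simp [hij]
    rw [this, map_sub, map_smul, map_one, ← hA.spectral_theorem]
  have h2 : (G.lapMatrix ℝ - μ • 1).rank = Fintype.card {i // hA.eigenvalues i - μ ≠ 0} := by
    rw [h, Unitary.conjStarAlgAut_apply, ← Unitary.coe_star]
    simp [-isUnit_iff_ne_zero, -Unitary.coe_star, Matrix.rank_diagonal]
  rw [h2, Multiset.count_map, ← Finset.filter_val, Finset.card_val, Fintype.card_subtype,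
    ← Finset.card_univ,
    ← Finset.card_filter_add_card_filter_not (s := Finset.univ) (fun i => hA.eigenvalues i - μ ≠ 0)]
  congr 2
  ext i
  simp [sub_eq_zero, eq_comm (a := μ)]

open Classical in
theorem lapMatrix_apply_eq {V : Type*} [Fintype V] (G : SimpleGraph V) (i j : V) :
    G.lapMatrix ℝ i j = (if i = j then (G.degree i : ℝ) else 0) - if G.Adj i j then 1 else 0 := by
  simp [SimpleGraph.lapMatrix, SimpleGraph.degMatrix, Matrix.diagonal_apply,
    SimpleGraph.adjMatrix_apply]

open Classical in
/-- An eigenvalue `μ ≠ 0` of multiplicity `n - 3` yields the rank condition: three rows of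
`L - μ I + (μ / n) J` together with the all-ones vector lie in the three-dimensional row space of
`L - μ I`, and in a linear relation between them the coefficient of the all-ones vector
vanishes. -/
theorem exists_isRankTwo {V : Type*} [Fintype V] (G : SimpleGraph V) {μ : ℝ} (hμ : μ ≠ 0)
    (hn : 3 ≤ Fintype.card V)
    (h : (laplacianSpectrum G).count μ = Fintype.card V - 3) :
    ∃ M, IsRankTwo G (μ / Fintype.card V) M := by
  have hn0 : (Fintype.card V : ℝ) ≠ 0 := by
    have : Fintype.card V ≠ 0 := by omega
    exact_mod_cast this
  set n := Fintype.card V with hndef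
  set N := G.lapMatrix ℝ - μ • (1 : Matrix V V ℝ) with hN
  have hNij : ∀ i j, N i j = (if i = j then (G.degree i : ℝ) - μ else 0) -
      if G.Adj i j then 1 else 0 := by
    intro i j
    rw [hN, Matrix.sub_apply, lapMatrix_apply_eq, Matrix.smul_apply, Matrix.one_apply]
    split_ifs <;> (simp; try ring)
  have hsum : ∀ i, ∑ j, N i j = -μ := by
    intro i
    simp_rw [hNij, Finset.sum_sub_distrib]
    rw [← G.degree_eq_sum_if_adj (R := ℝ)]
    simp
  have hcol : ∀ j, ∑ i, N i j = -μ := by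
    intro j
    rw [← hsum j]
    refine Finset.sum_congr rfl fun i _ => ?_
    rw [hNij, hNij]
    by_cases hij : i = j
    · subst hij; rfl
    · simp [hij, Ne.symm hij, G.adj_comm]
  have hrank : N.rank = 3 := by
    have := rank_lapMatrix_sub G μ
    rw [h, ← hN, ← hndef] at this
    omega
  let S := Submodule.span ℝ (Set.range N.row)
  have hS : Module.finrank ℝ S = 3 := by rw [← Matrix.rank_eq_finrank_span_row, hrank]
  have hrow : ∀ i, N.row i ∈ S := fun i => Submodule.subset_span ⟨i, rfl⟩
  have hone : (fun _ => 1 : V → ℝ) ∈ S := by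
    have : (fun _ => 1 : V → ℝ) = (-μ)⁻¹ • ∑ i, N.row i := by
      ext j
      have h1 : (∑ i, N.row i) j = -μ := by
        rw [Finset.sum_apply]
        exact hcol j
      rw [Pi.smul_apply, h1, smul_eq_mul, inv_mul_cancel₀ (neg_ne_zero.2 hμ)]
    rw [this]
    exact S.smul_mem _ (S.sum_mem fun i _ => hrow i)
  let M : V → V → ℝ := fun i j => N i j + μ / n
  have hM : ∀ i, (M i) ∈ S := by
    intro i
    have : M i = N.row i + (μ / n) • (fun _ => 1 : V → ℝ) := by
      ext j; simp [M, Matrix.row]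
    rw [this]
    exact S.add_mem (hrow i) (S.smul_mem _ hone)
  have hMsum : ∀ i, ∑ j, M i j = 0 := by
    intro i
    simp only [M, Finset.sum_add_distrib, hsum, Finset.sum_const, Finset.card_univ, nsmul_eq_mul]
    rw [← hndef]
    field_simp
    ring
  refine ⟨M, ?_, ?_, hMsum, ?_⟩
  · intro i j hij
    simp only [M, hNij, if_neg hij.ne, if_pos hij]; ring
  · intro i j hne hij
    simp only [M, hNij, if_neg hne, if_neg hij]; ring
  · intro i j k
    let v : Fin 4 → S := ![⟨M i, hM i⟩, ⟨M j, hM j⟩, ⟨M k, hM k⟩, ⟨_, hone⟩]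
    have hv : ¬LinearIndependent ℝ v := fun hv => by
      have := hv.fintype_card_le_finrank
      rw [hS] at this
      simp at this
    obtain ⟨g, hg, x, hx⟩ := Fintype.not_linearIndependent_iff.1 hv
    have hg' : ∀ y, g 0 * M i y + g 1 * M j y + g 2 * M k y + g 3 = 0 := by
      intro y
      have := congrArg (fun w : S => (w : V → ℝ) y) hg
      simpa [v, Fin.sum_univ_four] using this
    have h3 : g 3 = 0 := by
      have := Finset.sum_congr rfl (fun y (_ : y ∈ Finset.univ) => hg' y)
      simp only [Finset.sum_add_distrib, ← Finset.mul_sum, hMsum, Finset.sum_const,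
        Finset.card_univ, nsmul_eq_mul, ← hndef] at this
      have h4 : (n : ℝ) * g 3 = 0 := by linarith
      exact (mul_eq_zero.1 h4).resolve_left hn0
    refine ⟨g 0, g 1, g 2, ?_, fun y => by simpa [h3] using hg' y⟩
    by_contra hcon
    push Not at hcon
    fin_cases x
    · exact hx hcon.1
    · exact hx hcon.2.1
    · exact hx hcon.2.2
    · exact hx h3

open Classical in
theorem sum_degree_eq_trace {V : Type*} [Fintype V] (G : SimpleGraph V) :
    (∑ v, (G.degree v : ℝ)) = (G.lapMatrix ℝ ^ 1).trace := by
  simp [Matrix.trace, lapMatrix_apply_eq]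

open Classical in
theorem sum_degree_sq_eq_trace {V : Type*} [Fintype V] (G : SimpleGraph V) :
    (∑ v, (G.degree v : ℝ) ^ 2) + ∑ v, (G.degree v : ℝ) = (G.lapMatrix ℝ ^ 2).trace := by
  rw [Matrix.trace, ← Finset.sum_add_distrib]
  refine Finset.sum_congr rfl fun i _ => ?_
  rw [Matrix.diag_apply, sq, sq, Matrix.mul_apply]
  have : ∀ j, G.lapMatrix ℝ i j * G.lapMatrix ℝ j i =
      (if i = j then (G.degree i : ℝ) * G.degree i else 0) + if G.Adj i j then 1 else 0 := by
    intro j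
    rw [lapMatrix_apply_eq, lapMatrix_apply_eq]
    by_cases hij : i = j
    · subst hij; simp
    · by_cases hadj : G.Adj i j <;> simp [hij, Ne.symm hij, G.adj_comm j i, hadj]
  simp_rw [this, Finset.sum_add_distrib]
  rw [← G.degree_eq_sum_if_adj (R := ℝ)]
  simp

open Classical in
theorem sum_degree_eq_of_laplacianSpectrum_eq {V W : Type*} [Fintype V] [Fintype W]
    {G : SimpleGraph V} {H : SimpleGraph W} (h : laplacianSpectrum G = laplacianSpectrum H) :
    ∑ v, G.degree v = ∑ w, H.degree w := by
  have : (∑ v, (G.degree v : ℝ)) = ∑ w, (H.degree w : ℝ) := by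
    rw [sum_degree_eq_trace, sum_degree_eq_trace, trace_lapMatrix_pow, trace_lapMatrix_pow, h]
  exact_mod_cast this

open Classical in
theorem sum_degree_sq_eq_of_laplacianSpectrum_eq {V W : Type*} [Fintype V] [Fintype W]
    {G : SimpleGraph V} {H : SimpleGraph W} (h : laplacianSpectrum G = laplacianSpectrum H) :
    ∑ v, G.degree v ^ 2 = ∑ w, H.degree w ^ 2 := by
  have h1 := sum_degree_sq_eq_trace G
  rw [trace_lapMatrix_pow, h, ← trace_lapMatrix_pow, ← sum_degree_sq_eq_trace H] at h1
  have h2 : (∑ v, (G.degree v : ℝ)) = ∑ w, (H.degree w : ℝ) := by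
    exact_mod_cast sum_degree_eq_of_laplacianSpectrum_eq h
  rw [h2] at h1
  exact_mod_cast add_right_cancel h1

/-! ### Graphs on four and five vertices -/

/-- Position of the pair `i < j < n` in the lexicographic list of all such pairs. The arithmetic on
codes is written with functions that the kernel evaluates efficiently. -/
def pairIndex (n i j : ℕ) : ℕ := Nat.sub (i * n + j) (Nat.div (Nat.mul (i + 1) (i + 2)) 2)

/-- Adjacency in the graph on `0, …, n - 1` whose edge set is given by the binary digits of `g`. -/
def codeAdj (n g i j : ℕ) : Bool :=
  (Nat.blt i j && Nat.testBit g (pairIndex n i j)) ||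
    (Nat.blt j i && Nat.testBit g (pairIndex n j i))

/-- Vertex degrees in the graph with code `g`. -/
def codeDegree (n g i : ℕ) : ℕ := ((List.range n).map fun j => (codeAdj n g i j).toNat).sum

/-- The number of closed walks of length three in the graph with code `g`. -/
def codeTriangles (n g : ℕ) : ℕ :=
  ((List.range n).map fun i => ((List.range n).map fun j => ((List.range n).map fun k =>
    (codeAdj n g i j && (codeAdj n g j k && codeAdj n g k i)).toNat).sum).sum).sum

/-- A number determined by the traces of the first three powers of the Laplacian matrix of the
graph with code `g`: the weights `100` and `10000` combine the sum of degrees, the sum of their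
squares, and the sum of their cubes minus the number of closed walks of length three. There are at
most `60` such walks on five vertices, so the subtraction does not truncate. -/
def codeKey (n g : ℕ) : ℕ :=
  ((List.range n).map fun i => codeDegree n g i).sum +
    100 * ((List.range n).map fun i => codeDegree n g i ^ 2).sum +
    10000 * (((List.range n).map fun i => codeDegree n g i ^ 3).sum + 60 - codeTriangles n g)

/-- If the degrees in the graph with code `g` are weakly increasing, then some ordering of the
vertices turns `g` into the code listed in `T` for its key. -/
def codeCheck (n : ℕ) (T : List (ℕ × ℕ)) (g : ℕ) : Bool :=
  ((List.range (n - 1)).any fun i => Nat.blt (codeDegree n g (i + 1)) (codeDegree n g i)) ||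
  match T.lookup (codeKey n g) with
  | none => false
  | some r => (List.range n).permutations'.any fun l =>
      (List.range n).all fun i => (List.range n).all fun j =>
        codeAdj n g (l.getD i 0) (l.getD j 0) == codeAdj n r i j

/-- The keys of the graphs on four vertices, each with one code. -/
def keysFour : List (ℕ × ℕ) :=
  [(600000, 0), (620202, 1), (640404, 12), (700604, 3), (781006, 13), (781206, 11), (901206, 7),
    (921608, 30), (981808, 15), (1182610, 31), (1443612, 63)]

/-- The keys of the graphs on five vertices, each with one code. -/
def keysFive : List (ℕ × ℕ) :=
  [(600000, 0), (620202, 1), (640404, 20), (700604, 3), (720806, 28), (781006, 21), (781206, 19),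
    (801408, 184), (861408, 58), (901206, 7), (921608, 54), (981608, 29), (981808, 23),
    (1002010, 220), (1062210, 185), (1122210, 62), (1182410, 59), (1182610, 55), (1282008, 15),
    (1323012, 221), (1362610, 31), (1383012, 126), (1383212, 187), (1443212, 207), (1443612, 183),
    (1563412, 63), (1644014, 254), (1764214, 223), (1824414, 191), (1944414, 127), (2085216, 495),
    (2205416, 255), (2646618, 511), (3208020, 1023)]

theorem codeCheck_four : (List.range (2 ^ 6)).all (codeCheck 4 keysFour) = true := by
  decide +kernel

theorem codeCheck_five : (List.range (2 ^ 10)).all (codeCheck 5 keysFive) = true := by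
  decide +kernel

theorem sum_map_range_eq (n : ℕ) (f : ℕ → ℕ) : ((List.range n).map f).sum = ∑ i : Fin n, f i := by
  rw [Fin.sum_univ_eq_sum_range (fun i => f i)]
  rfl

/-- The graph `G`, with its vertices put in some order, has code `g`. -/
def HasCode {V : Type*} (G : SimpleGraph V) (n g : ℕ) (e : V ≃ Fin n) : Prop :=
  ∀ i j : Fin n, codeAdj n g i j = true ↔ G.Adj (e.symm i) (e.symm j)

theorem HasCode.nonempty_iso {V W : Type*} {G : SimpleGraph V} {H : SimpleGraph W} {n g : ℕ}
    {e : V ≃ Fin n} {f : W ≃ Fin n} (hG : HasCode G n g e) (hH : HasCode H n g f) :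
    Nonempty (G ≃g H) := by
  refine ⟨⟨e.trans f.symm, ?_⟩⟩
  intro v w
  have h1 := hG (e v) (e w)
  have h2 := hH (e v) (e w)
  simp only [Equiv.symm_apply_apply] at h1
  rw [Equiv.trans_apply, Equiv.trans_apply, ← h2, h1]

open Classical in
theorem exists_hasCode {V : Type*} [Fintype V] (G : SimpleGraph V) {n N : ℕ}
    (e : V ≃ Fin n) (hlt : ∀ i j : Fin n, i < j → pairIndex n i j < N)
    (hinj : ∀ i j k l : Fin n, i < j → k < l → pairIndex n i j = pairIndex n k l → i = k ∧ j = l) :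
    ∃ g < 2 ^ N, HasCode G n g e := by
  let f : Fin N → Bool := fun x =>
    decide (∃ i j : Fin n, i < j ∧ pairIndex n i j = x ∧ G.Adj (e.symm i) (e.symm j))
  have hf : ∀ i j : Fin n, i < j →
      ((Nat.ofBits f).testBit (pairIndex n i j) = true ↔ G.Adj (e.symm i) (e.symm j)) := by
    intro i j hij
    rw [Nat.testBit_ofBits_lt f _ (hlt i j hij)]
    simp only [f, decide_eq_true_eq]
    constructor
    · rintro ⟨k, l, hkl, hp, hadj⟩
      obtain ⟨rfl, rfl⟩ := hinj _ _ _ _ hkl hij hp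
      exact hadj
    · exact fun h => ⟨i, j, hij, rfl, h⟩
  refine ⟨Nat.ofBits f, Nat.ofBits_lt_two_pow f, fun i j => ?_⟩
  have hb : ∀ i j : Fin n, Nat.blt i j = true ↔ i < j := fun i j => by
    rw [Nat.blt_eq]; rfl
  simp only [codeAdj, Bool.or_eq_true, Bool.and_eq_true, hb]
  rcases lt_trichotomy i j with h | rfl | h
  · rw [hf i j h]; simp [h, h.not_gt]
  · simp
  · rw [hf j i h, G.adj_comm]; simp [h, h.not_gt]

open Classical in
theorem HasCode.codeDegree_eq {V : Type*} [Fintype V] {G : SimpleGraph V} {n g : ℕ}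
    {e : V ≃ Fin n} (h : HasCode G n g e) (i : Fin n) : codeDegree n g i = G.degree (e.symm i) := by
  have h2 : ∀ v, G.degree v = ∑ w, if G.Adj v w then 1 else 0 := fun v => by
    simpa using G.degree_eq_sum_if_adj (R := ℕ) v
  rw [codeDegree, sum_map_range_eq, h2, ← e.symm.sum_comp]
  refine Finset.sum_congr rfl fun j _ => ?_
  rw [Bool.toNat, if_congr (h i j).symm rfl rfl]
  cases codeAdj n g i j <;> rfl

open Classical in
theorem HasCode.codeTriangles_eq {V : Type*} [Fintype V] {G : SimpleGraph V} {n g : ℕ}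
    {e : V ≃ Fin n} (h : HasCode G n g e) : codeTriangles n g =
      ∑ u, ∑ v, ∑ w, if G.Adj u v ∧ G.Adj v w ∧ G.Adj w u then 1 else 0 := by
  rw [codeTriangles, sum_map_range_eq, ← e.symm.sum_comp]
  refine Finset.sum_congr rfl fun i _ => ?_
  rw [sum_map_range_eq, ← e.symm.sum_comp]
  refine Finset.sum_congr rfl fun j _ => ?_
  rw [sum_map_range_eq, ← e.symm.sum_comp]
  refine Finset.sum_congr rfl fun k _ => ?_
  rw [← h, ← h, ← h]
  cases codeAdj n g i j <;> cases codeAdj n g j k <;> cases codeAdj n g k i <;> simp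

open Classical in
theorem sum_degree_cube_eq_trace {V : Type*} [Fintype V] (G : SimpleGraph V) :
    (∑ v, (G.degree v : ℝ) ^ 3) + 3 * ∑ v, (G.degree v : ℝ) ^ 2 =
      (G.lapMatrix ℝ ^ 3).trace +
        ∑ u, ∑ v, ∑ w, if G.Adj u v ∧ G.Adj v w ∧ G.Adj w u then 1 else 0 := by
  set D := G.degMatrix ℝ with hD
  set A := G.adjMatrix ℝ with hA
  have h1 : (D * D * D).trace = ∑ v, (G.degree v : ℝ) ^ 3 := by
    simp [hD, SimpleGraph.degMatrix, Matrix.trace, pow_succ]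
  have h2 : (D * D * A).trace = 0 := by
    refine Finset.sum_eq_zero fun v _ => ?_
    rw [Matrix.diag_apply, hD, SimpleGraph.degMatrix, Matrix.diagonal_mul_diagonal,
      Matrix.diagonal_mul, hA, SimpleGraph.adjMatrix_apply, if_neg (G.irrefl), mul_zero]
  have h3 : (D * (A * A)).trace = ∑ v, (G.degree v : ℝ) ^ 2 := by
    refine Finset.sum_congr rfl fun v _ => ?_
    rw [Matrix.diag_apply, hD, SimpleGraph.degMatrix, Matrix.diagonal_mul, hA,
      SimpleGraph.adjMatrix_mul_self_apply_self, sq]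
  have h4 : (A * (A * A)).trace =
      ∑ u, ∑ v, ∑ w, if G.Adj u v ∧ G.Adj v w ∧ G.Adj w u then 1 else 0 := by
    refine Finset.sum_congr rfl fun u _ => ?_
    rw [Matrix.diag_apply, Matrix.mul_apply]
    refine Finset.sum_congr rfl fun v _ => ?_
    rw [Matrix.mul_apply, Finset.mul_sum]
    refine Finset.sum_congr rfl fun w _ => ?_
    simp only [hA, SimpleGraph.adjMatrix_apply]
    by_cases huv : G.Adj u v <;> by_cases hvw : G.Adj v w <;> by_cases hwu : G.Adj w u <;>
      simp [huv, hvw, hwu]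
  have h5 : G.lapMatrix ℝ ^ 3 = D * D * D - D * D * A - D * A * D - A * D * D + D * (A * A)
      + A * D * A + A * A * D - A * (A * A) := by
    rw [SimpleGraph.lapMatrix, ← hD, ← hA]
    noncomm_ring
  have h6 : (D * A * D).trace = 0 := by rw [Matrix.trace_mul_comm, ← mul_assoc, h2]
  have h7 : (A * D * D).trace = 0 := by
    rw [mul_assoc, Matrix.trace_mul_comm, h2]
  have h8 : (A * D * A).trace = (D * (A * A)).trace := by
    rw [mul_assoc, Matrix.trace_mul_comm, mul_assoc]
  have h9 : (A * A * D).trace = (D * (A * A)).trace := by rw [Matrix.trace_mul_comm]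
  rw [h5]
  simp only [Matrix.trace_add, Matrix.trace_sub, h1, h2, h3, h4, h6, h7, h8, h9]
  ring

open Classical in
theorem HasCode.codeKey_eq {V W : Type*} [Fintype V] [Fintype W] {G : SimpleGraph V}
    {H : SimpleGraph W} {n g k : ℕ} {e : V ≃ Fin n} {f : W ≃ Fin n} (hG : HasCode G n g e)
    (hH : HasCode H n k f) (h : laplacianSpectrum G = laplacianSpectrum H) :
    codeKey n g = codeKey n k := by
  have h1 := sum_degree_eq_of_laplacianSpectrum_eq h
  have h2 := sum_degree_sq_eq_of_laplacianSpectrum_eq h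
  have h3 : ∑ v, G.degree v ^ 3 + codeTriangles n k = ∑ w, H.degree w ^ 3 + codeTriangles n g := by
    have h4 := sum_degree_cube_eq_trace G
    have h5 := sum_degree_cube_eq_trace H
    rw [trace_lapMatrix_pow, h, ← trace_lapMatrix_pow] at h4
    have h6 : (∑ v, (G.degree v : ℝ) ^ 2) = ∑ w, (H.degree w : ℝ) ^ 2 := by exact_mod_cast h2
    rw [hG.codeTriangles_eq, hH.codeTriangles_eq]
    have : ((∑ v, G.degree v ^ 3 +
        ∑ u, ∑ v, ∑ w, (if H.Adj u v ∧ H.Adj v w ∧ H.Adj w u then 1 else 0) : ℕ) : ℝ) =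
        ((∑ w, H.degree w ^ 3 +
        ∑ u, ∑ v, ∑ w, (if G.Adj u v ∧ G.Adj v w ∧ G.Adj w u then 1 else 0) : ℕ) : ℝ) := by
      push_cast
      linarith
    exact_mod_cast this
  have key : ∀ (p : ℕ), ((List.range n).map fun i => codeDegree n g i ^ p).sum =
      ∑ v, G.degree v ^ p := fun p => by
    rw [sum_map_range_eq, ← e.symm.sum_comp]
    exact Finset.sum_congr rfl fun i _ => by rw [hG.codeDegree_eq]
  have key' : ∀ (p : ℕ), ((List.range n).map fun i => codeDegree n k i ^ p).sum =
      ∑ v, H.degree v ^ p := fun p => by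
    rw [sum_map_range_eq, ← f.symm.sum_comp]
    exact Finset.sum_congr rfl fun i _ => by rw [hH.codeDegree_eq]
  have k1 := key 1
  have k1' := key' 1
  simp only [pow_one] at k1 k1'
  rw [codeKey, codeKey, k1, k1', key, key, key', key', h1, h2]
  omega

/-- Sorting the vertices by degree. -/
theorem exists_equiv_monotone {V : Type*} [Fintype V] (d : V → ℕ) {n : ℕ}
    (hn : Fintype.card V = n) : ∃ e : V ≃ Fin n, Monotone fun i => d (e.symm i) := by
  let e := Fintype.equivFinOfCardEq hn
  refine ⟨e.trans (Tuple.sort (d ∘ e.symm)).symm, ?_⟩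
  exact Tuple.monotone_sort (d ∘ e.symm)

theorem HasCode.of_codeCheck {V : Type*} {G : SimpleGraph V} {n g : ℕ} {T : List (ℕ × ℕ)}
    {e : V ≃ Fin n} (h : HasCode G n g e)
    (hd : ∀ i < n - 1, codeDegree n g i ≤ codeDegree n g (i + 1)) (hT : codeCheck n T g = true) :
    ∃ r f, T.lookup (codeKey n g) = some r ∧ HasCode G n r f := by
  rw [codeCheck, Bool.or_eq_true] at hT
  rcases hT with hT | hT
  · obtain ⟨i, hi, hlt⟩ := List.any_eq_true.1 hT
    rw [Nat.blt_eq] at hlt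
    exact absurd (hd i (List.mem_range.1 hi)) (by omega)
  · split at hT
    · cases hT
    · rename_i r hr
      obtain ⟨l, hl, hl'⟩ := List.any_eq_true.1 hT
      rw [List.mem_permutations'] at hl
      have hlen : l.length = n := by simpa using hl.length_eq
      have hnd : l.Nodup := hl.nodup_iff.2 List.nodup_range
      have hmem : ∀ i : Fin n, l.getD i 0 < n := by
        intro i
        have hi : (i : ℕ) < l.length := by omega
        rw [List.getD_eq_getElem _ _ hi]
        exact List.mem_range.1 (hl.subset (List.getElem_mem hi))
      let s : Fin n → Fin n := fun i => ⟨l.getD i 0, hmem i⟩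
      have hs : Function.Injective s := by
        intro i j hij
        have hi : (i : ℕ) < l.length := by omega
        have hj : (j : ℕ) < l.length := by omega
        have := congrArg Fin.val hij
        simp only [s] at this
        rw [List.getD_eq_getElem _ _ hi, List.getD_eq_getElem _ _ hj] at this
        exact Fin.ext ((hnd.getElem_inj_iff).1 this)
      let σ : Fin n ≃ Fin n := Equiv.ofBijective s (Finite.injective_iff_bijective.1 hs)
      refine ⟨r, e.trans σ.symm, hr, fun i j => ?_⟩
      have h1 := List.all_eq_true.1 hl' i (List.mem_range.2 i.2)
      have h2 := List.all_eq_true.1 h1 j (List.mem_range.2 j.2)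
      rw [← beq_iff_eq.1 h2]
      exact h (s i) (s j)

open Classical in
/-- Graphs with the same Laplacian spectrum are isomorphic as soon as the finite check `codeCheck`
succeeds for all codes. -/
theorem nonempty_iso_of_codeCheck {V W : Type*} [Fintype V] [Fintype W] {G : SimpleGraph V}
    {H : SimpleGraph W} {n N : ℕ} {T : List (ℕ × ℕ)}
    (hT : (List.range (2 ^ N)).all (codeCheck n T) = true)
    (hlt : ∀ i j : Fin n, i < j → pairIndex n i j < N)
    (hinj : ∀ i j k l : Fin n, i < j → k < l → pairIndex n i j = pairIndex n k l → i = k ∧ j = l)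
    (hV : Fintype.card V = n) (hW : Fintype.card W = n)
    (h : laplacianSpectrum G = laplacianSpectrum H) : Nonempty (G ≃g H) := by
  obtain ⟨e, he⟩ := exists_equiv_monotone (fun v => G.degree v) hV
  obtain ⟨f, hf⟩ := exists_equiv_monotone (fun v => H.degree v) hW
  obtain ⟨g, hg, hG⟩ := exists_hasCode G e hlt hinj
  obtain ⟨k, hk, hH⟩ := exists_hasCode H f hlt hinj
  obtain ⟨r, e', hr, hGr⟩ := hG.of_codeCheck (fun i hi => by
    rw [hG.codeDegree_eq ⟨i, by omega⟩, hG.codeDegree_eq ⟨i + 1, by omega⟩]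
    exact he (by simp [Fin.le_def])) (List.all_eq_true.1 hT g (List.mem_range.2 hg))
  obtain ⟨r', f', hr', hHr⟩ := hH.of_codeCheck (fun i hi => by
    rw [hH.codeDegree_eq ⟨i, by omega⟩, hH.codeDegree_eq ⟨i + 1, by omega⟩]
    exact hf (by simp [Fin.le_def])) (List.all_eq_true.1 hT k (List.mem_range.2 hk))
  rw [hG.codeKey_eq hH h, hr', Option.some_inj] at hr
  subst hr
  exact hGr.nonempty_iso hHr

theorem nonempty_iso_of_card_eq_four {V W : Type*} [Fintype V] [Fintype W] {G : SimpleGraph V}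
    {H : SimpleGraph W} (hV : Fintype.card V = 4) (hW : Fintype.card W = 4)
    (h : laplacianSpectrum G = laplacianSpectrum H) : Nonempty (G ≃g H) :=
  nonempty_iso_of_codeCheck codeCheck_four (by decide) (by decide) hV hW h

theorem nonempty_iso_of_card_eq_five {V W : Type*} [Fintype V] [Fintype W] {G : SimpleGraph V}
    {H : SimpleGraph W} (hV : Fintype.card V = 5) (hW : Fintype.card W = 5)
    (h : laplacianSpectrum G = laplacianSpectrum H) : Nonempty (G ≃g H) :=
  nonempty_iso_of_codeCheck codeCheck_five (by decide) (by decide) hV hW h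

/-! ### Rows of a rank-two matrix -/

/-- Two rows of `M` are linearly independent. -/
def IndepRows {V : Type*} (M : V → V → ℝ) (i j : V) : Prop :=
  ∀ s t : ℝ, (∀ x, s * M i x + t * M j x = 0) → s = 0 ∧ t = 0

theorem IndepRows.symm {V : Type*} {M : V → V → ℝ} {i j : V} (h : IndepRows M i j) :
    IndepRows M j i := fun s t hst =>
  (h t s fun x => by rw [add_comm]; exact hst x).symm

theorem IndepRows.row_ne {V : Type*} {M : V → V → ℝ} {i j : V} (h : IndepRows M i j) :
    M i ≠ M j := fun hij => by
  have := (h 1 (-1) fun x => by rw [hij]; ring).1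
  norm_num at this

namespace IsRankTwo

variable {V : Type*} [Fintype V] {G : SimpleGraph V} {α : ℝ} {M : V → V → ℝ}

theorem symm (h : IsRankTwo G α M) (i j : V) : M i j = M j i := by
  rcases eq_or_ne i j with rfl | hij
  · rfl
  · by_cases hadj : G.Adj i j
    · rw [h.apply_adj hadj, h.apply_adj hadj.symm]
    · rw [h.apply_not_adj hij hadj, h.apply_not_adj hij.symm (fun h' => hadj h'.symm)]

theorem apply_eq (h : IsRankTwo G α M) {i j : V} (hij : i ≠ j) : M i j = α ∨ M i j = α - 1 := by
  by_cases hadj : G.Adj i j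
  · exact Or.inr (h.apply_adj hadj)
  · exact Or.inl (h.apply_not_adj hij hadj)

theorem adj_iff (h : IsRankTwo G α M) {i j : V} (hij : i ≠ j) : G.Adj i j ↔ M i j = α - 1 := by
  refine ⟨fun hadj => h.apply_adj hadj, fun h' => ?_⟩
  by_contra hadj
  have := h.apply_not_adj hij hadj
  linarith

/-- All minors of order three vanish. -/
theorem minor_eq_zero (h : IsRankTwo G α M) (i j k a b c : V) :
    M i a * (M j b * M k c - M j c * M k b) - M i b * (M j a * M k c - M j c * M k a) +
      M i c * (M j a * M k b - M j b * M k a) = 0 := by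
  obtain ⟨r, s, t, h0, h1⟩ := h.dep i j k
  have ha := h1 a
  have hb := h1 b
  have hc := h1 c
  rcases h0 with h0 | h0 | h0 <;> refine (mul_eq_zero.1 ?_).resolve_left h0
  · linear_combination (M j b * M k c - M j c * M k b) * ha -
      (M j a * M k c - M j c * M k a) * hb + (M j a * M k b - M j b * M k a) * hc
  · linear_combination (M i c * M k b - M i b * M k c) * ha +
      (M i a * M k c - M i c * M k a) * hb - (M i a * M k b - M i b * M k a) * hc
  · linear_combination (M i b * M j c - M i c * M j b) * ha -
      (M i a * M j c - M i c * M j a) * hb + (M i a * M j b - M i b * M j a) * hc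

/-- Vanishing of the minors of order two of the Schur complement of the entry `M p p`. -/
theorem schur_minor (h : IsRankTwo G α M) (p j k b c : V) :
    (M p p * M j b - M p j * M p b) * (M p p * M k c - M p k * M p c) =
      (M p p * M j c - M p j * M p c) * (M p p * M k b - M p k * M p b) := by
  have h1 := h.minor_eq_zero p j k p b c
  rw [h.symm j p, h.symm k p] at h1
  linear_combination M p p * h1

theorem exists_eq_combination (h : IsRankTwo G α M) {i j : V} (hij : IndepRows M i j) (k : V) :
    ∃ s t : ℝ, ∀ x, M k x = s * M i x + t * M j x := by
  obtain ⟨r, s, t, h0, h1⟩ := h.dep i j k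
  have ht : t ≠ 0 := by
    rintro rfl
    have := hij r s fun x => by linarith [h1 x]
    tauto
  refine ⟨-r / t, -s / t, fun x => ?_⟩
  field_simp
  linarith [h1 x]

/-- Given two independent rows `i` and `j`, any row is determined by its entries in the
columns `i` and `j`; here in a version up to a scalar factor. -/
theorem row_eq_mul (h : IsRankTwo G α M) {i j k l : V} (hij : IndepRows M i j) {c : ℝ}
    (hi : M k i = c * M l i) (hj : M k j = c * M l j) (x : V) : M k x = c * M l x := by
  obtain ⟨s, t, hk⟩ := h.exists_eq_combination hij k
  obtain ⟨s', t', hl⟩ := h.exists_eq_combination hij l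
  obtain ⟨u, v, hx⟩ := h.exists_eq_combination hij x
  rw [hk i, hl i] at hi
  rw [hk j, hl j] at hj
  rw [hk x, hl x, h.symm i x, h.symm j x, hx i, hx j, h.symm j i]
  rw [h.symm j i] at hi
  linear_combination u * hi + v * hj

theorem row_eq (h : IsRankTwo G α M) {i j k l : V} (hij : IndepRows M i j)
    (hi : M k i = M l i) (hj : M k j = M l j) : M k = M l := by
  funext x
  simpa using h.row_eq_mul (c := 1) hij (by simpa using hi) (by simpa using hj) x

/-- Dependent rows are proportional: for `α ≠ 0, 1` no row vanishes. -/
theorem exists_eq_smul (h : IsRankTwo G α M) (h0 : α ≠ 0) (h1 : α ≠ 1)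
    (hV : 2 ≤ Fintype.card V) {i j : V} (hij : ¬IndepRows M i j) :
    ∃ c : ℝ, ∀ x, M j x = c * M i x := by
  simp only [IndepRows, not_forall] at hij
  obtain ⟨s, t, hst, hne⟩ := hij
  have ht : t ≠ 0 := by
    rintro rfl
    have hs : s ≠ 0 := fun hs => hne ⟨hs, rfl⟩
    have : Nontrivial V := Fintype.one_lt_card_iff_nontrivial.1 hV
    obtain ⟨k, hk⟩ := exists_ne i
    have h2 := hst k
    simp only [zero_mul, add_zero, mul_eq_zero, hs, false_or] at h2
    rcases h.apply_eq hk.symm with h3 | h3 <;> rw [h3] at h2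
    · exact h0 h2
    · exact h1 (by linarith)
  refine ⟨-s / t, fun x => ?_⟩
  field_simp
  linarith [hst x]

/-- Independent rows have a nonzero Gram determinant. -/
theorem gram_ne_zero (h : IsRankTwo G α M) {i j : V} (hij : IndepRows M i j) :
    M i i * M j j - M i j ^ 2 ≠ 0 := by
  intro hdet
  have key : ∀ s t : ℝ, s * M i i + t * M i j = 0 → s * M i j + t * M j j = 0 →
      s = 0 ∧ t = 0 := by
    intro s t h1 h2
    refine hij s t fun x => ?_
    obtain ⟨u, v, hx⟩ := h.exists_eq_combination hij x
    rw [h.symm i x, h.symm j x, hx i, hx j, h.symm j i]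
    linear_combination u * h1 + v * h2
  have h1 := key (M i j) (-M i i) (by ring) (by linear_combination -hdet)
  have h2 := key (M j j) (-M i j) (by linear_combination hdet) (by ring)
  have h3 := key 1 0 (by linarith [h1.2]) (by linarith [h1.1])
  exact one_ne_zero h3.1

/-- If two rows agree, they agree with the diagonal entries. -/
theorem diag_eq_of_row_eq (h : IsRankTwo G α M) {i j : V} (hij : M i = M j) : M i i = M i j := by
  conv_rhs => rw [h.symm i j, ← hij]

end IsRankTwo

/-! ### Graphs with few special vertices -/

/-- A sum of a function that is constant outside the special vertices `s i`. -/
theorem sum_eq_sum_special {V R : Type*} [Fintype V] [CommRing R] {r : ℕ} {s : Fin r → V}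
    (hs : Function.Injective s) {f : V → R} {z : R} (hf : ∀ v, (∀ i, v ≠ s i) → f v = z) :
    ∑ v, f v = (∑ i, f (s i)) + (Fintype.card V - r) * z := by
  classical
  have h1 : ∑ v, f v = ∑ v, (f v - z) + Fintype.card V * z := by simp
  have h2 : ∑ v, (f v - z) = ∑ i, (f (s i) - z) := by
    rw [← Finset.sum_image (f := fun v => f v - z) (s := Finset.univ) (g := s)
      (fun a _ b _ hab => hs hab)]
    refine (Finset.sum_subset (Finset.subset_univ _) fun v _ hv => ?_).symm
    rw [hf v, sub_self]
    intro i hi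
    exact hv (Finset.mem_image.2 ⟨i, Finset.mem_univ _, hi.symm⟩)
  rw [h1, h2, Finset.sum_sub_distrib]
  simp
  ring

/-- A criterion for being a blow-up when all but a few special vertices `s i` have the same
colour `e`. -/
theorem isBlowup_of_special {V : Type*} [Fintype V] {G : SimpleGraph V} {k r : ℕ}
    (P : Fin k → Fin k → Bool) {m : Fin k → ℕ} {s : Fin r → V} (a : Fin r → Fin k) (e : Fin k)
    (hP : ∀ x y, P x y = P y x) (hs : Function.Injective s)
    (h1 : ∀ i j, i < j → (G.Adj (s i) (s j) ↔ P (a i) (a j) = true))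
    (h2 : ∀ i v, (∀ j, v ≠ s j) → (G.Adj (s i) v ↔ P (a i) e = true))
    (h3 : ∀ v w, v ≠ w → (∀ j, v ≠ s j) → (∀ j, w ≠ s j) → (G.Adj v w ↔ P e e = true))
    (hm : ∀ x, (∑ i, if a i = x then 1 else 0) + (if e = x then (Fintype.card V : ℤ) - r else 0)
      = m x) : IsBlowup G P m := by
  classical
  let c : V → Fin k := fun v => if h : ∃ i, s i = v then a h.choose else e
  have hcs : ∀ i, c (s i) = a i := fun i => by
    have h : ∃ j, s j = s i := ⟨i, rfl⟩
    simp only [c, dif_pos h, hs h.choose_spec]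
  have hce : ∀ v, (∀ i, v ≠ s i) → c v = e := fun v hv => by
    have h : ¬∃ i, s i = v := fun ⟨i, hi⟩ => hv i hi.symm
    simp only [c, dif_neg h]
  have hcase : ∀ v, (∃ i, v = s i) ∨ ∀ i, v ≠ s i := fun v => by
    by_cases h : ∃ i, v = s i
    · exact Or.inl h
    · exact Or.inr fun i hi => h ⟨i, hi⟩
  refine ⟨c, fun v w hvw => ?_, fun x => ?_⟩
  · rcases hcase v with ⟨i, rfl⟩ | hv <;> rcases hcase w with ⟨j, rfl⟩ | hw
    · rw [hcs, hcs]
      rcases lt_trichotomy i j with hij | rfl | hij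
      · exact h1 i j hij
      · exact absurd rfl hvw
      · rw [G.adj_comm, hP]; exact h1 j i hij
    · rw [hcs, hce w hw]; exact h2 i w hw
    · rw [hcs, hce v hv, G.adj_comm, hP]; exact h2 j v hv
    · rw [hce v hv, hce w hw]; exact h3 v w hvw hv hw
  · have h4 : (Nat.card {v // c v = x} : ℤ) = ∑ v, if c v = x then 1 else 0 := by
      rw [Nat.card_eq_fintype_card, Fintype.card_subtype]
      simp
    have h5 := sum_eq_sum_special (R := ℤ) hs (f := fun v => if c v = x then 1 else 0)
      (z := if e = x then 1 else 0) (fun v hv => by rw [hce v hv])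
    have : (Nat.card {v // c v = x} : ℤ) = m x := by
      rw [h4, h5, ← hm x]
      congr 1
      · exact Finset.sum_congr rfl fun i _ => by rw [hcs]
      · simp
    exact_mod_cast this

/-- The pattern of `K_{a,b}` with `c` isolated vertices, for class sizes `a`, `b`, `c`. -/
def bipartitePattern : Fin 3 → Fin 3 → Bool :=
  ![![false, true, false], ![true, false, false], ![false, false, false]]

/-- The pattern of the join of a clique and a coclique. -/
def splitPattern : Fin 2 → Fin 2 → Bool := ![![true, true], ![true, false]]

/-- The pattern of a vertex joined to a coclique and a clique. -/
def conePattern : Fin 3 → Fin 3 → Bool :=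
  ![![false, true, true], ![true, false, false], ![true, false, true]]

/-- If the row of `p` spans the rows of all vertices but `j`, `k`, `l`, then the Schur complement
`R` of the entry `M p p`, scaled by `M p p`, is supported on `{j, k, l}`. It has zero row sums and
rank at most one, so the second elementary symmetric function of its off-diagonal entries vanishes. -/
theorem IsRankTwo.schur_triangle {V : Type*} [Fintype V] {G : SimpleGraph V} {α : ℝ}
    {M : V → V → ℝ} (h : IsRankTwo G α M) {p j k l : V} (hjk : j ≠ k) (hjl : j ≠ l) (hkl : k ≠ l)
    (hp : ∀ v, v ≠ j → v ≠ k → v ≠ l → ∀ x, M p p * M v x = M p v * M p x) :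
    (M p p * M j k - M p j * M p k) * (M p p * M j l - M p j * M p l) +
      (M p p * M j k - M p j * M p k) * (M p p * M k l - M p k * M p l) +
      (M p p * M j l - M p j * M p l) * (M p p * M k l - M p k * M p l) = 0 ∧
    (M p p * M j j - M p j * M p j) + (M p p * M j k - M p j * M p k) +
      (M p p * M j l - M p j * M p l) = 0 := by
  have hs : Function.Injective ![j, k, l] := by
    intro a b hab
    fin_cases a <;> fin_cases b <;> simp_all
  have hsum : ∀ i, (M p p * M i j - M p i * M p j) + (M p p * M i k - M p i * M p k) +
      (M p p * M i l - M p i * M p l) = 0 := by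
    intro i
    have h1 := sum_eq_sum_special hs (f := fun v => M p p * M i v - M p i * M p v) (z := 0)
      (fun v hv => by
        have := hp v (hv 0) (hv 1) (hv 2) i
        rw [h.symm i v, this]; ring)
    rw [Finset.sum_sub_distrib, ← Finset.mul_sum, ← Finset.mul_sum, h.sum_row, h.sum_row,
      Fin.sum_univ_three] at h1
    simp only [Matrix.cons_val_zero, Matrix.cons_val_one, Matrix.cons_val] at h1
    linarith
  have h1 := h.schur_minor p j k j k
  have h2 := hsum j
  have h3 := hsum k
  rw [h.symm k j] at h1 h3
  refine ⟨?_, h2⟩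
  have e1 : M p p * M j j - M p j * M p j =
    -((M p p * M j k - M p j * M p k) + (M p p * M j l - M p j * M p l)) := by linarith
  have e2 : M p p * M k k - M p k * M p k =
    -((M p p * M j k - M p j * M p k) + (M p p * M k l - M p k * M p l)) := by linarith
  rw [e1, e2] at h1
  linear_combination h1

namespace IsRankTwo

variable {V : Type*} [Fintype V] {G : SimpleGraph V} {α : ℝ} {M : V → V → ℝ}

theorem adj_or (h : IsRankTwo G α M) {i j : V} (hij : i ≠ j) :
    (G.Adj i j ∧ M i j = α - 1) ∨ (¬G.Adj i j ∧ M i j = α - 0) := by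
  by_cases hadj : G.Adj i j
  · exact Or.inl ⟨hadj, h.apply_adj hadj⟩
  · exact Or.inr ⟨hadj, by rw [h.apply_not_adj hij hadj, sub_zero]⟩

/-- The situation that all rows of `M` but those of `j`, `k`, `l` agree with the row of `p`, and
their vertices form a coclique. -/
structure CocliqueAndThree (M : V → V → ℝ) (α : ℝ) (p j k l : V) : Prop where
  jk : j ≠ k
  jl : j ≠ l
  kl : k ≠ l
  pj : p ≠ j
  pk : p ≠ k
  pl : p ≠ l
  row : ∀ v, v ≠ j → v ≠ k → v ≠ l → M v = M p
  diag : M p p = α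

omit [Fintype V] in
theorem CocliqueAndThree.injective {p j k l : V} (c : CocliqueAndThree M α p j k l) :
    Function.Injective ![j, k, l] := by
  have h1 := c.jk
  have h2 := c.jl
  have h3 := c.kl
  intro a b hab
  fin_cases a <;> fin_cases b <;> simp_all

/-- `G` is the blow-up given by its adjacencies on `p`, `j`, `k`, `l`, with colours `a` for `j`,
`k`, `l` and `e` for all other vertices. -/
theorem CocliqueAndThree.isBlowup {p j k l : V} (c : CocliqueAndThree M α p j k l)
    (h : IsRankTwo G α M) {r : ℕ} (P : Fin r → Fin r → Bool) (m : Fin r → ℕ) (a : Fin 3 → Fin r)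
    (e : Fin r) (hP : ∀ x y, P x y = P y x) (hjk : G.Adj j k ↔ P (a 0) (a 1) = true)
    (hjl : G.Adj j l ↔ P (a 0) (a 2) = true) (hkl : G.Adj k l ↔ P (a 1) (a 2) = true)
    (hpj : G.Adj p j ↔ P (a 0) e = true) (hpk : G.Adj p k ↔ P (a 1) e = true)
    (hpl : G.Adj p l ↔ P (a 2) e = true) (he : P e e = false)
    (hm : ∀ x, (∑ i, if a i = x then 1 else 0) + (if e = x then (Fintype.card V : ℤ) - 3 else 0)
      = m x) : IsBlowup G P m := by
  refine isBlowup_of_special P a e hP c.injective ?_ ?_ ?_ (by exact_mod_cast hm)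
  · intro x y hxy
    fin_cases x <;> fin_cases y <;> first | exact absurd hxy (by decide) | assumption
  · intro x v hv
    have hrow := c.row v (hv 0) (hv 1) (hv 2)
    have key : ∀ s, v ≠ s → p ≠ s → (G.Adj s v ↔ G.Adj p s) := fun s h1 h2 => by
      rw [G.adj_comm, h.adj_iff h1, h.adj_iff h2, hrow]
    fin_cases x
    · exact (key j (hv 0) c.pj).trans hpj
    · exact (key k (hv 1) c.pk).trans hpk
    · exact (key l (hv 2) c.pl).trans hpl
  · intro v w hvw hv hw
    rw [he, h.adj_iff hvw, c.row v (hv 0) (hv 1) (hv 2), h.symm, c.row w (hw 0) (hw 1) (hw 2),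
      c.diag]
    constructor
    · intro hc; linarith
    · intro hc; cases hc

/-- The relation of `schur_triangle` in terms of adjacencies: `uj, uk, ul` are those of `p` to `j`,
`k`, `l`, and `ajk, ajl, akl` those among `j`, `k`, `l`. -/
theorem CocliqueAndThree.relation {p j k l : V} (c : CocliqueAndThree M α p j k l)
    (h : IsRankTwo G α M) {uj uk ul ajk ajl akl : ℝ} (hj : M p j = α - uj) (hk : M p k = α - uk)
    (hl : M p l = α - ul) (hjk : M j k = α - ajk) (hjl : M j l = α - ajl)
    (hkl : M k l = α - akl) {n : ℝ} (hn : (Fintype.card V : ℝ) = n) :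
    α * n = uj + uk + ul ∧
    ((uj + uk + ul) * (uj + uk - ajk) - n * (uj * uk)) *
        ((uj + uk + ul) * (uj + ul - ajl) - n * (uj * ul)) +
      ((uj + uk + ul) * (uj + uk - ajk) - n * (uj * uk)) *
        ((uj + uk + ul) * (uk + ul - akl) - n * (uk * ul)) +
      ((uj + uk + ul) * (uj + ul - ajl) - n * (uj * ul)) *
        ((uj + uk + ul) * (uk + ul - akl) - n * (uk * ul)) = 0 := by
  have h1 : α * n = uj + uk + ul := by
    have h2 := sum_eq_sum_special c.injective (f := M p) (z := α) (fun v hv => by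
      rw [h.symm, c.row v (hv 0) (hv 1) (hv 2), c.diag])
    rw [h.sum_row, Fin.sum_univ_three, hn] at h2
    simp only [Matrix.cons_val_zero, Matrix.cons_val_one, Matrix.cons_val] at h2
    rw [hj, hk, hl] at h2
    push_cast at h2
    linarith
  refine ⟨h1, ?_⟩
  have h2 := (h.schur_triangle (p := p) c.jk c.jl c.kl (fun v h1 h2 h3 x => by
    rw [c.row v h1 h2 h3, h.symm p v, c.row v h1 h2 h3])).1
  rw [c.diag, hj, hk, hl, hjk, hjl, hkl] at h2
  rw [← h1]
  linear_combination n ^ 2 * h2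

/-- For `α * n = 1`: a star on `n - 1` vertices with an isolated vertex, a star on `n` vertices, or
such a star with an edge added. For `α * n = 2`: `K_{2, n-2}`, or the same graph with an edge
joining the two vertices of the small part. -/
def SmallCase {V : Type*} [Fintype V] (G : SimpleGraph V) (α : ℝ) : Prop :=
  (α * Fintype.card V = 1 ∧
    (IsBlowup G bipartitePattern ![1, Fintype.card V - 2, 1] ∨
      IsBlowup G bipartitePattern ![1, Fintype.card V - 1, 0] ∨
      IsBlowup G conePattern ![1, Fintype.card V - 3, 2])) ∨
  (α * Fintype.card V = 2 ∧
    (IsBlowup G bipartitePattern ![2, Fintype.card V - 2, 0] ∨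
      IsBlowup G splitPattern ![2, Fintype.card V - 2]))

theorem bipartitePattern_symm : ∀ x y, bipartitePattern x y = bipartitePattern y x := by decide

theorem splitPattern_symm : ∀ x y, splitPattern x y = splitPattern y x := by decide

theorem conePattern_symm : ∀ x y, conePattern x y = conePattern y x := by decide

theorem CocliqueAndThree.smallCase_of_one_adj {p j k l : V} (c : CocliqueAndThree M α p j k l)
    (h : IsRankTwo G α M) (hn : 6 ≤ Fintype.card V) (hj : G.Adj p j) (hk : ¬G.Adj p k)
    (hl : ¬G.Adj p l) : SmallCase G α := by
  have r := fun {ajk ajl akl} => c.relation h (uj := 1) (uk := 0) (ul := 0) (ajk := ajk)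
    (ajl := ajl) (akl := akl) (h.apply_adj hj) (by rw [h.apply_not_adj c.pk hk]; ring)
    (by rw [h.apply_not_adj c.pl hl]; ring)
  refine Or.inl ?_
  rcases h.adj_or c.jk with ⟨hjk, mjk⟩ | ⟨hjk, mjk⟩ <;>
    rcases h.adj_or c.jl with ⟨hjl, mjl⟩ | ⟨hjl, mjl⟩ <;>
    rcases h.adj_or c.kl with ⟨hkl, mkl⟩ | ⟨hkl, mkl⟩ <;>
    obtain ⟨r1, r2⟩ := r mjk mjl mkl rfl <;> norm_num at r1 r2 <;> refine ⟨r1, ?_⟩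
  · refine Or.inr (Or.inr (c.isBlowup h _ _ ![0, 2, 2] 1 conePattern_symm ?_ ?_ ?_ ?_ ?_ ?_ ?_ ?_))
    all_goals first | simp [hj, hk, hl, hjk, hjl, hkl, conePattern]; done | skip
    intro x; rw [Fin.sum_univ_three]; fin_cases x <;> simp; omega
  · refine Or.inr (Or.inl (c.isBlowup h _ _ ![0, 1, 1] 1 bipartitePattern_symm
      ?_ ?_ ?_ ?_ ?_ ?_ ?_ ?_))
    all_goals first | simp [hj, hk, hl, hjk, hjl, hkl, bipartitePattern]; done | skip
    intro x; rw [Fin.sum_univ_three]; fin_cases x <;> simp; omega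
  · refine Or.inl (c.isBlowup h _ _ ![0, 1, 2] 1 bipartitePattern_symm ?_ ?_ ?_ ?_ ?_ ?_ ?_ ?_)
    all_goals first | simp [hj, hk, hl, hjk, hjl, hkl, bipartitePattern]; done | skip
    intro x; rw [Fin.sum_univ_three]; fin_cases x <;> simp; omega
  · refine Or.inl (c.isBlowup h _ _ ![0, 2, 1] 1 bipartitePattern_symm ?_ ?_ ?_ ?_ ?_ ?_ ?_ ?_)
    all_goals first | simp [hj, hk, hl, hjk, hjl, hkl, bipartitePattern]; done | skip
    intro x; rw [Fin.sum_univ_three]; fin_cases x <;> simp; omega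

theorem CocliqueAndThree.smallCase_of_two_adj {p j k l : V} (c : CocliqueAndThree M α p j k l)
    (h : IsRankTwo G α M) (hn : 6 ≤ Fintype.card V) (hj : G.Adj p j) (hk : G.Adj p k)
    (hl : ¬G.Adj p l) : SmallCase G α := by
  have r := fun {ajk ajl akl} => c.relation h (uj := 1) (uk := 1) (ul := 0) (ajk := ajk)
    (ajl := ajl) (akl := akl) (h.apply_adj hj) (h.apply_adj hk)
    (by rw [h.apply_not_adj c.pl hl]; ring)
  have hn' : (6 : ℝ) ≤ Fintype.card V := by exact_mod_cast hn
  refine Or.inr ?_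
  rcases h.adj_or c.jk with ⟨hjk, mjk⟩ | ⟨hjk, mjk⟩ <;>
    rcases h.adj_or c.jl with ⟨hjl, mjl⟩ | ⟨hjl, mjl⟩ <;>
    rcases h.adj_or c.kl with ⟨hkl, mkl⟩ | ⟨hkl, mkl⟩ <;>
    obtain ⟨r1, r2⟩ := r mjk mjl mkl rfl <;> norm_num at r1 r2 <;> try (exfalso; linarith)
  · refine ⟨r1, Or.inr (c.isBlowup h _ _ ![0, 0, 1] 1 splitPattern_symm ?_ ?_ ?_ ?_ ?_ ?_ ?_ ?_)⟩
    all_goals first | simp [hj, hk, hl, hjk, hjl, hkl, splitPattern]; done | skip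
    intro x; rw [Fin.sum_univ_three]; fin_cases x <;> simp; omega
  · refine ⟨r1, Or.inl (c.isBlowup h _ _ ![0, 0, 1] 1 bipartitePattern_symm
      ?_ ?_ ?_ ?_ ?_ ?_ ?_ ?_)⟩
    all_goals first | simp [hj, hk, hl, hjk, hjl, hkl, bipartitePattern]; done | skip
    intro x; rw [Fin.sum_univ_three]; fin_cases x <;> simp; omega

/-- For `α * n = 3` no adjacencies among `j`, `k`, `l` satisfy the relation, unless `α = 1 / 2`. -/
theorem CocliqueAndThree.false_of_three_adj {p j k l : V} (c : CocliqueAndThree M α p j k l)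
    (h : IsRankTwo G α M) (hn : 6 ≤ Fintype.card V) (hα : α ≠ 1 / 2) (hj : G.Adj p j)
    (hk : G.Adj p k) (hl : G.Adj p l) : False := by
  have r := fun {ajk ajl akl} => c.relation h (uj := 1) (uk := 1) (ul := 1) (ajk := ajk)
    (ajl := ajl) (akl := akl) (h.apply_adj hj) (h.apply_adj hk) (h.apply_adj hl)
  have hn' : (7 : ℝ) ≤ Fintype.card V := by
    rcases hn.eq_or_lt with h6 | h7
    · have := (r (sub_sub_cancel α (M j k)).symm (sub_sub_cancel α (M j l)).symm
        (sub_sub_cancel α (M k l)).symm rfl).1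
      rw [← h6] at this
      exact absurd (by norm_num at this; linarith) hα
    · exact_mod_cast h7
  rcases h.adj_or c.jk with ⟨hjk, mjk⟩ | ⟨hjk, mjk⟩ <;>
    rcases h.adj_or c.jl with ⟨hjl, mjl⟩ | ⟨hjl, mjl⟩ <;>
    rcases h.adj_or c.kl with ⟨hkl, mkl⟩ | ⟨hkl, mkl⟩ <;>
    obtain ⟨r1, r2⟩ := r mjk mjl mkl rfl <;> norm_num at r1 r2 <;> nlinarith

/-- The number of neighbours of `p` among `j`, `k`, `l` is `α * n`. -/
theorem CocliqueAndThree.smallCase {p j k l : V} (c : CocliqueAndThree M α p j k l)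
    (h : IsRankTwo G α M) (hn : 6 ≤ Fintype.card V) (h0 : α ≠ 0) (hα : α ≠ 1 / 2) :
    SmallCase G α := by
  have c1 : CocliqueAndThree M α p j l k :=
    ⟨c.jl, c.jk, c.kl.symm, c.pj, c.pl, c.pk, fun v h1 h2 h3 => c.row v h1 h3 h2, c.diag⟩
  have c2 : CocliqueAndThree M α p k l j :=
    ⟨c.kl, c.jk.symm, c.jl.symm, c.pk, c.pl, c.pj, fun v h1 h2 h3 => c.row v h3 h1 h2, c.diag⟩
  have c3 : CocliqueAndThree M α p l j k :=
    ⟨c.jl.symm, c.kl.symm, c.jk, c.pl, c.pj, c.pk, fun v h1 h2 h3 => c.row v h2 h3 h1, c.diag⟩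
  by_cases hj : G.Adj p j <;> by_cases hk : G.Adj p k <;> by_cases hl : G.Adj p l
  · exact (c.false_of_three_adj h hn hα hj hk hl).elim
  · exact c.smallCase_of_two_adj h hn hj hk hl
  · exact c1.smallCase_of_two_adj h hn hj hl hk
  · exact c.smallCase_of_one_adj h hn hj hk hl
  · exact c2.smallCase_of_two_adj h hn hk hl hj
  · exact c2.smallCase_of_one_adj h hn hk hl hj
  · exact c3.smallCase_of_one_adj h hn hl hj hk
  · have r := c.relation h (uj := 0) (uk := 0) (ul := 0)
      (by rw [h.apply_not_adj c.pj hj, sub_zero]) (by rw [h.apply_not_adj c.pk hk, sub_zero])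
      (by rw [h.apply_not_adj c.pl hl, sub_zero]) (sub_sub_cancel α (M j k)).symm
      (sub_sub_cancel α (M j l)).symm (sub_sub_cancel α (M k l)).symm rfl
    have hn' : (Fintype.card V : ℝ) ≠ 0 := by
      have : Fintype.card V ≠ 0 := by omega
      exact_mod_cast this
    have r1 := r.1
    norm_num at r1
    rcases r1 with r1 | r1
    · exact absurd r1 h0
    · omega

/-! ### Proportional rows -/

/-- Two proportional rows, one of a vertex `i` adjacent to everything else. Then `α * n = 1`, and
the graph without `i` has a Laplacian matrix of rank at most one, hence at most one edge. -/
theorem smallCase_of_proportional_aux (h : IsRankTwo G α M) (hn : 6 ≤ Fintype.card V)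
    (hα : α < 1 / 2) (h0 : α ≠ 0) {i j : V} (hij : i ≠ j) {c : ℝ} (hc : ∀ x, M j x = c * M i x)
    (hi : ∀ k, k ≠ i → k ≠ j → M i k = α - 1) (hj : ∀ k, k ≠ i → k ≠ j → M j k = α) :
    SmallCase G α := by
  classical
  have hn' : (6 : ℝ) ≤ Fintype.card V := by exact_mod_cast hn
  set n := (Fintype.card V : ℝ) with hndef
  have hs : Function.Injective ![i, j] := by
    intro a b hab
    fin_cases a <;> fin_cases b <;> simp_all
  have si := sum_eq_sum_special hs (f := M i) (z := α - 1) (fun v hv => hi v (hv 0) (hv 1))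
  have sj := sum_eq_sum_special hs (f := M j) (z := α) (fun v hv => hj v (hv 0) (hv 1))
  rw [h.sum_row, Fin.sum_univ_two, ← hndef] at si sj
  simp only [Matrix.cons_val_zero, Matrix.cons_val_one] at si sj
  obtain ⟨k, hki, hkj⟩ : ∃ k, k ≠ i ∧ k ≠ j := by
    have : ({i, j} : Finset V).card < Fintype.card V := by
      rw [Finset.card_pair hij]; omega
    obtain ⟨k, hk⟩ := Finset.exists_mem_notMem_of_card_lt_card (s := {i, j})
      (t := Finset.univ) (by simpa using this)
    exact ⟨k, by simp at hk; tauto, by simp at hk; tauto⟩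
  have hck : c * (α - 1) = α := by rw [← hi k hki hkj, ← hc, hj k hki hkj]
  have hcj := hc j
  have hci := hc i
  rw [h.symm j i] at sj hci
  have hMij : M i j = α - 1 := by
    refine (h.apply_eq hij).resolve_left fun hα' => ?_
    rw [hα'] at sj hcj hci
    rw [hcj] at sj
    have h1 : α * (c + 1 + (n - 2)) = 0 := by linear_combination -sj
    have h2 : c + 1 + (n - 2) = 0 := (mul_eq_zero.1 h1).resolve_left h0
    nlinarith
  rw [hMij] at sj hcj si
  rw [hcj, hck] at sj
  have hnα : n * α = 1 := by linear_combination -sj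
  have hα1 : 0 < 1 - α := by linarith
  have hii : M i i * α = (1 - α) ^ 2 := by
    have : M i i = (n - 1) * (1 - α) := by linear_combination -si
    rw [this]
    linear_combination (1 - α) * hnα
  have hii0 : M i i ≠ 0 := by
    intro h'
    rw [h'] at hii
    nlinarith
  have hcol : ∀ k, k ≠ i → M k i = α - 1 := by
    intro k hk
    rw [h.symm]
    by_cases hkj : k = j
    · rw [hkj, hMij]
    · exact hi k hk hkj
  -- `α - M k l` is the Laplacian matrix of the graph without `i`; it has rank at most one
  have hT : ∀ k l m o, k ≠ i → l ≠ i → m ≠ i → o ≠ i →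
      (M k l - α) * (M m o - α) = (M k o - α) * (M m l - α) := by
    intro k l m o hk hl hm ho
    have h1 := h.schur_minor i k m l o
    rw [h.symm i k, h.symm i m, h.symm i l, h.symm i o, hcol k hk, hcol l hl, hcol m hm,
      hcol o ho] at h1
    have h2 : ∀ z : ℝ, M i i * z - (α - 1) * (α - 1) = M i i * (z - α) := by
      intro z; linear_combination hii
    rw [h2, h2, h2, h2] at h1
    have h3 : (M i i) ^ 2 * ((M k l - α) * (M m o - α) - (M k o - α) * (M m l - α)) = 0 := by
      linear_combination h1
    have := (mul_eq_zero.1 h3).resolve_left (pow_ne_zero 2 hii0)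
    linarith
  have hsum : ∀ k, k ≠ i → ∑ x ∈ Finset.univ.erase i, (M k x - α) = 0 := by
    intro k hk
    have h1 := Finset.add_sum_erase Finset.univ (fun x => M k x - α) (Finset.mem_univ i)
    have h2 : ∑ x, (M k x - α) = -1 := by
      rw [Finset.sum_sub_distrib, h.sum_row, Finset.sum_const, Finset.card_univ, nsmul_eq_mul,
        ← hndef, hnα]
      ring
    rw [h2, hcol k hk] at h1
    linarith
  have hle : ∀ k x, k ≠ x → M k x - α ≤ 0 := by
    intro k x hkx
    rcases h.apply_eq hkx with h1 | h1 <;> rw [h1] <;> linarith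
  have hdeg : ∀ k l, k ≠ i → l ≠ i → k ≠ l → α - M k l ≤ M k k - α := by
    intro k l hk hl hkl
    have h1 := Finset.add_sum_erase (Finset.univ.erase i) (fun x => M k x - α)
      (a := k) (by simp [hk])
    have h2 := Finset.add_sum_erase ((Finset.univ.erase i).erase k) (fun x => M k x - α)
      (a := l) (by simp [hl, hkl.symm])
    have h3 : ∑ x ∈ ((Finset.univ.erase i).erase k).erase l, (M k x - α) ≤ 0 :=
      Finset.sum_nonpos fun x hx => hle k x (by simp at hx; tauto)
    rw [hsum k hk] at h1
    linarith
  have hdeg' : ∀ k l m, k ≠ i → l ≠ i → m ≠ i → k ≠ l → k ≠ m → l ≠ m →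
      (α - M k l) + (α - M k m) ≤ M k k - α := by
    intro k l m hk hl hm hkl hkm hlm
    have h1 := Finset.add_sum_erase (Finset.univ.erase i) (fun x => M k x - α)
      (a := k) (by simp [hk])
    have h2 := Finset.add_sum_erase ((Finset.univ.erase i).erase k) (fun x => M k x - α)
      (a := l) (by simp [hl, hkl.symm])
    have h4 := Finset.add_sum_erase (((Finset.univ.erase i).erase k).erase l)
      (fun x => M k x - α) (a := m) (by simp [hm, hkm.symm, hlm.symm])
    have h3 : ∑ x ∈ (((Finset.univ.erase i).erase k).erase l).erase m, (M k x - α) ≤ 0 :=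
      Finset.sum_nonpos fun x hx => hle k x (by simp at hx; tauto)
    rw [hsum k hk] at h1
    linarith
  suffices hkl : ∃ k l, k ≠ i ∧ l ≠ i ∧ k ≠ l ∧
      ∀ v, v ≠ i → v ≠ k → v ≠ l → ∀ x, x ≠ i → M v x = α by
    obtain ⟨k, l, hk, hl, hkl, hv⟩ := hkl
    obtain ⟨p, hp⟩ := Finset.exists_mem_notMem_of_card_lt_card (s := {i, k, l})
      (t := Finset.univ) (by
        have := Finset.card_le_three (a := i) (b := k) (c := l)
        rw [Finset.card_univ]; omega)
    simp only [Finset.mem_univ, Finset.mem_insert, Finset.mem_singleton, not_or, true_and] at hp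
    refine CocliqueAndThree.smallCase (p := p) (j := i) (k := k) (l := l)
      ⟨hk.symm, hl.symm, hkl, hp.1, hp.2.1, hp.2.2, fun v h1 h2 h3 => ?_, ?_⟩ h hn h0 hα.ne
    · funext x
      by_cases hx : x = i
      · rw [hx, hcol v h1, hcol p hp.1]
      · rw [hv v h1 h2 h3 x hx, hv p hp.1 hp.2.1 hp.2.2 x hx]
    · exact hv p hp.1 hp.2.1 hp.2.2 p hp.1
  by_cases hedge : ∃ k l, k ≠ i ∧ l ≠ i ∧ k ≠ l ∧ M k l = α - 1
  · obtain ⟨k, l, hk, hl, hkl, hM⟩ := hedge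
    refine ⟨k, l, hk, hl, hkl, fun v hvi hvk hvl x hx => ?_⟩
    have h1 := hT k k l l hk hk hl hl
    rw [h.symm l k, hM] at h1
    have hk1 : 1 ≤ M k k - α := by have := hdeg k l hk hl hkl; linarith
    have hl1 : 1 ≤ M l l - α := by
      have := hdeg l k hl hk hkl.symm; rw [h.symm l k] at this; linarith
    have hkv : M k v = α := by
      refine (h.apply_eq hvk.symm).resolve_right fun h2 => ?_
      have := hdeg' k l v hk hl hvi hkl hvk.symm hvl.symm
      nlinarith
    have hvv : M v v - α = 0 := by
      have h3 := hT k k v v hk hk hvi hvi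
      rw [h.symm v k, hkv, sub_self, zero_mul] at h3
      exact (mul_eq_zero.1 h3).resolve_left (by linarith)
    by_cases hxv : x = v
    · rw [hxv]; linarith
    · refine (h.apply_eq (Ne.symm hxv)).resolve_right fun h2 => ?_
      have := hdeg v x hvi hx (Ne.symm hxv)
      linarith
  · obtain ⟨l, hl⟩ := Finset.exists_mem_notMem_of_card_lt_card (s := {i, k})
      (t := Finset.univ) (by
        have := Finset.card_le_two (a := i) (b := k)
        rw [Finset.card_univ]; omega)
    simp only [Finset.mem_univ, Finset.mem_insert, Finset.mem_singleton, not_or, true_and] at hl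
    have hoff : ∀ a b, a ≠ i → b ≠ i → a ≠ b → M a b = α := fun a b ha hb hab =>
      (h.apply_eq hab).resolve_right fun h2 => hedge ⟨a, b, ha, hb, hab, h2⟩
    refine ⟨k, l, hki, hl.1, Ne.symm hl.2, fun v hvi _ _ x hx => ?_⟩
    by_cases hxv : x = v
    · have h1 := Finset.add_sum_erase (Finset.univ.erase i) (fun x => M v x - α)
        (a := v) (by simp [hvi])
      rw [hsum v hvi, Finset.sum_eq_zero (fun y hy => ?_)] at h1
      · rw [hxv]; linarith
      · simp only [Finset.mem_erase, Finset.mem_univ, and_true] at hy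
        rw [hoff v y hvi hy.2 (Ne.symm hy.1), sub_self]
    · exact hoff v x hvi hx (Ne.symm hxv)

/-- Two different rows that are proportional take both values `α`, `α - 1` in every other column. -/
theorem smallCase_of_proportional (h : IsRankTwo G α M) (hn : 6 ≤ Fintype.card V)
    (hα : α < 1 / 2) (h0 : α ≠ 0) {i j : V} (hij : M i ≠ M j) {c : ℝ}
    (hc : ∀ x, M j x = c * M i x) : SmallCase G α := by
  classical
  have hne : i ≠ j := fun h' => hij (by rw [h'])
  have hc1 : c ≠ 1 := by
    rintro rfl
    exact hij (funext fun x => by rw [hc x, one_mul])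
  have key : ∀ k, k ≠ i → k ≠ j → (M i k = α - 1 ∧ M j k = α ∧ c * (α - 1) = α) ∨
      (M i k = α ∧ M j k = α - 1 ∧ c * α = α - 1) := by
    intro k hki hkj
    have h1 := hc k
    rcases h.apply_eq hki.symm with h2 | h2 <;> rcases h.apply_eq hkj.symm with h3 | h3 <;>
      rw [h2, h3] at h1
    · exact absurd (mul_right_cancel₀ h0 (by linarith : c * α = 1 * α)) hc1
    · exact Or.inr ⟨h2, h3, h1.symm⟩
    · exact Or.inl ⟨h2, h3, h1.symm⟩
    · exact absurd (mul_right_cancel₀ (by linarith : α - 1 ≠ 0)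
        (by linarith : c * (α - 1) = 1 * (α - 1))) hc1
  -- the factor `c` cannot be both `α / (α - 1)` and `(α - 1) / α`
  have hex : ¬(c * (α - 1) = α ∧ c * α = α - 1) := by
    rintro ⟨h1, h2⟩
    have : α * α = (α - 1) * (α - 1) := by linear_combination (α - 1) * h2 - α * h1
    nlinarith
  by_cases hcase : c * (α - 1) = α
  · refine h.smallCase_of_proportional_aux hn hα h0 hne hc (fun k h1 h2 => ?_) fun k h1 h2 => ?_
    · rcases key k h1 h2 with h3 | h3
      · exact h3.1
      · exact absurd ⟨hcase, h3.2.2⟩ hex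
    · rcases key k h1 h2 with h3 | h3
      · exact h3.2.1
      · exact absurd ⟨hcase, h3.2.2⟩ hex
  · obtain ⟨k, hk⟩ := Finset.exists_mem_notMem_of_card_lt_card (s := {i, j})
      (t := Finset.univ) (by
        have := Finset.card_le_two (a := i) (b := j)
        rw [Finset.card_univ]; omega)
    simp only [Finset.mem_univ, Finset.mem_insert, Finset.mem_singleton, not_or, true_and] at hk
    have hc' := ((key k hk.1 hk.2).resolve_left fun h3 => hcase h3.2.2).2.2
    have hc0 : c ≠ 0 := by
      rintro rfl
      linarith
    refine h.smallCase_of_proportional_aux hn hα h0 hne.symm (c := c⁻¹) (fun x => ?_)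
      (fun k h1 h2 => ?_) fun k h1 h2 => ?_
    · rw [hc x, inv_mul_cancel_left₀ hc0]
    · exact ((key k h2 h1).resolve_left fun h3 => hcase h3.2.2).2.1
    · exact ((key k h2 h1).resolve_left fun h3 => hcase h3.2.2).1

/-! ### Few distinct rows -/

omit [Fintype V] in
theorem exists_coloring_of_rows {r : ℕ} (ρ : Fin r → V)
    (hinj : ∀ x y, x ≠ y → M (ρ x) ≠ M (ρ y)) (hρ : ∀ v, ∃ x, M v = M (ρ x)) :
    ∃ c : V → Fin r, (∀ v, M v = M (ρ (c v))) ∧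
      ∀ x, Nat.card {v // c v = x} = Nat.card {v // M v = M (ρ x)} := by
  choose c hc using hρ
  refine ⟨c, hc, fun x => Nat.card_congr (Equiv.subtypeEquivRight fun v => ⟨?_, fun hv => ?_⟩)⟩
  · rintro rfl; exact hc v
  · by_contra hne
    exact hinj _ _ hne (by rw [← hc, hv])

/-- If every row of `M` is one of finitely many, then `G` is a blow-up whose classes are the sets
of vertices with a given row. The diagonal entry of a class is irrelevant if the class has only
one vertex. -/
theorem isBlowup_of_rows (h : IsRankTwo G α M) {r : ℕ} {ρ : Fin r → V}
    (hinj : ∀ x y, x ≠ y → M (ρ x) ≠ M (ρ y)) (hρ : ∀ v, ∃ x, M v = M (ρ x))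
    (P : Fin r → Fin r → Bool)
    (hoff : ∀ x y, x ≠ y → M (ρ x) (ρ y) = if P x y then α - 1 else α)
    (hdiag : ∀ x, (∀ v, M v = M (ρ x) → v = ρ x) ∨
      M (ρ x) (ρ x) = if P x x then α - 1 else α) :
    IsBlowup G P (fun x => Nat.card {v // M v = M (ρ x)}) := by
  obtain ⟨c, hc, hcard⟩ := exists_coloring_of_rows ρ hinj hρ
  refine ⟨c, fun v w hvw => ?_, hcard⟩
  rw [h.adj_iff hvw, hc v, h.symm, hc w, h.symm]
  have hval : M (ρ (c v)) (ρ (c w)) = if P (c v) (c w) then α - 1 else α := by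
    by_cases hvw' : c v = c w
    · rw [← hvw']
      refine (hdiag (c v)).resolve_left fun hs => hvw ?_
      rw [hs v (hc v), hs w (by rw [hvw']; exact hc w)]
    · exact hoff _ _ hvw'
  rw [hval]
  cases P (c v) (c w) <;> simp
  intro h'; linarith

/-- The zero row sums, as relations between the numbers of vertices with a given row. -/
theorem sum_card_row (h : IsRankTwo G α M) {r : ℕ} {ρ : Fin r → V}
    (hinj : ∀ x y, x ≠ y → M (ρ x) ≠ M (ρ y)) (hρ : ∀ v, ∃ x, M v = M (ρ x)) (x : Fin r) :
    ∑ y, (Nat.card {v // M v = M (ρ y)} : ℝ) * M (ρ x) (ρ y) = 0 := by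
  obtain ⟨c, hc, hcard⟩ := exists_coloring_of_rows ρ hinj hρ
  rw [← sum_comp_coloring c hcard (fun y => M (ρ x) (ρ y)), ← h.sum_row (ρ x)]
  exact Finset.sum_congr rfl fun w _ => by rw [h.symm (ρ x) w, hc w, h.symm]

theorem sum_card_row_eq_card {r : ℕ} {ρ : Fin r → V}
    (hinj : ∀ x y, x ≠ y → M (ρ x) ≠ M (ρ y)) (hρ : ∀ v, ∃ x, M v = M (ρ x)) :
    ∑ x, Nat.card {v // M v = M (ρ x)} = Fintype.card V := by
  obtain ⟨c, hc, hcard⟩ := exists_coloring_of_rows ρ hinj hρ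
  simpa using (sum_comp_coloring c hcard (fun _ => (1 : ℕ))).symm

theorem two_le_card_row (M : V → V → ℝ) {i i' : V} (hne : i' ≠ i) (h : M i' = M i) :
    2 ≤ Nat.card {v // M v = M i} := by
  have : Nontrivial {v // M v = M i} := ⟨⟨i', h⟩, ⟨i, rfl⟩, by simpa using hne⟩
  exact Finite.one_lt_card

omit [Fintype V] in
theorem card_row_eq_one {M : V → V → ℝ} {i : V} (h : ∀ v, M v = M i → v = i) :
    Nat.card {v // M v = M i} = 1 := by
  rw [Nat.card_eq_one_iff_unique]
  exact ⟨⟨fun a b => Subtype.ext ((h _ a.2).trans (h _ b.2).symm)⟩, ⟨⟨i, rfl⟩⟩⟩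

/-- The pattern of two disjoint cliques and a coclique joined to both of them or to none. -/
def twoCliquesPattern (b : Bool) : Fin 3 → Fin 3 → Bool :=
  ![![true, false, b], ![false, true, b], ![b, b, false]]

/-- Two rows that each occur at least twice and a third one that occurs once. The zero row sums
force both repeated rows to belong to cliques, of the same size. -/
theorem twoCliques_of_not_adj (h : IsRankTwo G α M) (hα : α ≠ 1 / 2)
    (hI : ∀ i j, M i ≠ M j → IndepRows M i j) {i i' j j' k : V} (hii' : i' ≠ i)
    (hi' : M i' = M i) (hjj' : j' ≠ j) (hj' : M j' = M j) (hij : M i ≠ M j) (hik : M i ≠ M k)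
    (hjk : M j ≠ M k) (hall : ∀ v, v ≠ k → M v = M i ∨ M v = M j) (hadj : ¬G.Adj i j) :
    ∃ m : ℕ, Fintype.card V = 2 * m + 1 ∧
      ((α * Fintype.card V = m ∧ IsBlowup G (twoCliquesPattern false) ![m, m, 1]) ∨
        (α * Fintype.card V = m + 1 ∧ IsBlowup G (twoCliquesPattern true) ![m, m, 1])) := by
  have nij : i ≠ j := fun h' => hij (by rw [h'])
  have nik : i ≠ k := fun h' => hik (by rw [h'])
  have njk : j ≠ k := fun h' => hjk (by rw [h'])
  have hMij := h.apply_not_adj nij hadj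
  have hMii : M i i = α ∨ M i i = α - 1 := by
    rw [h.diag_eq_of_row_eq hi'.symm]; exact h.apply_eq hii'.symm
  have hMjj : M j j = α ∨ M j j = α - 1 := by
    rw [h.diag_eq_of_row_eq hj'.symm]; exact h.apply_eq hjj'.symm
  have hk : ∀ v, M v = M k → v = k := fun v hv => by
    by_contra hvk
    rcases hall v hvk with h' | h'
    · exact hik (by rw [← h', hv])
    · exact hjk (by rw [← h', hv])
  have hgram := h.gram_ne_zero (hI i j hij)
  have hinj : ∀ x y, x ≠ y → M (![i, j, k] x) ≠ M (![i, j, k] y) := by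
    intro x y hxy
    fin_cases x <;> fin_cases y <;>
      first | exact absurd rfl hxy | assumption | (apply Ne.symm; assumption)
  have hρ : ∀ v, ∃ x, M v = M (![i, j, k] x) := by
    intro v
    by_cases hv : v = k
    · exact ⟨2, by rw [hv]; rfl⟩
    · rcases hall v hv with h' | h'
      · exact ⟨0, h'⟩
      · exact ⟨1, h'⟩
  have s0 := h.sum_card_row hinj hρ 0
  have s1 := h.sum_card_row hinj hρ 1
  have s2 := sum_card_row_eq_card hinj hρ
  have s2' : ((∑ x, Nat.card {v // M v = M (![i, j, k] x)} : ℕ) : ℝ) = Fintype.card V := by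
    rw [s2]
  have hk1 := card_row_eq_one hk
  have hi2 := two_le_card_row M hii' hi'
  have hj2 := two_le_card_row M hjj' hj'
  rw [Fin.sum_univ_three] at s0 s1 s2 s2'
  simp only [Matrix.cons_val_zero, Matrix.cons_val_one, Matrix.cons_val] at s0 s1 s2 s2'
  rw [hk1] at s0 s1 s2 s2'
  have hi2' : (2 : ℝ) ≤ Nat.card {v // M v = M i} := by exact_mod_cast hi2
  have hj2' : (2 : ℝ) ≤ Nat.card {v // M v = M j} := by exact_mod_cast hj2
  push_cast at s0 s1 s2'
  have e1 := h.apply_eq nik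
  have e2 := h.apply_eq njk
  have hdiag' : M i i = α - 1 ∧ M j j = α - 1 := by
    rw [h.symm j i, hMij] at s1
    rw [hMij] at s0 hgram
    rcases hMii with h1 | h1 <;> rcases hMjj with h2 | h2
    · rw [h1, h2] at hgram
      exact absurd (by ring) hgram
    · exfalso
      rw [h1] at s0
      rw [h2] at s1
      rcases e1 with e1 | e1 <;> rcases e2 with e2 | e2 <;> rw [e1] at s0 <;> rw [e2] at s1 <;>
        linarith
    · exfalso
      rw [h1] at s0
      rw [h2] at s1
      rcases e1 with e1 | e1 <;> rcases e2 with e2 | e2 <;> rw [e1] at s0 <;> rw [e2] at s1 <;>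
        linarith
    · exact ⟨h1, h2⟩
  obtain ⟨hMii, hMjj⟩ := hdiag'
  rw [h.symm j i, hMij, hMjj] at s1
  rw [hMij, hMii] at s0
  have build : ∀ b : Bool, M i k = (if b then α - 1 else α) → M j k = (if b then α - 1 else α) →
      Nat.card {v // M v = M i} = Nat.card {v // M v = M j} →
      IsBlowup G (twoCliquesPattern b) 
        ![Nat.card {v // M v = M i}, Nat.card {v // M v = M i}, 1] := by
    intro b hb1 hb2 hm
    have hB := h.isBlowup_of_rows hinj hρ (twoCliquesPattern b)
      (by
        intro x y hxy
        fin_cases x <;> fin_cases y <;> first | exact absurd rfl hxy | skip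
        all_goals simp [twoCliquesPattern, hMij, h.symm j i, h.symm k i, h.symm k j, hb1, hb2])
      (by
        intro x
        fin_cases x
        · exact Or.inr (by simp [twoCliquesPattern, hMii])
        · exact Or.inr (by simp [twoCliquesPattern, hMjj])
        · exact Or.inl hk)
    convert hB using 1
    funext x
    fin_cases x
    · rfl
    · exact hm
    · exact hk1.symm
  rcases e1 with e1 | e1 <;> rcases e2 with e2 | e2 <;> rw [e1] at s0 <;> rw [e2] at s1
  · have hm : Nat.card {v // M v = M i} = Nat.card {v // M v = M j} := by
      have : (Nat.card {v // M v = M i} : ℝ) = Nat.card {v // M v = M j} := by linarith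
      exact_mod_cast this
    refine ⟨_, by omega, Or.inl ⟨?_, build false (by simpa using e1) (by simpa using e2) hm⟩⟩
    rw [← s2']; linarith
  · exfalso
    refine hα ?_
    have h1 : (Nat.card {v // M v = M i} : ℝ) * (2 * α - 1) = 0 := by
      have : (Nat.card {v // M v = M i} : ℝ) = Nat.card {v // M v = M j} + 1 := by linarith
      rw [this] at s0 ⊢
      linarith
    rcases mul_eq_zero.1 h1 with h1 | h1 <;> linarith
  · exfalso
    refine hα ?_
    have h1 : (Nat.card {v // M v = M j} : ℝ) * (2 * α - 1) = 0 := by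
      have : (Nat.card {v // M v = M j} : ℝ) = Nat.card {v // M v = M i} + 1 := by linarith
      rw [this] at s1 ⊢
      linarith
    rcases mul_eq_zero.1 h1 with h1 | h1 <;> linarith
  · have hm : Nat.card {v // M v = M i} = Nat.card {v // M v = M j} := by
      have : (Nat.card {v // M v = M i} : ℝ) = Nat.card {v // M v = M j} := by linarith
      exact_mod_cast this
    refine ⟨_, by omega, Or.inr ⟨?_, build true (by simpa using e1) (by simpa using e2) hm⟩⟩
    rw [← s2']; linarith

/-! ### Special triples -/

/-- The vertices `i`, `j`, `k` have different rows, and so have `l₁`, `l₂`, `l₃`. -/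
structure SpecialTriple (M : V → V → ℝ) (i j k l₁ l₂ l₃ : V) : Prop where
  ij : M i ≠ M j
  ik : M i ≠ M k
  jk : M j ≠ M k
  outside₁ : l₁ ≠ i ∧ l₁ ≠ j ∧ l₁ ≠ k
  outside₂ : l₂ ≠ i ∧ l₂ ≠ j ∧ l₂ ≠ k
  outside₃ : l₃ ≠ i ∧ l₃ ≠ j ∧ l₃ ≠ k
  l₁₂ : M l₁ ≠ M l₂
  l₁₃ : M l₁ ≠ M l₃
  l₂₃ : M l₂ ≠ M l₃

/-- Three different elements of `{0, 1}²` are all but one of its elements. -/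
theorem three_of_four (Q : Bool → Bool → Prop) {a b c d e f : Bool} (h1 : Q a b) (h2 : Q c d)
    (h3 : Q e f) (h12 : a = c → b ≠ d) (h13 : a = e → b ≠ f) (h23 : c = e → d ≠ f) :
    (Q false false ∧ Q false true ∧ Q true false) ∨
      (Q false false ∧ Q false true ∧ Q true true) ∨
      (Q false false ∧ Q true false ∧ Q true true) ∨
      (Q false true ∧ Q true false ∧ Q true true) := by
  cases a <;> cases b <;> cases c <;> cases d <;> cases e <;> cases f <;> simp_all

/-- If row `k` is `s` times row `i` plus `t` times row `j`, then the adjacency of a fourth vertex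
to `k` is an affine function of its adjacencies to `i` and `j`. The affine functions taking values
in `{0, 1}` on three of the four points of `{0, 1}²` are few. -/
theorem affine_cases (h0 : α ≠ 0) (hα : α < 1 / 2) {s t : ℝ} (h10 : ¬(s = 1 ∧ t = 0))
    (h01 : ¬(s = 0 ∧ t = 1)) {Q : Bool → Bool → Prop}
    (hQ' : ∀ a b, Q a b → ∃ c : ℝ, (c = 0 ∨ c = 1) ∧
      s * (α - if a then 1 else 0) + t * (α - if b then 1 else 0) = α - c)
    (h3 : (Q false false ∧ Q false true ∧ Q true false) ∨
      (Q false false ∧ Q false true ∧ Q true true) ∨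
      (Q false false ∧ Q true false ∧ Q true true) ∨
      (Q false true ∧ Q true false ∧ Q true true)) :
    α = 1 / 3 ∧ s = -1 ∧ t = -1 ∧ Q false false ∧ Q false true ∧ Q true false := by
  rcases h3 with ⟨q1, q2, q3⟩ | ⟨q1, q2, q3⟩ | ⟨q1, q2, q3⟩ | ⟨q1, q2, q3⟩ <;>
    obtain ⟨c, hc, e1⟩ := hQ' _ _ q1 <;> obtain ⟨d, hd, e2⟩ := hQ' _ _ q2 <;>
    obtain ⟨e, he, e3⟩ := hQ' _ _ q3 <;>
    simp only [if_true, Bool.false_eq_true, if_false] at e1 e2 e3 <;> clear hQ'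
  · obtain rfl : t = d - c := by linarith
    obtain rfl : s = e - c := by linarith
    rcases hc with rfl | rfl <;> rcases hd with rfl | rfl <;> rcases he with rfl | rfl <;>
      first
        | (refine absurd ⟨?_, ?_⟩ h10 <;> linarith)
        | (refine absurd ⟨?_, ?_⟩ h01 <;> linarith)
        | (refine absurd ?_ h0; linarith)
        | (refine ⟨?_, ?_, ?_, q1, q2, q3⟩ <;> linarith)
  · obtain rfl : t = d - c := by linarith
    obtain rfl : s = e - d := by linarith
    exfalso
    rcases hc with rfl | rfl <;> rcases hd with rfl | rfl <;> rcases he with rfl | rfl <;>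
      first
        | (refine h10 ⟨?_, ?_⟩ <;> linarith)
        | (refine h01 ⟨?_, ?_⟩ <;> linarith)
        | (refine h0 ?_; linarith)
  · obtain rfl : s = d - c := by linarith
    obtain rfl : t = e - d := by linarith
    exfalso
    rcases hc with rfl | rfl <;> rcases hd with rfl | rfl <;> rcases he with rfl | rfl <;>
      first
        | (refine h10 ⟨?_, ?_⟩ <;> linarith)
        | (refine h01 ⟨?_, ?_⟩ <;> linarith)
        | (refine h0 ?_; linarith)
  · obtain rfl : s = e - c := by linarith
    obtain rfl : t = e - d := by linarith
    exfalso
    rcases hc with rfl | rfl <;> rcases hd with rfl | rfl <;> rcases he with rfl | rfl <;>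
      first
        | (refine h10 ⟨?_, ?_⟩ <;> linarith)
        | (refine h01 ⟨?_, ?_⟩ <;> linarith)
        | (refine h0 ?_; linarith)

/-- In a special triple the three rows sum to zero, and every other vertex is adjacent to
exactly one of its vertices. -/
theorem SpecialTriple.row_sum {i j k l₁ l₂ l₃ : V} (c : SpecialTriple M i j k l₁ l₂ l₃)
    (h : IsRankTwo G α M) (h0 : α ≠ 0) (hα : α < 1 / 2)
    (hI : ∀ i j, M i ≠ M j → IndepRows M i j) :
    α = 1 / 3 ∧ (∀ x, M i x + M j x + M k x = 0) ∧
      (∃ l, (l ≠ i ∧ l ≠ j ∧ l ≠ k) ∧ M i l = 1 / 3 ∧ M j l = 1 / 3) ∧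
      (∃ l, (l ≠ i ∧ l ≠ j ∧ l ≠ k) ∧ M i l = 1 / 3 ∧ M j l = -2 / 3) ∧
      ∃ l, (l ≠ i ∧ l ≠ j ∧ l ≠ k) ∧ M i l = -2 / 3 ∧ M j l = 1 / 3 := by
  classical
  obtain ⟨s, t, hst⟩ := h.exists_eq_combination (hI i j c.ij) k
  have hval : ∀ a l, a ≠ l → M a l = α - if decide (G.Adj a l) then 1 else 0 := by
    intro a l hal
    by_cases hadj : G.Adj a l
    · simp [hadj, h.apply_adj hadj]
    · simp [hadj, h.apply_not_adj hal hadj]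
  let Q : Bool → Bool → Prop := fun a b => ∃ l, (l ≠ i ∧ l ≠ j ∧ l ≠ k) ∧
    M i l = (α - if a then 1 else 0) ∧ M j l = α - if b then 1 else 0
  have hQl : ∀ l, (l ≠ i ∧ l ≠ j ∧ l ≠ k) → Q (G.Adj i l) (G.Adj j l) := fun l hl =>
    ⟨l, hl, hval i l hl.1.symm, hval j l hl.2.1.symm⟩
  have same : ∀ l l', M l ≠ M l' → (l ≠ i ∧ l ≠ j ∧ l ≠ k) → (l' ≠ i ∧ l' ≠ j ∧ l' ≠ k) →
      decide (G.Adj i l) = decide (G.Adj i l') → decide (G.Adj j l) ≠ decide (G.Adj j l') :=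
    fun l l' hne hl hl' hi hj => hne (h.row_eq (hI i j c.ij)
      (by rw [h.symm l, h.symm l', hval i l hl.1.symm, hi, ← hval i l' hl'.1.symm])
      (by rw [h.symm l, h.symm l', hval j l hl.2.1.symm, hj, ← hval j l' hl'.2.1.symm]))
  have hQ : ∀ a b, Q a b → ∃ c : ℝ, (c = 0 ∨ c = 1) ∧
      s * (α - if a then 1 else 0) + t * (α - if b then 1 else 0) = α - c := by
    rintro a b ⟨l, hl, h1, h2⟩
    rw [← h1, ← h2, ← hst]
    rcases h.apply_eq hl.2.2.symm with h3 | h3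
    · exact ⟨0, Or.inl rfl, by rw [h3, sub_zero]⟩
    · exact ⟨1, Or.inr rfl, h3⟩
  have h3 := three_of_four Q (hQl _ c.outside₁) (hQl _ c.outside₂) (hQl _ c.outside₃)
    (same _ _ c.l₁₂ c.outside₁ c.outside₂) (same _ _ c.l₁₃ c.outside₁ c.outside₃)
    (same _ _ c.l₂₃ c.outside₂ c.outside₃)
  have := affine_cases h0 hα (s := s) (t := t) (fun hh => c.ik (funext fun x => by
      rw [hst x, hh.1, hh.2]; ring)) (fun hh => c.jk (funext fun x => by
      rw [hst x, hh.1, hh.2]; ring)) hQ h3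
  obtain ⟨ha, hs, ht, ⟨l, hl, hl1, hl2⟩, ⟨l', hl', hl1', hl2'⟩, ⟨l'', hl'', hl1'', hl2''⟩⟩ := this
  refine ⟨ha, fun x => by rw [hst x, hs, ht]; ring, ⟨l, hl, ?_, ?_⟩, ⟨l', hl', ?_, ?_⟩,
    ⟨l'', hl'', ?_, ?_⟩⟩ <;>
    simp only [if_true, Bool.false_eq_true, if_false] at * <;> linarith

/-- The pattern of three disjoint cliques. -/
def threeCliquesPattern : Fin 3 → Fin 3 → Bool :=
  ![![true, false, false], ![false, true, false], ![false, false, true]]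

/-- The pattern of the disjoint union of a complete bipartite graph and a clique. -/
def bipartiteCliquePattern : Fin 3 → Fin 3 → Bool :=
  ![![false, true, false], ![true, false, false], ![false, false, true]]

/-- Three cliques of size `n / 3`, or a complete bipartite graph and a clique, with all classes of
that size. -/
def ThirdCase {V : Type*} [Fintype V] (G : SimpleGraph V) (α : ℝ) : Prop :=
  α = 1 / 3 ∧ ∃ m : ℕ, Fintype.card V = 3 * m ∧
    (IsBlowup G threeCliquesPattern ![m, m, m] ∨ IsBlowup G bipartiteCliquePattern ![m, m, m])

/-- Among the three rows, the one of a vertex `v` is determined by the entries in two columns.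
The vertices `σ i`, `σ j`, `σ k` are `i`, `j`, `k` in an order matching these entries. -/
theorem row_mem_of_sum_eq_zero (h : IsRankTwo G α M) (hα : α = 1 / 3) {i j k : V}
    (hI : IndepRows M i j) (hsum : ∀ x, M i x + M j x + M k x = 0) {σ : V → V}
    (hσi : M (σ i) i = -2 / 3 ∧ M (σ i) j = 1 / 3) (hσj : M (σ j) i = 1 / 3 ∧ M (σ j) j = -2 / 3)
    (hσk : M (σ k) i = 1 / 3 ∧ M (σ k) j = 1 / 3) {v : V} (hvi : v ≠ i) (hvj : v ≠ j)
    (hvk : v ≠ k) : M v = M (σ i) ∨ M v = M (σ j) ∨ M v = M (σ k) := by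
  have h1 := hsum v
  rw [h.symm i, h.symm j, h.symm k] at h1
  have ei := h.apply_eq hvi
  have ej := h.apply_eq hvj
  have ek := h.apply_eq hvk
  rw [hα] at ei ej ek
  rcases ei with ei | ei <;> rcases ej with ej | ej
  · exact Or.inr (Or.inr (h.row_eq hI (by rw [ei, hσk.1]) (by rw [ej, hσk.2])))
  · exact Or.inr (Or.inl (h.row_eq hI (by rw [ei, hσj.1]) (by rw [ej, hσj.2]; norm_num)))
  · exact Or.inl (h.row_eq hI (by rw [ei, hσi.1]; norm_num) (by rw [ej, hσi.2]))
  · exfalso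
    rcases ek with ek | ek <;> linarith

/-- Three rows of which all others are copies, with the entries of one of the two graphs. -/
theorem thirdCase_of_rows (h : IsRankTwo G α M) (hα : α = 1 / 3) {i j k : V} (hij : M i ≠ M j)
    (hik : M i ≠ M k) (hjk : M j ≠ M k) (hall : ∀ v, M v = M i ∨ M v = M j ∨ M v = M k)
    (hMik : M i k = 1 / 3) (hMjk : M j k = 1 / 3) (hMkk : M k k = -2 / 3)
    (hM : (M i i = -2 / 3 ∧ M j j = -2 / 3 ∧ M i j = 1 / 3) ∨
      (M i i = 1 / 3 ∧ M j j = 1 / 3 ∧ M i j = -2 / 3)) : ThirdCase G α := by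
  have hinj : ∀ x y, x ≠ y → M (![i, j, k] x) ≠ M (![i, j, k] y) := by
    intro x y hxy
    fin_cases x <;> fin_cases y <;>
      first | exact absurd rfl hxy | assumption | (apply Ne.symm; assumption)
  have hρ : ∀ v, ∃ x, M v = M (![i, j, k] x) := by
    intro v
    rcases hall v with h' | h' | h'
    · exact ⟨0, h'⟩
    · exact ⟨1, h'⟩
    · exact ⟨2, h'⟩
  have s0 := h.sum_card_row hinj hρ 0
  have s1 := h.sum_card_row hinj hρ 1
  have s2 := sum_card_row_eq_card hinj hρ
  rw [Fin.sum_univ_three] at s0 s1 s2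
  simp only [Matrix.cons_val_zero, Matrix.cons_val_one, Matrix.cons_val] at s0 s1 s2
  rw [h.symm j i] at s1
  have hm : Nat.card {v // M v = M j} = Nat.card {v // M v = M i} ∧
      Nat.card {v // M v = M k} = Nat.card {v // M v = M i} := by
    have : (Nat.card {v // M v = M j} : ℝ) = Nat.card {v // M v = M i} ∧
        (Nat.card {v // M v = M k} : ℝ) = Nat.card {v // M v = M i} := by
      rcases hM with ⟨h1, h2, h3⟩ | ⟨h1, h2, h3⟩ <;> rw [h1, h3, hMik] at s0 <;>
        rw [h2, h3, hMjk] at s1 <;> constructor <;> linarith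
    exact_mod_cast this
  have hfun : (fun x => Nat.card {v // M v = M (![i, j, k] x)}) =
      ![Nat.card {v // M v = M i}, Nat.card {v // M v = M i}, Nat.card {v // M v = M i}] := by
    funext x
    fin_cases x
    · rfl
    · exact hm.1
    · exact hm.2
  refine ⟨hα, Nat.card {v // M v = M i}, by omega, ?_⟩
  rw [← hfun]
  rcases hM with ⟨h1, h2, h3⟩ | ⟨h1, h2, h3⟩
  · refine Or.inl (h.isBlowup_of_rows hinj hρ _ (fun x y hxy => ?_) fun x => Or.inr ?_)
    · fin_cases x <;> fin_cases y <;> first | exact absurd rfl hxy | skip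
      all_goals simp [threeCliquesPattern, h.symm j i, h.symm k i, h.symm k j, h3, hMik, hMjk, hα]
    · fin_cases x <;> simp [threeCliquesPattern, h1, h2, hMkk, hα] <;> norm_num
  · refine Or.inr (h.isBlowup_of_rows hinj hρ _ (fun x y hxy => ?_) fun x => Or.inr ?_)
    · fin_cases x <;> fin_cases y <;> first | exact absurd rfl hxy | skip
      all_goals simp [bipartiteCliquePattern, h.symm j i, h.symm k i, h.symm k j, h3, hMik, hMjk,
        hα] <;> norm_num
    · fin_cases x <;> simp [bipartiteCliquePattern, h1, h2, hMkk, hα] <;> norm_num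

/-- The case that `k` is adjacent neither to `i` nor to `j`. -/
theorem thirdCase_of_sum_eq_zero (h : IsRankTwo G α M) (hα : α = 1 / 3) {i j k : V}
    (hij : M i ≠ M j) (hik : M i ≠ M k) (hjk : M j ≠ M k) (hI : IndepRows M i j)
    (hsum : ∀ x, M i x + M j x + M k x = 0) (hMik : M i k = 1 / 3) (hMjk : M j k = 1 / 3)
    (hMij : M i j = 1 / 3 ∨ M i j = -2 / 3) : ThirdCase G α := by
  have si := hsum i
  have sj := hsum j
  have sk := hsum k
  rw [h.symm j i, h.symm k i, hMik] at si
  rw [h.symm k j, hMjk] at sj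
  rw [hMik, hMjk] at sk
  have hall : ∀ v, (v ≠ i → v ≠ j → v ≠ k → M v = M i ∨ M v = M j ∨ M v = M k) →
      M v = M i ∨ M v = M j ∨ M v = M k := by
    intro v hv
    by_cases h1 : v = i
    · exact Or.inl (by rw [h1])
    by_cases h2 : v = j
    · exact Or.inr (Or.inl (by rw [h2]))
    by_cases h3 : v = k
    · exact Or.inr (Or.inr (by rw [h3]))
    exact hv h1 h2 h3
  refine h.thirdCase_of_rows hα hij hik hjk (fun v => hall v fun h1 h2 h3 => ?_) hMik hMjk
    (by linarith) ?_
  · rcases hMij with e | e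
    · exact h.row_mem_of_sum_eq_zero hα hI hsum (σ := id) ⟨by simp only [id]; linarith, e⟩
        ⟨by rw [id, h.symm, e], by simp only [id]; linarith⟩
        ⟨by rw [id, h.symm, hMik], by rw [id, h.symm, hMjk]⟩ h1 h2 h3
    · -- `i` and `j` lie in the two parts of a complete bipartite graph, so a vertex with the
      -- adjacencies that `j` shows to `i` and `j` has the row of `j`
      have hne : j ≠ i := fun h' => hij (by rw [h'])
      have hki : k ≠ i := fun h' => hik (by rw [h'])
      have hkj : k ≠ j := fun h' => hjk (by rw [h'])
      classical
      have := h.row_mem_of_sum_eq_zero hα hI hsum (σ := Equiv.swap i j)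
        ⟨by rw [Equiv.swap_apply_left, h.symm, e], by rw [Equiv.swap_apply_left]; linarith⟩
        ⟨by rw [Equiv.swap_apply_right]; linarith, by rw [Equiv.swap_apply_right, e]⟩
        ⟨by rw [Equiv.swap_apply_of_ne_of_ne hki hkj, h.symm, hMik],
          by rw [Equiv.swap_apply_of_ne_of_ne hki hkj, h.symm, hMjk]⟩ h1 h2 h3
      rw [Equiv.swap_apply_left, Equiv.swap_apply_right,
        Equiv.swap_apply_of_ne_of_ne hki hkj] at this
      tauto
  · rcases hMij with e | e
    · exact Or.inl ⟨by linarith, by linarith, e⟩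
    · exact Or.inr ⟨by linarith, by linarith, e⟩

/-- At most one edge joins the vertices of a special triple: with two, two of the rows would have a
vanishing Gram determinant, and with three there would be two proportional rows. -/
theorem SpecialTriple.thirdCase {i j k l₁ l₂ l₃ : V} (c : SpecialTriple M i j k l₁ l₂ l₃)
    (h : IsRankTwo G α M) (h0 : α ≠ 0) (hα : α < 1 / 2)
    (hI : ∀ i j, M i ≠ M j → IndepRows M i j) : ThirdCase G α := by
  obtain ⟨ha, hsum, ⟨lk, hlk, hlki, hlkj⟩, ⟨lj, hlj, hlji, hljj⟩, ⟨li, hli, hlii, hlij⟩⟩ :=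
    c.row_sum h h0 hα hI
  have nij : i ≠ j := fun h' => c.ij (by rw [h'])
  have nik : i ≠ k := fun h' => c.ik (by rw [h'])
  have njk : j ≠ k := fun h' => c.jk (by rw [h'])
  have e1 := h.apply_eq nij
  have e2 := h.apply_eq nik
  have e3 := h.apply_eq njk
  rw [ha] at e1 e2 e3
  have si := hsum i
  have sj := hsum j
  have sk := hsum k
  rw [h.symm j i, h.symm k i] at si
  rw [h.symm k j] at sj
  have e1 : M i j = 1 / 3 ∨ M i j = -2 / 3 := e1.imp_right fun e => by rw [e]; norm_num
  have e2 : M i k = 1 / 3 ∨ M i k = -2 / 3 := e2.imp_right fun e => by rw [e]; norm_num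
  have e3 : M j k = 1 / 3 ∨ M j k = -2 / 3 := e3.imp_right fun e => by rw [e]; norm_num
  have hij := hI i j c.ij
  have hik := hI i k c.ik
  have hjk := hI j k c.jk
  by_cases a1 : M i k = 1 / 3 ∧ M j k = 1 / 3
  · exact h.thirdCase_of_sum_eq_zero ha c.ij c.ik c.jk hij hsum a1.1 a1.2 e1
  by_cases a2 : M i j = 1 / 3 ∧ M j k = 1 / 3
  · exact h.thirdCase_of_sum_eq_zero ha c.ik c.ij c.jk.symm hik (fun x => by linarith [hsum x])
      a2.1 (by rw [h.symm, a2.2]) e2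
  by_cases a3 : M i j = 1 / 3 ∧ M i k = 1 / 3
  · exact h.thirdCase_of_sum_eq_zero ha c.jk c.ij.symm c.ik.symm hjk
      (fun x => by linarith [hsum x]) (by rw [h.symm, a3.1]) (by rw [h.symm, a3.2]) e3
  exfalso
  have g1 := h.gram_ne_zero hij
  have g2 := h.gram_ne_zero hik
  have g3 := h.gram_ne_zero hjk
  rcases e1 with e1 | e1 <;> rcases e2 with e2 | e2 <;> rcases e3 with e3 | e3 <;>
    simp only [e1, e2, e3, true_and, and_true, not_true_eq_false] at a1 a2 a3
  · refine g1 ?_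
    rw [e1, show M i i = 1 / 3 by linarith, show M j j = 1 / 3 by linarith]; norm_num
  · refine g2 ?_
    rw [e2, show M i i = 1 / 3 by linarith, show M k k = 1 / 3 by linarith]; norm_num
  · refine g3 ?_
    rw [e3, show M j j = 1 / 3 by linarith, show M k k = 1 / 3 by linarith]; norm_num
  · -- a triangle; the row of `li` is `-1 / 2` times the row of `i`
    have hM : M i i = 4 / 3 := by linarith
    have hrow := h.row_eq_mul (k := li) (l := i) (c := -1 / 2) hij
      (by rw [h.symm, hlii, hM]; norm_num)
      (by rw [h.symm, hlij, e1]; norm_num)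
    have hne : M li ≠ M i := fun h' => by
      have := congrFun h' i
      rw [h.symm, hlii, hM] at this
      norm_num at this
    have := (hI li i hne 2 1 fun x => by rw [hrow x]; ring).2
    norm_num at this

/-! ### Classification below one half -/

/-- With `2 * m + 1` vertices: two cliques of size `m` and an isolated vertex, or `K_{m, m}` and
an isolated vertex. -/
def HalfOddCase {V : Type*} [Fintype V] (G : SimpleGraph V) (α : ℝ) : Prop :=
  ∃ m : ℕ, Fintype.card V = 2 * m + 1 ∧ α * Fintype.card V = m ∧
    (IsBlowup G (twoCliquesPattern false) ![m, m, 1] ∨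
      IsBlowup G (fun x y => !twoCliquesPattern true x y) ![m, m, 1])

/-- The rows add up to zero, so they are not all copies of two independent ones. -/
theorem exists_third_row (h : IsRankTwo G α M) {i j : V} (hij : IndepRows M i j) :
    ∃ k, M i ≠ M k ∧ M j ≠ M k := by
  classical
  by_contra! hall
  have hne := hij.row_ne
  have key : ∀ x, ∑ v, M v x = (Finset.univ.filter fun v => M v = M i).card * M i x +
      (Finset.univ.filter fun v => ¬M v = M i).card * M j x := by
    intro x
    rw [← Finset.sum_filter_add_sum_filter_not Finset.univ (fun v => M v = M i)]
    congr 1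
    · rw [Finset.sum_congr rfl (g := fun _ => M i x) (fun v hv => by
        rw [(Finset.mem_filter.1 hv).2]), Finset.sum_const, nsmul_eq_mul]
    · rw [Finset.sum_congr rfl (g := fun _ => M j x) (fun v hv => by
        rw [hall v (Ne.symm (Finset.mem_filter.1 hv).2)]), Finset.sum_const, nsmul_eq_mul]
  have h0 := (hij _ _ fun x => by
    rw [← key x, ← h.sum_row x]
    exact Finset.sum_congr rfl fun v _ => h.symm v x).1
  have : (Finset.univ.filter fun v => M v = M i).card = 0 := by exact_mod_cast h0
  rw [Finset.card_eq_zero] at this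
  have hi : i ∈ Finset.univ.filter fun v => M v = M i := by simp
  rw [this] at hi
  simp at hi

/-- Two rows that occur at least twice: without special triples, only one vertex has another row. -/
theorem halfOddCase_of_two_classes (h : IsRankTwo G α M) (hn : 6 ≤ Fintype.card V)
    (hα : α < 1 / 2) (hI : ∀ i j, M i ≠ M j → IndepRows M i j)
    (hS : ∀ i j k l₁ l₂ l₃, ¬SpecialTriple M i j k l₁ l₂ l₃) {i i' j j' : V} (hii' : i' ≠ i)
    (hi' : M i' = M i) (hjj' : j' ≠ j) (hj' : M j' = M j) (hij : M i ≠ M j) :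
    HalfOddCase G α := by
  obtain ⟨k, hik, hjk⟩ := h.exists_third_row (hI i j hij)
  have hn' : (6 : ℝ) ≤ Fintype.card V := by exact_mod_cast hn
  have hall : ∀ v, v ≠ k → M v = M i ∨ M v = M j := by
    intro v hvk
    by_contra! hv
    refine hS i j k i' j' v
      ⟨hij, hik, hjk, ⟨hii', ?_, ?_⟩, ⟨?_, hjj', ?_⟩, ⟨?_, ?_, hvk⟩, ?_, ?_, ?_⟩
    · rintro rfl; exact hij hi'.symm
    · rintro rfl; exact hik hi'.symm
    · rintro rfl; exact hij hj'
    · rintro rfl; exact hjk hj'.symm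
    · rintro rfl; exact hv.1 rfl
    · rintro rfl; exact hv.2 rfl
    · rw [hi', hj']; exact hij
    · rw [hi']; exact hv.1.symm
    · rw [hj']; exact hv.2.symm
  by_cases hadj : G.Adj i j
  · have hneg : ∀ {a b : V}, M a = M b → (fun x => -M a x) = fun x => -M b x := fun hab => by
      rw [hab]
    have hneg' : ∀ {a b : V}, M a ≠ M b → (fun x => -M a x) ≠ fun x => -M b x := fun hab h' =>
      hab (funext fun x => neg_injective (congrFun h' x))
    obtain ⟨m, hm, h' | h'⟩ := h.compl.twoCliques_of_not_adj (i := i) (i' := i') (j := j)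
      (j' := j') (k := k) (by linarith)
      (fun a b hab s t hst => hI a b (fun h' => hab (hneg h')) s t fun x => by
        linarith [hst x]) hii' (hneg hi') hjj' (hneg hj') (hneg' hij) (hneg' hik) (hneg' hjk)
      (fun v hv => (hall v hv).imp hneg hneg)
      (by rw [SimpleGraph.compl_adj]; tauto)
    · -- `n * (1 - α) = m` contradicts `α < 1 / 2`
      exfalso
      have h1 : (Fintype.card V : ℝ) = 2 * m + 1 := by exact_mod_cast hm
      nlinarith [h'.1]
    · refine ⟨m, hm, ?_, Or.inr h'.2.of_compl⟩
      have h1 : (Fintype.card V : ℝ) = 2 * m + 1 := by exact_mod_cast hm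
      linarith [h'.1]
  · obtain ⟨m, hm, h' | h'⟩ := h.twoCliques_of_not_adj (by linarith) hI hii' hi' hjj' hj' hij
      hik hjk hall hadj
    · exact ⟨m, hm, h'.1, Or.inl h'.2⟩
    · exfalso
      have h1 : (Fintype.card V : ℝ) = 2 * m + 1 := by exact_mod_cast hm
      nlinarith [h'.1]

/-- Only one row occurs more than once: without special triples, at most three vertices have another
row. -/
theorem smallCase_of_one_class (h : IsRankTwo G α M) (hn : 6 ≤ Fintype.card V) (h0 : α ≠ 0)
    (hα : α < 1 / 2) (hS : ∀ i j k l₁ l₂ l₃, ¬SpecialTriple M i j k l₁ l₂ l₃) {p p' : V}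
    (hpp' : p' ≠ p) (hp' : M p' = M p) (hone : ∀ i j, i ≠ j → M i = M j → M i = M p) :
    SmallCase G α := by
  classical
  have hn' : (6 : ℝ) ≤ Fintype.card V := by exact_mod_cast hn
  set S := Finset.univ.filter fun v => M v ≠ M p with hSdef
  have hpS : S ⊆ Finset.univ.erase p := by
    intro v hv
    simp only [hSdef, Finset.mem_filter, Finset.mem_univ, true_and] at hv
    simp only [Finset.mem_erase, Finset.mem_univ, and_true]
    rintro rfl
    exact hv rfl
  have hcard : S.card ≤ 3 := by
    by_contra hlt
    obtain ⟨f⟩ := Function.Embedding.nonempty_of_card_le (α := Fin 4) (β := S) (by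
      rw [Fintype.card_fin, Fintype.card_coe]; omega)
    have hf : ∀ x, M (f x) ≠ M p := fun x => (Finset.mem_filter.1 (f x).2).2
    have hf' : ∀ x y, x ≠ y → (f x : V) ≠ f y := fun x y hxy h' =>
      hxy (f.injective (Subtype.ext h'))
    have hff : ∀ x y, x ≠ y → M (f x) ≠ M (f y) := fun x y hxy h' =>
      hf x (hone _ _ (hf' x y hxy) h')
    have hfp : ∀ x, (f x : V) ≠ p := fun x h' => hf x (by rw [h'])
    have hfp' : ∀ x, (f x : V) ≠ p' := fun x h' => hf x (by rw [h', hp'])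
    exact hS p (f 0) (f 1) p' (f 2) (f 3) ⟨(hf 0).symm, (hf 1).symm, hff 0 1 (by decide),
      ⟨hpp', (hfp' 0).symm, (hfp' 1).symm⟩,
      ⟨hfp 2, hf' 2 0 (by decide), hf' 2 1 (by decide)⟩,
      ⟨hfp 3, hf' 3 0 (by decide), hf' 3 1 (by decide)⟩,
      by rw [hp']; exact (hf 2).symm, by rw [hp']; exact (hf 3).symm, hff 2 3 (by decide)⟩
  obtain ⟨T, hST, hTp, hT⟩ := Finset.exists_subsuperset_card_eq hpS hcard (by
    rw [Finset.card_erase_of_mem (Finset.mem_univ _), Finset.card_univ]; omega)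
  obtain ⟨j, k, l, hjk, hjl, hkl, rfl⟩ := Finset.card_eq_three.1 hT
  have hp : ∀ v ∈ ({j, k, l} : Finset V), p ≠ v := fun v hv =>
    ((Finset.mem_erase.1 (hTp hv)).1).symm
  have hrow : ∀ v, v ≠ j → v ≠ k → v ≠ l → M v = M p := by
    intro v h1 h2 h3
    by_contra hv
    have : v ∈ ({j, k, l} : Finset V) := hST (by simp [hSdef, hv])
    simp [h1, h2, h3] at this
  have hdiag : M p p = α ∨ M p p = α - 1 := by
    rw [h.diag_eq_of_row_eq hp'.symm]; exact h.apply_eq hpp'.symm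
  rcases hdiag with hd | hd
  · exact CocliqueAndThree.smallCase ⟨hjk, hjl, hkl, hp j (by simp), hp k (by simp),
      hp l (by simp), hrow, hd⟩ h hn h0 (by linarith)
  · -- for the complement, `(1 - α) * n ≤ 2` contradicts `α < 1 / 2` and `6 ≤ n`
    exfalso
    have c : CocliqueAndThree (fun i j => -M i j) (1 - α) p j k l :=
      ⟨hjk, hjl, hkl, hp j (by simp), hp k (by simp), hp l (by simp),
        fun v h1 h2 h3 => by simp only [hrow v h1 h2 h3], by simp only [hd]; ring⟩
    rcases c.smallCase h.compl hn (by linarith) (by linarith) with h' | h' <;> nlinarith [h'.1]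

/-- For `6 ≤ n` and `α < 1 / 2`, `α ≠ 0`, the graph belongs to one of three families. -/
theorem classification (h : IsRankTwo G α M) (hn : 6 ≤ Fintype.card V) (h0 : α ≠ 0)
    (hα : α < 1 / 2) : SmallCase G α ∨ ThirdCase G α ∨ HalfOddCase G α := by
  by_cases hI : ∀ i j, M i ≠ M j → IndepRows M i j
  · by_cases hS : ∃ i j k l₁ l₂ l₃, SpecialTriple M i j k l₁ l₂ l₃
    · obtain ⟨i, j, k, l₁, l₂, l₃, c⟩ := hS
      exact Or.inr (Or.inl (c.thirdCase h h0 hα hI))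
    · push Not at hS
      by_cases hB : ∃ p p', p' ≠ p ∧ M p' = M p
      · obtain ⟨p, p', hpp', hp'⟩ := hB
        by_cases hone : ∀ i j, i ≠ j → M i = M j → M i = M p
        · exact Or.inl (h.smallCase_of_one_class hn h0 hα hS hpp' hp' hone)
        · push Not at hone
          obtain ⟨i, j, hij, hMij, hne⟩ := hone
          exact Or.inr (Or.inr (h.halfOddCase_of_two_classes hn hα hI hS hpp' hp' hij hMij
            (fun h' => hne (by rw [hMij, h']))))
      · push Not at hB
        exfalso
        obtain ⟨f⟩ := Function.Embedding.nonempty_of_card_le (α := Fin 6) (β := V) (by simpa)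
        have hf : ∀ x y, x ≠ y → f x ≠ f y := fun x y hxy h' => hxy (f.injective h')
        have hff : ∀ x y, x ≠ y → M (f x) ≠ M (f y) := fun x y hxy => hB _ _ (hf x y hxy)
        refine hS (f 0) (f 1) (f 2) (f 3) (f 4) (f 5) ⟨?_, ?_, ?_, ⟨?_, ?_, ?_⟩, ⟨?_, ?_, ?_⟩,
          ⟨?_, ?_, ?_⟩, ?_, ?_, ?_⟩ <;> first | exact hff _ _ (by decide) | exact hf _ _ (by decide)
  · push Not at hI
    obtain ⟨i, j, hij, hdep⟩ := hI
    obtain ⟨c, hc⟩ := h.exists_eq_smul h0 (by linarith) (by omega) hdep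
    exact Or.inl (h.smallCase_of_proportional hn hα h0 hij hc)

end IsRankTwo

/-! ### Classification at one half -/

namespace IsRankTwo

/-- Classes `A, A', B, B'`, where `A`, `A'` are cocliques joined to each other, `B`, `B'` are
disjoint cliques, and `A` is joined to `B'` and `A'` to `B`. -/
def fourPattern : Fin 4 → Fin 4 → Bool :=
  ![![false, true, false, true], ![true, false, true, false], ![false, true, true, false],
    ![true, false, false, true]]

/-- The join of a coclique with the disjoint union of a coclique and a clique. For a
clique of size two this is a complete bipartite graph with an edge added. -/
def bipartiteAddPattern : Fin 3 → Fin 3 → Bool :=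
  ![![false, true, false], ![true, false, true], ![false, true, true]]

/-- Besides a two-parameter family, `K_{m, m}` with an edge added and its complement. -/
def HalfCase {V : Type*} [Fintype V] (G : SimpleGraph V) : Prop :=
  (∃ a b : ℕ, Fintype.card V = 2 * (a + b) ∧ IsBlowup G fourPattern ![a, a, b, b]) ∨
    ∃ a : ℕ, Fintype.card V = 2 * a + 4 ∧ (IsBlowup G bipartiteAddPattern ![a, a + 2, 2] ∨
      IsBlowup G (fun x y => !bipartiteAddPattern x y) ![a, a + 2, 2])

/-- The rows of `i` and `j` agree up to sign. -/
def SameUpToSign {V : Type*} (M : V → V → ℝ) (i j : V) : Prop :=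
  ∃ c : ℝ, (c = 1 ∨ c = -1) ∧ ∀ x, M i x = c * M j x

theorem SameUpToSign.symm {V : Type*} {M : V → V → ℝ} {i j : V} (h : SameUpToSign M i j) :
    SameUpToSign M j i := by
  obtain ⟨c, hc, hx⟩ := h
  refine ⟨c, hc, fun x => ?_⟩
  rw [hx x]
  rcases hc with rfl | rfl <;> ring

variable {V : Type*} [Fintype V] {G : SimpleGraph V} {M : V → V → ℝ}

theorem apply_eq_half (h : IsRankTwo G (1 / 2) M) {i j : V} (hij : i ≠ j) :
    M i j = 1 / 2 ∨ M i j = -1 / 2 :=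
  (h.apply_eq hij).imp_right fun e => by rw [e]; norm_num

theorem adj_iff_half (h : IsRankTwo G (1 / 2) M) {i j : V} (hij : i ≠ j) :
    G.Adj i j ↔ M i j = -1 / 2 := by
  rw [h.adj_iff hij, show (1 / 2 - 1 : ℝ) = -1 / 2 by norm_num]

theorem indepRows_of_not_sameUpToSign (h : IsRankTwo G (1 / 2) M) (hn : 3 ≤ Fintype.card V)
    {i j : V} (hij : ¬SameUpToSign M i j) : IndepRows M i j := by
  classical
  by_contra hI
  obtain ⟨c, hc⟩ := h.exists_eq_smul (by norm_num) (by norm_num) (by omega) hI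
  obtain ⟨k, hk⟩ := Finset.exists_mem_notMem_of_card_lt_card (s := {i, j})
    (t := Finset.univ) (by
      have := Finset.card_le_two (a := i) (b := j)
      rw [Finset.card_univ]; omega)
  simp only [Finset.mem_univ, Finset.mem_insert, Finset.mem_singleton, not_or, true_and] at hk
  refine hij (SameUpToSign.symm ⟨c, ?_, hc⟩)
  have h1 := hc k
  rcases h.apply_eq_half (Ne.symm hk.1) with h2 | h2 <;>
    rcases h.apply_eq_half (Ne.symm hk.2) with h3 | h3 <;> rw [h2, h3] at h1
  · left; linarith
  · right; linarith
  · right; linarith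
  · left; linarith

/-- Outside a triple of rows that are pairwise different up to sign, all rows agree up to sign: the
product of the entries in the columns `i` and `j` does not depend on the row. -/
theorem sameUpToSign_outside (h : IsRankTwo G (1 / 2) M) (hn : 3 ≤ Fintype.card V) {i j k : V}
    (hij : ¬SameUpToSign M i j) (hik : ¬SameUpToSign M i k) (hjk : ¬SameUpToSign M j k) {l l' : V}
    (hl : l ≠ i ∧ l ≠ j ∧ l ≠ k) (hl' : l' ≠ i ∧ l' ≠ j ∧ l' ≠ k) : SameUpToSign M l l' := by
  have hI := h.indepRows_of_not_sameUpToSign hn hij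
  obtain ⟨s, t, hst⟩ := h.exists_eq_combination hI k
  have sq : ∀ {a b : V}, a ≠ b → M a b ^ 2 = 1 / 4 := fun hab => by
    rcases h.apply_eq_half hab with e | e <;> rw [e] <;> norm_num
  have key : M i l * M j l = M i l' * M j l' := by
    by_contra hne
    have hopp : M i l * M j l = -(M i l' * M j l') := by
      have h1 : (M i l * M j l - M i l' * M j l') * (M i l * M j l + M i l' * M j l') = 0 := by
        have e1 := sq hl.1.symm
        have e2 := sq hl.2.1.symm
        have e3 := sq hl'.1.symm
        have e4 := sq hl'.2.1.symm
        linear_combination M j l ^ 2 * e1 + 1 / 4 * e2 - M j l' ^ 2 * e3 - 1 / 4 * e4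
      rcases mul_eq_zero.1 h1 with h2 | h2
      · exact absurd (by linarith) hne
      · linarith
    have e1 := sq hl.2.2.symm
    have e2 := sq hl'.2.2.symm
    rw [hst l] at e1
    rw [hst l'] at e2
    have h1 : s * t * (M i l * M j l) = 0 := by
      linear_combination 1 / 4 * e1 - 1 / 4 * e2 - 1 / 4 * s ^ 2 * sq hl.1.symm +
        1 / 4 * s ^ 2 * sq hl'.1.symm - 1 / 4 * t ^ 2 * sq hl.2.1.symm +
        1 / 4 * t ^ 2 * sq hl'.2.1.symm + 1 / 2 * s * t * hopp
    have h2 : M i l * M j l ≠ 0 := by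
      rcases h.apply_eq_half hl.1.symm with e | e <;>
        rcases h.apply_eq_half hl.2.1.symm with e' | e' <;> rw [e, e'] <;> norm_num
    have h3 : s ^ 2 + t ^ 2 = 1 := by
      linear_combination 4 * e1 - 4 * s ^ 2 * sq hl.1.symm - 4 * t ^ 2 * sq hl.2.1.symm - 8 * h1
    rcases mul_eq_zero.1 ((mul_eq_zero.1 h1).resolve_right h2) with rfl | rfl
    · exact hjk (SameUpToSign.symm ⟨t, mul_self_eq_one_iff.1 (by linarith), fun x => by
        rw [hst x]; ring⟩)
    · exact hik (SameUpToSign.symm ⟨s, mul_self_eq_one_iff.1 (by linarith), fun x => by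
        rw [hst x]; ring⟩)
  have main : ∃ c : ℝ, (c = 1 ∨ c = -1) ∧ M l i = c * M l' i ∧ M l j = c * M l' j := by
    rw [h.symm l, h.symm l, h.symm l', h.symm l']
    rcases h.apply_eq_half hl.1.symm with e1 | e1 <;>
      rcases h.apply_eq_half hl.2.1.symm with e2 | e2 <;>
      rcases h.apply_eq_half hl'.1.symm with e3 | e3 <;>
      rcases h.apply_eq_half hl'.2.1.symm with e4 | e4 <;> rw [e1, e2, e3, e4] at key ⊢ <;>
      first
        | (exfalso; norm_num at key; done)
        | (refine ⟨1, Or.inl rfl, ?_, ?_⟩ <;> norm_num; done)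
        | (refine ⟨-1, Or.inr rfl, ?_, ?_⟩ <;> norm_num)
  obtain ⟨c, hc, h1, h2⟩ := main
  exact ⟨c, hc, h.row_eq_mul hI h1 h2⟩

/-- The vertices other than `j` and `k` form two cocliques, according to their adjacency to `j`. -/
theorem isBlowup_bipartiteAdd (h : IsRankTwo G (1 / 2) M) {j k : V} (hjk : j ≠ k)
    (hM : M j k = -1 / 2) (hjj : M j j = 3 / 2) (h1 : ∀ v, v ≠ j → v ≠ k → M v k = M v j)
    (h2 : ∀ v w, v ≠ j → v ≠ k → w ≠ j → w ≠ k → v ≠ w → M v w = 2 * M v j * M w j) :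
    ∃ a : ℕ, Fintype.card V = 2 * a + 4 ∧ IsBlowup G bipartiteAddPattern ![a, a + 2, 2] := by
  classical
  let c : V → Fin 3 := fun v => if v = j ∨ v = k then 2 else if M v j = 1 / 2 then 0 else 1
  have hcj : c j = 2 := by simp [c]
  have hck : c k = 2 := by simp [c]
  have hc : ∀ v, v ≠ j → v ≠ k → (c v = 0 ∧ M v j = 1 / 2) ∨ (c v = 1 ∧ M v j = -1 / 2) := by
    intro v hvj hvk
    rcases h.apply_eq_half hvj with e | e
    · left; simp [c, hvj, hvk, e]
    · right; refine ⟨?_, e⟩; simp only [c, hvj, hvk, e]; norm_num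
  have hs : Function.Injective ![j, k] := by
    intro a b hab
    fin_cases a <;> fin_cases b <;> simp_all
  have s1 := sum_eq_sum_special hs
    (f := fun v => M j v - (![1 / 2, -1 / 2, 1 / 2] : Fin 3 → ℝ) (c v))
    (z := 0) (fun v hv => by
      rw [h.symm]
      rcases hc v (hv 0) (hv 1) with e | e <;> simp [e])
  have s2 := sum_eq_sum_special hs (f := fun v => (![0, 0, 1] : Fin 3 → ℝ) (c v))
    (z := 0) (fun v hv => by
      rcases hc v (hv 0) (hv 1) with e | e <;> simp [e])
  have s3 := sum_comp_coloring c (fun _ => rfl) (fun _ => (1 : ℝ))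
  rw [Finset.sum_sub_distrib, h.sum_row, sum_comp_coloring c (fun _ => rfl)] at s1
  rw [sum_comp_coloring c (fun _ => rfl)] at s2
  simp only [Fin.sum_univ_two, Fin.sum_univ_three, Matrix.cons_val_zero, Matrix.cons_val_one,
    Matrix.cons_val, hcj, hck, hM, hjj] at s1 s2 s3
  simp only [Finset.sum_const, Finset.card_univ, nsmul_eq_mul, mul_one] at s3
  have t2 : (Nat.card {v // c v = 2} : ℝ) = 2 := by linarith
  have t1 : (Nat.card {v // c v = 1} : ℝ) = Nat.card {v // c v = 0} + 2 := by linarith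
  have t3 : (Fintype.card V : ℝ) = 2 * Nat.card {v // c v = 0} + 4 := by linarith
  refine ⟨Nat.card {v // c v = 0}, by exact_mod_cast t3, c, fun v w hvw => ?_, fun x => ?_⟩
  · rw [h.adj_iff_half hvw]
    have hcase : ∀ v, v = j ∨ v = k ∨ (v ≠ j ∧ v ≠ k) := fun v => by tauto
    rcases hcase v with rfl | rfl | ⟨hv1, hv2⟩ <;> rcases hcase w with rfl | rfl | ⟨hw1, hw2⟩
    · exact absurd rfl hvw
    · simp [hcj, hck, hM, bipartiteAddPattern]
    · rw [h.symm]
      rcases hc w hw1 hw2 with e | e <;> rw [e.1, e.2, hcj] <;>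
        norm_num [bipartiteAddPattern] <;> rfl
    · rw [h.symm, hM]; simp [hcj, hck, bipartiteAddPattern]
    · exact absurd rfl hvw
    · rw [h.symm, h1 w hw1 hw2]
      rcases hc w hw1 hw2 with e | e <;> rw [e.1, e.2, hck] <;>
        norm_num [bipartiteAddPattern] <;> rfl
    · rcases hc v hv1 hv2 with e | e <;> rw [e.1, e.2, hcj] <;>
        norm_num [bipartiteAddPattern] <;> rfl
    · rw [h1 v hv1 hv2]
      rcases hc v hv1 hv2 with e | e <;> rw [e.1, e.2, hck] <;>
        norm_num [bipartiteAddPattern] <;> rfl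
    · rw [h2 v w hv1 hv2 hw1 hw2 hvw]
      rcases hc v hv1 hv2 with e | e <;> rcases hc w hw1 hw2 with e' | e' <;>
        rw [e.1, e.2, e'.1, e'.2] <;> norm_num [bipartiteAddPattern]
  · fin_cases x
    · rfl
    · exact_mod_cast t1
    · exact_mod_cast t2

/-- With `R` as in `schur_triangle`, the entries of `R` in row `i` vanish, so the rows of all
vertices but `j` and `k` are multiples of the row of `p`. -/
theorem bipartiteAdd_of_schur (h : IsRankTwo G (1 / 2) M) {p i j k : V} (hij : i ≠ j)
    (hik : i ≠ k) (hjk : j ≠ k) (hpj : p ≠ j) (hpk : p ≠ k) (hpp : M p p = 1 / 2)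
    (hp : ∀ v, v ≠ i → v ≠ j → v ≠ k → ∀ x, M p p * M v x = M p v * M p x)
    (hRij : M p p * M i j - M p i * M p j = 0) (hRik : M p p * M i k - M p i * M p k = 0)
    (sij : ¬SameUpToSign M i j) (sjk : ¬SameUpToSign M j k) (hpi : p ≠ i) :
    ∃ a : ℕ, Fintype.card V = 2 * a + 4 ∧ IsBlowup G bipartiteAddPattern ![a, a + 2, 2] := by
  have t1 := (h.schur_triangle hij hik hjk hp).2
  have t2 := (h.schur_triangle hij.symm hjk hik (fun v a b c => hp v b a c)).2
  have t3 := (h.schur_triangle hik.symm hjk.symm hij (fun v a b c => hp v b c a)).2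
  rw [h.symm j i, h.symm k i, h.symm k j] at *
  rw [hpp] at hp hRij hRik t1 t2 t3
  have hi : ∀ x, M i x = 2 * M p i * M p x := by
    intro x
    by_cases hx : x = i
    · rw [hx]; linarith
    by_cases hx' : x = j
    · rw [hx']; linarith
    by_cases hx'' : x = k
    · rw [hx'']; linarith
    · rw [h.symm]
      linarith [hp x hx hx' hx'' i]
  have hp' : ∀ v, v ≠ j → v ≠ k → ∀ x, M v x = 2 * M p v * M p x := by
    intro v hvj hvk x
    by_cases hvi : v = i
    · rw [hvi]; exact hi x
    · linarith [hp v hvi hvj hvk x]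
  have hMpi := h.apply_eq_half hpi
  have hMpj := h.apply_eq_half hpj
  have hMpk := h.apply_eq_half hpk
  have hMjk := h.apply_eq_half hjk
  have hjx : ∀ x, x ≠ j → x ≠ k → M j x = 2 * M p j * M p x := fun x a b => by
    rw [h.symm, hp' x a b j]; ring
  have hkx : ∀ x, x ≠ j → x ≠ k → M k x = 2 * M p k * M p x := fun x a b => by
    rw [h.symm, hp' x a b k]; ring
  -- the vertices `j` and `k` are not in the span of the row of `p`
  have hne : M j k ≠ 2 * M p j * M p k := by
    intro he
    refine sij ⟨4 * M p i * M p j, ?_, fun x => ?_⟩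
    · rcases hMpi with e | e <;> rcases hMpj with e' | e' <;> rw [e, e'] <;> norm_num
    · have hj : M j x = 2 * M p j * M p x := by
        by_cases hx' : x = j
        · rw [hx']; linarith
        by_cases hx'' : x = k
        · rw [hx'', he]
        · exact hjx x hx' hx''
      rw [hi x, hj]
      rcases hMpj with e' | e' <;> rw [e'] <;> ring
  have heq : M p j = M p k := by
    by_contra hne'
    refine sjk ⟨-1, Or.inr rfl, fun x => ?_⟩
    have hopp : M p j = -M p k := by
      rcases hMpj with e | e <;> rcases hMpk with e' | e' <;> rw [e, e'] at hne' ⊢ <;>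
        first | exact absurd rfl hne' | norm_num
    by_cases hx' : x = j
    · rw [hx', h.symm k j]; linear_combination 2 * t2 - 2 * hRij + 2 * M p j * hopp
    by_cases hx'' : x = k
    · rw [hx'']; linear_combination 2 * t3 - 2 * hRik + 2 * M p k * hopp
    · rw [hjx x hx' hx'', hkx x hx' hx'', hopp]; ring
  have hM : M j k = -1 / 2 := by
    refine hMjk.resolve_left fun e => hne ?_
    rw [e, ← heq]
    rcases hMpj with e | e <;> rw [e] <;> norm_num
  refine h.isBlowup_bipartiteAdd hjk hM ?_ (fun v hvj hvk => ?_) fun v w a b c d _ => ?_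
  · have t4 : M j j + M j k = 2 * M p j ^ 2 + 2 * M p j * M p k := by
      linear_combination 2 * t2 - 2 * hRij
    rw [hM, ← heq] at t4
    rcases hMpj with e | e <;> rw [e] at t4 <;> linarith
  · rw [hp' v hvj hvk, hp' v hvj hvk, heq]
  · rw [hp' v a b w, hp' v a b j, hp' w c d j]
    rcases hMpj with e | e <;> rw [e] <;> ring

end IsRankTwo

namespace IsRankTwo

theorem sameUpToSign_neg {V : Type*} {M : V → V → ℝ} {i j : V} :
    SameUpToSign (fun i j => -M i j) i j ↔ SameUpToSign M i j := by
  refine exists_congr fun c => and_congr_right fun _ => forall_congr' fun x => ?_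
  rw [mul_neg, neg_inj]

variable {V : Type*} [Fintype V] {G : SimpleGraph V} {M : V → V → ℝ}

theorem compl_half (h : IsRankTwo G (1 / 2) M) : IsRankTwo Gᶜ (1 / 2) (fun i j => -M i j) := by
  have := h.compl
  rwa [show (1 - 1 / 2 : ℝ) = 1 / 2 by norm_num] at this

/-- The off-diagonal entries of the Schur complement are `0` or `± 1 / 2`, so their second
elementary symmetric function only vanishes if at least two of them do. -/
theorem bipartiteAdd_of_triple (h : IsRankTwo G (1 / 2) M) (hn : 3 ≤ Fintype.card V) {i j k p : V}
    (hij : ¬SameUpToSign M i j) (hik : ¬SameUpToSign M i k) (hjk : ¬SameUpToSign M j k)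
    (hp : p ≠ i ∧ p ≠ j ∧ p ≠ k) (hpp : M p p = 1 / 2) :
    ∃ a : ℕ, Fintype.card V = 2 * a + 4 ∧ IsBlowup G bipartiteAddPattern ![a, a + 2, 2] := by
  have hne : ∀ {a b : V}, ¬SameUpToSign M a b → a ≠ b := by
    rintro a b hab rfl
    exact hab ⟨1, Or.inl rfl, fun x => by ring⟩
  have nij := hne hij
  have nik := hne hik
  have njk := hne hjk
  have hrow : ∀ v, v ≠ i → v ≠ j → v ≠ k → ∀ x, M p p * M v x = M p v * M p x := by
    intro v h1 h2 h3 x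
    obtain ⟨c, -, hc⟩ := h.sameUpToSign_outside hn hij hik hjk ⟨h1, h2, h3⟩ hp
    rw [h.symm p v, hc x, hc p]; ring
  have e2 := (h.schur_triangle nij nik njk hrow).1
  have val : ∀ {a b : V}, a ≠ b → p ≠ a → p ≠ b →
      M p p * M a b - M p a * M p b = 0 ∨ M p p * M a b - M p a * M p b = 1 / 2 ∨
        M p p * M a b - M p a * M p b = -1 / 2 := by
    intro a b hab ha hb
    rw [hpp]
    rcases h.apply_eq_half hab with e | e <;> rcases h.apply_eq_half ha with e' | e' <;>
      rcases h.apply_eq_half hb with e'' | e'' <;> rw [e, e', e''] <;> norm_num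
  have key : (M p p * M i j - M p i * M p j = 0 ∧ M p p * M i k - M p i * M p k = 0) ∨
      (M p p * M i j - M p i * M p j = 0 ∧ M p p * M j k - M p j * M p k = 0) ∨
      (M p p * M i k - M p i * M p k = 0 ∧ M p p * M j k - M p j * M p k = 0) := by
    rcases val nij hp.1 hp.2.1 with e | e | e <;> rcases val nik hp.1 hp.2.2 with e' | e' | e' <;>
      rcases val njk hp.2.1 hp.2.2 with e'' | e'' | e'' <;> rw [e, e', e''] at e2 ⊢ <;>
      first | (exfalso; norm_num at e2; done) | norm_num
  rcases key with ⟨r1, r2⟩ | ⟨r1, r2⟩ | ⟨r1, r2⟩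
  · exact h.bipartiteAdd_of_schur nij nik njk hp.2.1 hp.2.2 hpp hrow r1 r2 hij hjk hp.1
  · exact h.bipartiteAdd_of_schur nij.symm njk nik hp.1 hp.2.2 hpp
      (fun v a b c => hrow v b a c) (by rw [h.symm j i]; linarith) r2
      (fun h' => hij h'.symm) hik hp.2.1
  · exact h.bipartiteAdd_of_schur nik.symm njk.symm nij hp.1 hp.2.1 hpp
      (fun v a b c => hrow v b c a) (by rw [h.symm k i]; linarith) (by rw [h.symm k j]; linarith)
      (fun h' => hik h'.symm) hij hp.2.2

/-- A vertex `p` outside the triple has diagonal entry `± 1 / 2`, because its row agrees up to sign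
with the row of another vertex; passing to the complement changes that sign. -/
theorem halfCase_of_triple (h : IsRankTwo G (1 / 2) M) (hn : 6 ≤ Fintype.card V) {i j k : V}
    (hij : ¬SameUpToSign M i j) (hik : ¬SameUpToSign M i k) (hjk : ¬SameUpToSign M j k) :
    HalfCase G := by
  classical
  obtain ⟨p, p', hp, hp', hpp'⟩ : ∃ p p', (p ≠ i ∧ p ≠ j ∧ p ≠ k) ∧
      (p' ≠ i ∧ p' ≠ j ∧ p' ≠ k) ∧ p ≠ p' := by
    have h1 := Finset.le_card_sdiff ({i, j, k} : Finset V) Finset.univ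
    have h2 := Finset.card_le_three (a := i) (b := j) (c := k)
    rw [Finset.card_univ] at h1
    obtain ⟨p, hp, p', hp', hne⟩ := Finset.one_lt_card.1
      (show 1 < (Finset.univ \ ({i, j, k} : Finset V)).card by omega)
    simp only [Finset.mem_sdiff, Finset.mem_univ, Finset.mem_insert, Finset.mem_singleton,
      not_or, true_and] at hp hp'
    exact ⟨p, p', hp, hp', hne⟩
  obtain ⟨c, hc, hx⟩ := h.sameUpToSign_outside (by omega) hij hik hjk hp' hp
  have hpp : M p p = 1 / 2 ∨ M p p = -1 / 2 := by
    have := hx p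
    rcases hc with rfl | rfl <;> rcases h.apply_eq_half hpp'.symm with e | e <;>
      rw [e] at this
    · left; linarith
    · right; linarith
    · right; linarith
    · left; linarith
  rcases hpp with hpp | hpp
  · obtain ⟨a, ha, hb⟩ := h.bipartiteAdd_of_triple (by omega) hij hik hjk hp hpp
    exact Or.inr ⟨a, ha, Or.inl hb⟩
  · obtain ⟨a, ha, hb⟩ := h.compl_half.bipartiteAdd_of_triple (by omega)
      (mt sameUpToSign_neg.1 hij) (mt sameUpToSign_neg.1 hik) (mt sameUpToSign_neg.1 hjk) hp
      (by rw [hpp]; norm_num)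
    exact Or.inr ⟨a, ha, Or.inr hb.of_compl⟩

/-- The off-diagonal values of `M` between classes in which the rows are `r`, `-r`, `s`, `-s`. -/
noncomputable def fourValue : Fin 4 → Fin 4 → ℝ :=
  ![![1 / 2, -1 / 2, 1 / 2, -1 / 2], ![-1 / 2, 1 / 2, -1 / 2, 1 / 2],
    ![1 / 2, -1 / 2, -1 / 2, 1 / 2], ![-1 / 2, 1 / 2, 1 / 2, -1 / 2]]

theorem halfCase_of_coloring (h : IsRankTwo G (1 / 2) M) (c : V → Fin 4)
    (hval : ∀ v w, v ≠ w → M v w = fourValue (c v) (c w))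
    (h01 : Nat.card {v // c v = 1} = Nat.card {v // c v = 0})
    (h23 : Nat.card {v // c v = 3} = Nat.card {v // c v = 2}) : HalfCase G := by
  have hB : IsBlowup G fourPattern ![Nat.card {v // c v = 0}, Nat.card {v // c v = 0},
      Nat.card {v // c v = 2}, Nat.card {v // c v = 2}] := by
    refine ⟨c, fun v w hvw => ?_, fun x => ?_⟩
    · rw [h.adj_iff_half hvw, hval v w hvw]
      generalize c v = x
      generalize c w = y
      fin_cases x <;> fin_cases y <;> norm_num [fourValue, fourPattern]
    · fin_cases x
      · rfl
      · exact h01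
      · rfl
      · exact h23
  refine Or.inl ⟨_, _, ?_, hB⟩
  rw [hB.card_eq, Fin.sum_univ_four]
  simp only [Matrix.cons_val_zero, Matrix.cons_val_one, Matrix.cons_val]
  ring

/-- The zero column sums, if all rows are `± M i` or `± M j`. -/
theorem card_eq_of_coloring (h : IsRankTwo G (1 / 2) M) {i j : V} (hij : IndepRows M i j)
    {c : V → Fin 4} (hc : ∀ v x, M v x = ![M i x, -M i x, M j x, -M j x] (c v)) :
    Nat.card {v // c v = 1} = Nat.card {v // c v = 0} ∧
      Nat.card {v // c v = 3} = Nat.card {v // c v = 2} := by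
  have hs : ∀ x, ((Nat.card {v // c v = 0} : ℝ) - Nat.card {v // c v = 1}) * M i x +
      ((Nat.card {v // c v = 2} : ℝ) - Nat.card {v // c v = 3}) * M j x = 0 := by
    intro x
    have h1 := h.sum_row x
    rw [Finset.sum_congr rfl fun v _ => (h.symm x v).trans (hc v x),
      sum_comp_coloring c (fun _ => rfl) (![M i x, -M i x, M j x, -M j x])] at h1
    rw [Fin.sum_univ_four] at h1
    simp only [Matrix.cons_val_zero, Matrix.cons_val_one, Matrix.cons_val] at h1
    linarith
  obtain ⟨h01, h23⟩ := hij _ _ hs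
  constructor
  · have : (Nat.card {v // c v = 1} : ℝ) = Nat.card {v // c v = 0} := by linarith
    exact_mod_cast this
  · have : (Nat.card {v // c v = 3} : ℝ) = Nat.card {v // c v = 2} := by linarith
    exact_mod_cast this

theorem halfCase_of_pair_aux (h : IsRankTwo G (1 / 2) M) {i j : V}
    (hij : IndepRows M i j) (hii : M i i = 1 / 2) (hjj : M j j = -1 / 2) (hMij : M i j = 1 / 2)
    {c : V → Fin 4} (hc : ∀ v x, M v x = ![M i x, -M i x, M j x, -M j x] (c v)) : HalfCase G := by
  obtain ⟨h01, h23⟩ := h.card_eq_of_coloring hij hc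
  refine h.halfCase_of_coloring c (fun v w _ => ?_) h01 h23
  have hji : M j i = 1 / 2 := by rw [h.symm, hMij]
  have hiw := hc w i
  have hjw := hc w j
  rw [h.symm w i] at hiw
  rw [h.symm w j] at hjw
  rw [hc v w, hiw, hjw, hii, hjj, hMij, hji]
  generalize c v = x
  generalize c w = y
  fin_cases x <;> fin_cases y <;> norm_num [fourValue]

theorem halfCase_of_pair (h : IsRankTwo G (1 / 2) M) {i j j' : V}
    (hij : IndepRows M i j) (hii : M i i = 1 / 2) (hjj : M j j = -1 / 2)
    (hj' : ∀ x, M j' x = -M j x) {c : V → Fin 4}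
    (hc : ∀ v x, M v x = ![M i x, -M i x, M j x, -M j x] (c v)) : HalfCase G := by
  have hne : i ≠ j := fun h' => hij.row_ne (by rw [h'])
  rcases h.apply_eq_half hne with e | e
  · exact h.halfCase_of_pair_aux hij hii hjj e hc
  · refine h.halfCase_of_pair_aux (i := i) (j := j') (c := fun v => ![0, 1, 3, 2] (c v))
      (fun s t hst => ?_) hii ?_ ?_ fun v x => ?_
    · have := hij s (-t) fun x => by rw [← hst x, hj' x]; ring
      exact ⟨this.1, by linarith [this.2]⟩
    · rw [hj', h.symm, hj', hjj]; norm_num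
    · rw [h.symm, hj', h.symm, e]; norm_num
    · rw [hc v x, hj' x]
      generalize c v = y
      fin_cases y <;> simp

theorem halfCase_of_single (h : IsRankTwo G (1 / 2) M) (hn : 6 ≤ Fintype.card V) {i : V}
    (hall : ∀ v, SameUpToSign M v i) : HalfCase G := by
  have : Nontrivial V := Fintype.one_lt_card_iff_nontrivial.1 (by omega)
  obtain ⟨j, hj⟩ := exists_ne i
  have hii : M i i = 1 / 2 ∨ M i i = -1 / 2 := by
    obtain ⟨c, hc, hx⟩ := hall j
    have := hx i
    rcases hc with rfl | rfl <;> rcases h.apply_eq_half hj with e | e <;> rw [e] at this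
    · left; linarith
    · right; linarith
    · right; linarith
    · left; linarith
  -- two of the four classes are empty
  obtain ⟨x₀, x₁, hx01, hv⟩ : ∃ x₀ x₁ : Fin 4, ((x₀ = 0 ∧ x₁ = 1) ∨ (x₀ = 2 ∧ x₁ = 3)) ∧
      fourValue x₀ x₀ = M i i ∧ fourValue x₀ x₁ = -M i i ∧ fourValue x₁ x₀ = -M i i ∧
      fourValue x₁ x₁ = M i i := by
    rcases hii with e | e
    · have h1 : (-1 / 2 : ℝ) = -(1 / 2) := by norm_num
      rw [e]
      exact ⟨0, 1, Or.inl ⟨rfl, rfl⟩, rfl, h1, h1, rfl⟩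
    · have h1 : (1 / 2 : ℝ) = -(-1 / 2) := by norm_num
      rw [e]
      exact ⟨2, 3, Or.inr ⟨rfl, rfl⟩, rfl, h1, h1, rfl⟩
  have hex : ∀ v, ∃ y : Fin 4, (y = x₀ ∧ ∀ x, M v x = M i x) ∨ (y = x₁ ∧ ∀ x, M v x = -M i x) := by
    intro v
    obtain ⟨c, rfl | rfl, hx⟩ := hall v
    · exact ⟨x₀, Or.inl ⟨rfl, fun x => by rw [hx x]; ring⟩⟩
    · exact ⟨x₁, Or.inr ⟨rfl, fun x => by rw [hx x]; ring⟩⟩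
  choose c hc using hex
  have hval : ∀ v w, v ≠ w → M v w = fourValue (c v) (c w) := by
    intro v w _
    rcases hc v with ⟨e, hv'⟩ | ⟨e, hv'⟩ <;> rcases hc w with ⟨e', hw'⟩ | ⟨e', hw'⟩ <;>
      rw [hv' w, h.symm i w, hw' i, e, e'] <;> simp [hv]
  have hs := h.sum_row i
  let f : Fin 4 → ℝ := fun y => if y = x₀ then M i i else if y = x₁ then -M i i else 0
  have hr : ∀ v, M i v = f (c v) := by
    intro v
    simp only [f]
    have : x₁ ≠ x₀ := by
      rcases hx01 with ⟨rfl, rfl⟩ | ⟨rfl, rfl⟩ <;> decide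
    rcases hc v with ⟨e, hv'⟩ | ⟨e, hv'⟩ <;> rw [h.symm i v, hv' i, e] <;> simp [this]
  have h0 : ∀ y, y ≠ x₀ → y ≠ x₁ → Nat.card {v // c v = y} = 0 := by
    intro y h1 h2
    rw [Nat.card_eq_zero]
    refine Or.inl ⟨fun v => ?_⟩
    rcases hc v with ⟨e, -⟩ | ⟨e, -⟩
    · exact h1 (v.2.symm.trans e)
    · exact h2 (v.2.symm.trans e)
  have hMii : M i i ≠ 0 := by rcases hii with e | e <;> rw [e] <;> norm_num
  rw [Finset.sum_congr rfl fun v _ => hr v, sum_comp_coloring c (fun _ => rfl) f,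
    Fin.sum_univ_four] at hs
  simp only [f] at hs
  rcases hx01 with ⟨rfl, rfl⟩ | ⟨rfl, rfl⟩
  · refine h.halfCase_of_coloring c hval ?_ ?_
    · simp only [show (1 : Fin 4) ≠ 0 by decide, show (2 : Fin 4) ≠ 0 by decide,
        show (3 : Fin 4) ≠ 0 by decide, show (2 : Fin 4) ≠ 1 by decide,
        show (3 : Fin 4) ≠ 1 by decide, if_true, if_false] at hs
      have : (Nat.card {v // c v = 1} : ℝ) = Nat.card {v // c v = 0} :=
        mul_right_cancel₀ hMii (by linarith)
      exact_mod_cast this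
    · rw [h0 2 (by decide) (by decide), h0 3 (by decide) (by decide)]
  · refine h.halfCase_of_coloring c hval ?_ ?_
    · rw [h0 0 (by decide) (by decide), h0 1 (by decide) (by decide)]
    · simp only [show (0 : Fin 4) ≠ 2 by decide, show (1 : Fin 4) ≠ 2 by decide,
        show (3 : Fin 4) ≠ 2 by decide, show (0 : Fin 4) ≠ 3 by decide,
        show (1 : Fin 4) ≠ 3 by decide, if_true, if_false] at hs
      have : (Nat.card {v // c v = 3} : ℝ) = Nat.card {v // c v = 2} :=
        mul_right_cancel₀ hMii (by linarith)
      exact_mod_cast this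

theorem halfCase (h : IsRankTwo G (1 / 2) M) (hn : 6 ≤ Fintype.card V) : HalfCase G := by
  by_cases hT : ∃ i j k, ¬SameUpToSign M i j ∧ ¬SameUpToSign M i k ∧ ¬SameUpToSign M j k
  · obtain ⟨i, j, k, h1, h2, h3⟩ := hT
    exact h.halfCase_of_triple hn h1 h2 h3
  push Not at hT
  have : Nonempty V := Fintype.card_pos_iff.1 (by omega)
  obtain ⟨i⟩ := this
  by_cases hS : ∀ v, SameUpToSign M v i
  · exact h.halfCase_of_single hn hS
  push Not at hS
  obtain ⟨j, hji⟩ := hS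
  have hij : ¬SameUpToSign M i j := fun h' => hji h'.symm
  have hI := h.indepRows_of_not_sameUpToSign (by omega) hij
  have hne : i ≠ j := fun h' => hI.row_ne (by rw [h'])
  have hex : ∀ v, ∃ y : Fin 4, ∀ x, M v x = ![M i x, -M i x, M j x, -M j x] y := by
    intro v
    by_cases hv : SameUpToSign M i v
    · obtain ⟨c, rfl | rfl, hx⟩ := hv
      · exact ⟨0, fun x => by simp [hx x]⟩
      · exact ⟨1, fun x => by simp [hx x]⟩
    · obtain ⟨c, rfl | rfl, hx⟩ := hT i j v hij hv
      · exact ⟨2, fun x => by simp [hx x]⟩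
      · exact ⟨3, fun x => by simp [hx x]⟩
  choose c hc using hex
  have hMij := h.apply_eq_half hne
  have hci : c i = 0 := by
    have h1 := hc i
    generalize c i = y at h1
    fin_cases y
    · rfl
    · exfalso
      have := h1 j
      simp only [Fin.mk_one, Matrix.cons_val_one, Matrix.cons_val_zero] at this
      rcases hMij with e | e <;> rw [e] at this <;> linarith
    · exact absurd ⟨1, Or.inl rfl, fun x => by simpa using h1 x⟩ hij
    · exact absurd ⟨-1, Or.inr rfl, fun x => by simpa using h1 x⟩ hij
  have hcj : c j = 2 := by
    have h1 := hc j
    generalize c j = y at h1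
    fin_cases y
    · exact absurd ⟨1, Or.inl rfl, fun x => by simpa using h1 x⟩ hji
    · exact absurd ⟨-1, Or.inr rfl, fun x => by simpa using h1 x⟩ hji
    · rfl
    · exfalso
      have := h1 i
      rw [h.symm j i] at this
      simp at this
      rcases hMij with e | e <;> rw [e] at this <;> linarith
  obtain ⟨h01, h23⟩ := h.card_eq_of_coloring hI hc
  have hopp : ∀ {a : V} {y z : Fin 4}, c a = y → Nat.card {v // c v = z} = Nat.card {v // c v = y} →
      ∃ a', c a' = z := by
    intro a y z ha hyz
    have : Nonempty {v // c v = y} := ⟨⟨a, ha⟩⟩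
    have h1 : 0 < Nat.card {v // c v = z} := by rw [hyz]; exact Nat.card_pos
    obtain ⟨⟨a', ha'⟩⟩ := (Nat.card_pos_iff.1 h1).1
    exact ⟨a', ha'⟩
  obtain ⟨i', hi'⟩ := hopp hci h01
  obtain ⟨j', hj'⟩ := hopp hcj h23
  have hMi' : ∀ x, M i' x = -M i x := fun x => by rw [hc i', hi']; rfl
  have hMj' : ∀ x, M j' x = -M j x := fun x => by rw [hc j', hj']; rfl
  have hdiag : ∀ {a a' : V}, a ≠ a' → (∀ x, M a' x = -M a x) → M a a = 1 / 2 ∨ M a a = -1 / 2 := by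
    intro a a' hne hx
    have := hx a
    rcases h.apply_eq_half hne.symm with e | e <;> rw [e] at this
    · right; linarith
    · left; linarith
  have hii := hdiag (a := i) (a' := i') (by rintro rfl; rw [hci] at hi'; cases hi') hMi'
  have hjj := hdiag (a := j) (a' := j') (by rintro rfl; rw [hcj] at hj'; cases hj') hMj'
  have hgram := h.gram_ne_zero hI
  rcases hii with hii | hii <;> rcases hjj with hjj | hjj
  · exfalso
    rw [hii, hjj] at hgram
    rcases hMij with e | e <;> rw [e] at hgram <;> norm_num at hgram
  · exact h.halfCase_of_pair hI hii hjj hMj' hc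
  · refine h.halfCase_of_pair (c := fun v => ![2, 3, 0, 1] (c v)) hI.symm hjj hii hMi' fun v x => ?_
    rw [hc v x]
    generalize c v = y
    fin_cases y <;> simp
  · exfalso
    rw [hii, hjj] at hgram
    rcases hMij with e | e <;> rw [e] at hgram <;> norm_num at hgram

end IsRankTwo

/-! ### Graphs with at most two edges in a spanning forest -/

namespace IsRankTwo

/-- The pattern of a clique and isolated vertices. -/
def cliquePattern : Fin 2 → Fin 2 → Bool := ![![true, false], ![false, false]]

/-- Isolated vertices together with nothing, an edge, a triangle, a path of length two, or two
disjoint edges. -/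
def ZeroCase {V : Type*} [Fintype V] (G : SimpleGraph V) : Prop :=
  IsBlowup G cliquePattern ![0, Fintype.card V] ∨
    IsBlowup G cliquePattern ![2, Fintype.card V - 2] ∨
    IsBlowup G cliquePattern ![3, Fintype.card V - 3] ∨
    IsBlowup G bipartitePattern ![1, 2, Fintype.card V - 3] ∨
    IsBlowup G (twoCliquesPattern false) ![2, 2, Fintype.card V - 4]

theorem cliquePattern_symm : ∀ x y, cliquePattern x y = cliquePattern y x := by decide

theorem twoCliquesPattern_symm : ∀ b x y, twoCliquesPattern b x y = twoCliquesPattern b y x := by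
  decide

/-- A variant of `isBlowup_of_special` for graphs whose edges join special vertices. -/
theorem isBlowup_of_forall_adj {V : Type*} [Fintype V] {G : SimpleGraph V} {k r : ℕ}
    (P : Fin k → Fin k → Bool) {m : Fin k → ℕ} {s : Fin r → V} (a : Fin r → Fin k) (e : Fin k)
    (hP : ∀ x y, P x y = P y x) (hs : Function.Injective s) (he : ∀ x, P x e = false)
    (hG : ∀ v w, G.Adj v w → ∃ i, v = s i)
    (h1 : ∀ i j, i < j → (G.Adj (s i) (s j) ↔ P (a i) (a j) = true))
    (hm : ∀ x, (∑ i, if a i = x then 1 else 0) + (if e = x then (Fintype.card V : ℤ) - r else 0)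
      = m x) : IsBlowup G P m := by
  have key : ∀ v w, (∀ j, v ≠ s j) → ¬G.Adj w v := fun v w hv hadj => by
    obtain ⟨i, hi⟩ := hG v w hadj.symm
    exact hv i hi
  refine isBlowup_of_special P a e hP hs h1 (fun i v hv => ?_) (fun v w _ _ hw => ?_) hm
  · simp [he, key v _ hv]
  · simp [he, key w _ hw]

variable {V : Type*} [Fintype V] {G : SimpleGraph V} {M : V → V → ℝ}

open Classical in
theorem apply_eq_lapMatrix (h : IsRankTwo G 0 M) (i j : V) : M i j = G.lapMatrix ℝ i j := by
  have hoff : ∀ {i j}, i ≠ j → M i j = G.lapMatrix ℝ i j := by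
    intro i j hij
    rw [lapMatrix_apply_eq, if_neg hij]
    by_cases hadj : G.Adj i j
    · rw [h.apply_adj hadj, if_pos hadj]
    · rw [h.apply_not_adj hij hadj, if_neg hadj]; norm_num
  by_cases hij : i = j
  · subst hij
    have h1 : ∑ x, G.lapMatrix ℝ i x = 0 := by
      have := congrFun (SimpleGraph.lapMatrix_mulVec_const_eq_zero (R := ℝ) G) i
      simpa [Matrix.mulVec, dotProduct] using this
    have h2 : ∑ x, (M i x - G.lapMatrix ℝ i x) = 0 := by
      rw [Finset.sum_sub_distrib, h.sum_row, h1, sub_zero]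
    rw [Finset.sum_eq_single i (fun x _ hx => by rw [hoff hx.symm, sub_self]) (by simp)] at h2
    linarith
  · exact hoff hij

/-- If `α = 0`, then `M` is the Laplacian matrix, whose kernel consists of the functions constant
on connected components. Hence every triple of vertices contains a component. -/
theorem exists_constant_on_adj (h : IsRankTwo G 0 M) {i j k : V} (hij : i ≠ j) (hik : i ≠ k)
    (hjk : j ≠ k) : ∃ f : V → ℝ, (f i ≠ 0 ∨ f j ≠ 0 ∨ f k ≠ 0) ∧
      (∀ v, v ≠ i → v ≠ j → v ≠ k → f v = 0) ∧ ∀ v w, G.Adj v w → f v = f w := by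
  classical
  obtain ⟨r, s, t, h0, h1⟩ := h.dep i j k
  let f : V → ℝ := Pi.single i r + Pi.single j s + Pi.single k t
  have hi : f i = r := by simp [f, hij, hik]
  have hj : f j = s := by simp [f, hij.symm, hjk]
  have hk : f k = t := by simp [f, hik.symm, hjk.symm]
  refine ⟨f, by rwa [hi, hj, hk], fun v a b c => by simp [f, a, b, c], ?_⟩
  rw [← SimpleGraph.lapMatrix_mulVec_eq_zero_iff_forall_adj]
  funext x
  have := h1 x
  rw [h.symm i, h.symm j, h.symm k, h.apply_eq_lapMatrix, h.apply_eq_lapMatrix,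
    h.apply_eq_lapMatrix] at this
  simp only [f, Matrix.mulVec_add, Matrix.mulVec_single, Pi.add_apply, Pi.smul_apply,
    Matrix.col_apply, MulOpposite.smul_eq_mul_unop, MulOpposite.unop_op, Pi.zero_apply]
  linarith

/-- A path of length two lies in a component that is contained in its vertex set; a further edge
would give a triple containing no component. -/
theorem zeroCase_of_path (h : IsRankTwo G 0 M) (hn : 6 ≤ Fintype.card V) {x y z : V}
    (hxy : G.Adj x y) (hyz : G.Adj y z) (hxz : x ≠ z) : ZeroCase G := by
  have nxy := hxy.ne
  have nyz := hyz.ne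
  have hG : ∀ v w, G.Adj v w → ∃ i, v = ![x, y, z] i := by
    intro v w hvw
    by_contra! hv
    have hvx : v ≠ x := hv 0
    have hvy : v ≠ y := hv 1
    have hvz : v ≠ z := hv 2
    obtain ⟨f, hf, hf0, hadj⟩ := h.exists_constant_on_adj nxy hvx.symm hvy.symm
    have h1 := hadj x y hxy
    have h2 := hadj y z hyz
    have h3 := hf0 z hxz.symm nyz.symm hvz.symm
    have hv0 : f v ≠ 0 := by
      rcases hf with hf | hf | hf
      · exact absurd (by rw [h1, h2, h3]) hf
      · exact absurd (by rw [h2, h3]) hf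
      · exact hf
    refine hv0 ?_
    rw [hadj v w hvw]
    by_cases hwx : w = x
    · rw [hwx, h1, h2, h3]
    by_cases hwy : w = y
    · rw [hwy, h2, h3]
    exact hf0 w hwx hwy hvw.ne.symm
  have hs : Function.Injective ![x, y, z] := by
    intro a b hab
    fin_cases a <;> fin_cases b <;> simp_all
  by_cases hadj : G.Adj x z
  · refine Or.inr (Or.inr (Or.inl (isBlowup_of_forall_adj _ ![0, 0, 0] 1 cliquePattern_symm hs
      (by decide) hG (fun i j hij => ?_) fun i => ?_)))
    · fin_cases i <;> fin_cases j <;>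
        first | exact absurd hij (by decide) | simp [cliquePattern, hxy, hyz, hadj]
    · rw [Fin.sum_univ_three]
      fin_cases i <;> simp; omega
  · refine Or.inr (Or.inr (Or.inr (Or.inl (isBlowup_of_forall_adj _ ![1, 0, 1] 2
      bipartitePattern_symm hs (by decide) hG (fun i j hij => ?_) fun i => ?_))))
    · fin_cases i <;> fin_cases j <;>
        first | exact absurd hij (by decide) | simp [bipartitePattern, hxy, hyz, hadj]
    · rw [Fin.sum_univ_three]
      fin_cases i <;> simp; omega

theorem zeroCase (h : IsRankTwo G 0 M) (hn : 6 ≤ Fintype.card V) : ZeroCase G := by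
  by_cases hP : ∃ x y z, G.Adj x y ∧ G.Adj y z ∧ x ≠ z
  · obtain ⟨x, y, z, h1, h2, h3⟩ := hP
    exact h.zeroCase_of_path hn h1 h2 h3
  push Not at hP
  by_cases hE : ∃ a b, G.Adj a b
  swap
  · push Not at hE
    refine Or.inl (isBlowup_of_forall_adj _ (s := Fin.elim0) Fin.elim0 1 cliquePattern_symm
      (fun i => Fin.elim0 i) (by decide) (fun v w hvw => absurd hvw (hE v w))
      (fun i => Fin.elim0 i) fun i => ?_)
    fin_cases i <;> simp
  obtain ⟨a, b, hab⟩ := hE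
  by_cases hE' : ∃ c d, G.Adj c d ∧ c ≠ a ∧ c ≠ b
  swap
  · push Not at hE'
    have hs : Function.Injective ![a, b] := by
      have := hab.ne
      intro i j hij
      fin_cases i <;> fin_cases j <;> simp_all
    refine Or.inr (Or.inl (isBlowup_of_forall_adj _ ![0, 0] 1 cliquePattern_symm hs (by decide)
      (fun v w hvw => ?_) (fun i j hij => ?_) fun i => ?_))
    · by_cases hva : v = a
      · exact ⟨0, hva⟩
      · exact ⟨1, hE' v w hvw hva⟩
    · fin_cases i <;> fin_cases j <;>
        first | exact absurd hij (by decide) | simp [cliquePattern, hab]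
    · rw [Fin.sum_univ_two]
      fin_cases i <;> simp; omega
  obtain ⟨c, d, hcd, hca, hcb⟩ := hE'
  have hda : d ≠ a := by
    rintro rfl
    exact hcb (hP c d b hcd hab)
  have hdb : d ≠ b := by
    rintro rfl
    exact hca (hP c d a hcd hab.symm)
  have nab := hab.ne
  have ncd := hcd.ne
  have hs : Function.Injective ![a, b, c, d] := by
    intro i j hij
    fin_cases i <;> fin_cases j <;> simp_all
  refine Or.inr (Or.inr (Or.inr (Or.inr (isBlowup_of_forall_adj _ ![0, 0, 1, 1] 2
    (twoCliquesPattern_symm false) hs (by decide) (fun v w hvw => ?_) (fun i j hij => ?_)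
      fun i => ?_))))
  · by_contra! hv
    have hva : v ≠ a := hv 0
    have hvb : v ≠ b := hv 1
    have hvc : v ≠ c := hv 2
    have hvd : v ≠ d := hv 3
    obtain ⟨f, hf, hf0, hadj⟩ := h.exists_constant_on_adj hca.symm hva.symm hvc.symm
    have h1 : f a = 0 := by rw [hadj a b hab, hf0 b nab.symm hcb.symm hvb.symm]
    have h2 : f c = 0 := by rw [hadj c d hcd, hf0 d hda ncd.symm hvd.symm]
    have hv0 : f v ≠ 0 := by
      rcases hf with hf | hf | hf
      · exact absurd h1 hf
      · exact absurd h2 hf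
      · exact hf
    refine hv0 ?_
    rw [hadj v w hvw]
    by_cases hwa : w = a
    · rw [hwa, h1]
    by_cases hwc : w = c
    · rw [hwc, h2]
    exact hf0 w hwa hwc hvw.ne.symm
  · have hac : ¬G.Adj a c := fun h' => hcb.symm (hP b a c hab.symm h')
    have had : ¬G.Adj a d := fun h' => hdb.symm (hP b a d hab.symm h')
    have hbc : ¬G.Adj b c := fun h' => hca.symm (hP a b c hab h')
    have hbd : ¬G.Adj b d := fun h' => hda.symm (hP a b d hab h')
    fin_cases i <;> fin_cases j <;>
      first
        | exact absurd hij (by decide)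
        | simp [twoCliquesPattern, hab, hcd, hac, had, hbc, hbd]
  · rw [Fin.sum_univ_four]
    fin_cases i <;> simp; omega

end IsRankTwo

/-! ### Degree sums -/

namespace IsRankTwo

open Classical in
theorem SmallCase.sum_degree {V : Type*} [Fintype V] {G : SimpleGraph V} {α : ℝ} {k : ℕ}
    (h : SmallCase G α) (hk : Fintype.card V = k + 6) :
    (α * Fintype.card V = 1 ∧
      ((∑ v, G.degree v = 2 * k + 8 ∧ IsBlowup G bipartitePattern ![1, k + 4, 1]) ∨
        (∑ v, G.degree v = 2 * k + 10 ∧ IsBlowup G bipartitePattern ![1, k + 5, 0]) ∨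
        (∑ v, G.degree v = 2 * k + 12 ∧ IsBlowup G conePattern ![1, k + 3, 2]))) ∨
    (α * Fintype.card V = 2 ∧
      ((∑ v, G.degree v = 4 * k + 16 ∧ IsBlowup G bipartitePattern ![2, k + 4, 0]) ∨
        (∑ v, G.degree v = 4 * k + 18 ∧ IsBlowup G splitPattern ![2, k + 4]))) := by
  unfold SmallCase at h
  rw [show Fintype.card V - 1 = k + 5 by omega, show Fintype.card V - 2 = k + 4 by omega,
    show Fintype.card V - 3 = k + 3 by omega] at h
  refine h.imp (And.imp_right (Or.imp (fun hB => ⟨?_, hB⟩) (Or.imp (fun hB => ⟨?_, hB⟩)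
    fun hB => ⟨?_, hB⟩))) (And.imp_right (Or.imp (fun hB => ⟨?_, hB⟩) fun hB => ⟨?_, hB⟩))
  · rw [hB.sum_degree (d := ![k + 4, 1, 0]) (fun x hx => by
      fin_cases x <;> simp [Fin.sum_univ_three, bipartitePattern]) fun d => d]
    simp [Fin.sum_univ_three]
    ring
  · rw [hB.sum_degree (d := ![k + 5, 1, 0]) (fun x hx => by
      fin_cases x <;> simp [Fin.sum_univ_three, bipartitePattern]) fun d => d]
    simp [Fin.sum_univ_three]
    ring
  · rw [hB.sum_degree (d := ![k + 5, 1, 2]) (fun x hx => by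
      fin_cases x <;> simp [Fin.sum_univ_three, conePattern]) fun d => d]
    simp [Fin.sum_univ_three]
    ring
  · rw [hB.sum_degree (d := ![k + 4, 2, 0]) (fun x hx => by
      fin_cases x <;> simp [Fin.sum_univ_three, bipartitePattern] at hx ⊢) fun d => d]
    simp [Fin.sum_univ_three]
    ring
  · rw [hB.sum_degree (d := ![k + 5, 2]) (fun x hx => by
      fin_cases x <;> simp [splitPattern]; omega) fun d => d]
    simp
    ring

open Classical in
theorem ThirdCase.sum_degree {V : Type*} [Fintype V] {G : SimpleGraph V} {α : ℝ}
    (h : ThirdCase G α) (hn : 6 ≤ Fintype.card V) :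
    α = 1 / 3 ∧ ∃ m : ℕ, Fintype.card V = 3 * m + 6 ∧
      ((∑ v, G.degree v = 3 * (m * m) + 9 * m + 6 ∧
          IsBlowup G threeCliquesPattern ![m + 2, m + 2, m + 2]) ∨
        (∑ v, G.degree v = 3 * (m * m) + 11 * m + 10 ∧
          IsBlowup G bipartiteCliquePattern ![m + 2, m + 2, m + 2])) := by
  obtain ⟨hα, m, hm, hB⟩ := h
  obtain ⟨m, rfl⟩ := Nat.exists_eq_add_of_le' (show 2 ≤ m by omega)
  refine ⟨hα, m, by omega, hB.imp (fun hB => ⟨?_, hB⟩) fun hB => ⟨?_, hB⟩⟩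
  · rw [hB.sum_degree (d := ![m + 1, m + 1, m + 1]) (fun x hx => by
      fin_cases x <;> simp [Fin.sum_univ_three, threeCliquesPattern]) fun d => d]
    simp [Fin.sum_univ_three]
    ring
  · rw [hB.sum_degree (d := ![m + 2, m + 2, m + 1]) (fun x hx => by
      fin_cases x <;> simp [Fin.sum_univ_three, bipartiteCliquePattern]) fun d => d]
    simp [Fin.sum_univ_three]
    ring

open Classical in
theorem HalfOddCase.sum_degree {V : Type*} [Fintype V] {G : SimpleGraph V} {α : ℝ}
    (h : HalfOddCase G α) (hn : 6 ≤ Fintype.card V) :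
    ∃ m : ℕ, Fintype.card V = 2 * m + 7 ∧ α * Fintype.card V = m + 3 ∧
      ((∑ v, G.degree v = 2 * (m * m) + 10 * m + 12 ∧
          IsBlowup G (twoCliquesPattern false) ![m + 3, m + 3, 1]) ∨
        (∑ v, G.degree v = 2 * (m * m) + 12 * m + 18 ∧
          IsBlowup G (fun x y => !twoCliquesPattern true x y) ![m + 3, m + 3, 1])) := by
  obtain ⟨m, hm, hα, hB⟩ := h
  obtain ⟨m, rfl⟩ := Nat.exists_eq_add_of_le' (show 3 ≤ m by omega)
  refine ⟨m, by omega, by rw [hα]; push_cast; ring, hB.imp (fun hB => ⟨?_, hB⟩) fun hB => ⟨?_, hB⟩⟩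
  · rw [hB.sum_degree (d := ![m + 2, m + 2, 0]) (fun x hx => by
      fin_cases x <;> simp [Fin.sum_univ_three, twoCliquesPattern]) fun d => d]
    simp [Fin.sum_univ_three]
    ring
  · rw [hB.sum_degree (d := ![m + 3, m + 3, 0]) (fun x hx => by
      fin_cases x <;> simp [Fin.sum_univ_three, twoCliquesPattern]) fun d => d]
    simp [Fin.sum_univ_three]
    ring

open Classical in
theorem HalfCase.sum_degree {V : Type*} [Fintype V] {G : SimpleGraph V} (h : HalfCase G) :
    ∃ m : ℕ, Fintype.card V = 2 * m ∧
      ((∃ a b, m = a + b ∧ ∑ v, G.degree v + 2 * b = 2 * (m * m) ∧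
          IsBlowup G fourPattern ![a, a, b, b]) ∨
        (∃ a, m = a + 2 ∧ ∑ v, G.degree v = 2 * (m * m) + 2 ∧
          IsBlowup G bipartiteAddPattern ![a, a + 2, 2]) ∨
        (∃ a, m = a + 2 ∧ ∑ v, G.degree v + 2 * m + 2 = 2 * (m * m) ∧
          IsBlowup G (fun x y => !bipartiteAddPattern x y) ![a, a + 2, 2])) := by
  rcases h with ⟨a, b, hc, hB⟩ | ⟨a, hc, hB | hB⟩
  · refine ⟨a + b, hc, Or.inl ⟨a, b, rfl, ?_, hB⟩⟩
    rw [hB.sum_degree (d := ![a + b, a + b, a + b - 1, a + b - 1]) (fun x hx => by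
      fin_cases x <;> simp [Fin.sum_univ_four, fourPattern] at hx ⊢ <;> omega) fun d => d]
    rcases Nat.eq_zero_or_pos b with rfl | hb
    · simp [Fin.sum_univ_four]
      ring
    · obtain ⟨b, rfl⟩ := Nat.exists_eq_add_of_le' hb
      simp [Fin.sum_univ_four, ← add_assoc]
      ring
  · refine ⟨a + 2, by omega, Or.inr (Or.inl ⟨a, rfl, ?_, hB⟩)⟩
    rw [hB.sum_degree (d := ![a + 2, a + 2, a + 3]) (fun x hx => by
      fin_cases x <;> simp [Fin.sum_univ_three, bipartiteAddPattern]) fun d => d]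
    simp [Fin.sum_univ_three]
    ring
  · refine ⟨a + 2, by omega, Or.inr (Or.inr ⟨a, rfl, ?_, hB⟩)⟩
    rw [hB.sum_degree (d := ![a + 1, a + 1, a]) (fun x hx => by
      fin_cases x <;> simp [Fin.sum_univ_three, bipartiteAddPattern]) fun d => d]
    simp [Fin.sum_univ_three]
    ring

open Classical in
theorem ZeroCase.sum_degree {V : Type*} [Fintype V] {G : SimpleGraph V} {k : ℕ} (h : ZeroCase G)
    (hk : Fintype.card V = k + 6) :
    (∑ v, G.degree v = 0 ∧ IsBlowup G cliquePattern ![0, k + 6]) ∨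
      (∑ v, G.degree v = 2 ∧ IsBlowup G cliquePattern ![2, k + 4]) ∨
      (∑ v, G.degree v = 6 ∧ IsBlowup G cliquePattern ![3, k + 3]) ∨
      (∑ v, G.degree v = 4 ∧ ∑ v, G.degree v ^ 2 = 6 ∧
        IsBlowup G bipartitePattern ![1, 2, k + 3]) ∨
      (∑ v, G.degree v = 4 ∧ ∑ v, G.degree v ^ 2 = 4 ∧
        IsBlowup G (twoCliquesPattern false) ![2, 2, k + 2]) := by
  unfold ZeroCase at h
  rw [show Fintype.card V - 2 = k + 4 by omega, show Fintype.card V - 3 = k + 3 by omega,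
    show Fintype.card V - 4 = k + 2 by omega, hk] at h
  have path : ∀ x : Fin 3, (![1, 2, k + 3] x ≠ 0) → ![2, 1, 0] x +
      (if bipartitePattern x x then 1 else 0) =
      ∑ y, ![1, 2, k + 3] y * (if bipartitePattern x y then 1 else 0) := by
    intro x _
    fin_cases x <;> simp [Fin.sum_univ_three, bipartitePattern]
  have edges : ∀ x : Fin 3, (![2, 2, k + 2] x ≠ 0) → ![1, 1, 0] x +
      (if twoCliquesPattern false x x then 1 else 0) =
      ∑ y, ![2, 2, k + 2] y * (if twoCliquesPattern false x y then 1 else 0) := by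
    intro x _
    fin_cases x <;> simp [Fin.sum_univ_three, twoCliquesPattern]
  refine h.imp (fun hB => ⟨?_, hB⟩) (Or.imp (fun hB => ⟨?_, hB⟩) (Or.imp (fun hB => ⟨?_, hB⟩)
    (Or.imp (fun hB => ⟨?_, ?_, hB⟩) fun hB => ⟨?_, ?_, hB⟩)))
  · rw [hB.sum_degree (d := ![0, 0]) (fun x hx => by
      fin_cases x <;> simp [cliquePattern] at hx ⊢) fun d => d]
    simp
  · rw [hB.sum_degree (d := ![1, 0]) (fun x hx => by
      fin_cases x <;> simp [cliquePattern]) fun d => d]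
    simp
  · rw [hB.sum_degree (d := ![2, 0]) (fun x hx => by
      fin_cases x <;> simp [cliquePattern]) fun d => d]
    simp
  · rw [hB.sum_degree path fun d => d]
    simp [Fin.sum_univ_three]
  · rw [hB.sum_degree path fun d => d ^ 2]
    simp [Fin.sum_univ_three]
  · rw [hB.sum_degree edges fun d => d]
    simp [Fin.sum_univ_three]
  · rw [hB.sum_degree edges fun d => d ^ 2]
    simp [Fin.sum_univ_three]

end IsRankTwo

/-! ### The spectrum determines the graph -/

namespace IsRankTwo

open Classical in
theorem SmallCase.nonempty_iso {V W : Type*} [Fintype V] [Fintype W] {G : SimpleGraph V}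
    {H : SimpleGraph W} {α : ℝ} {k : ℕ} (hG : SmallCase G α) (hH : SmallCase H α)
    (hV : Fintype.card V = k + 6) (hW : Fintype.card W = k + 6)
    (hd : ∑ v, G.degree v = ∑ w, H.degree w) : Nonempty (G ≃g H) := by
  have hG' := hG.sum_degree hV
  have hH' := hH.sum_degree hW
  rw [hV] at hG'
  rw [hW] at hH'
  rcases hG' with ⟨h1, h⟩ | ⟨h1, h⟩ <;> rcases hH' with ⟨h1', h'⟩ | ⟨h1', h'⟩
  · rcases h with ⟨s, hB⟩ | ⟨s, hB⟩ | ⟨s, hB⟩ <;>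
      rcases h' with ⟨s', hB'⟩ | ⟨s', hB'⟩ | ⟨s', hB'⟩ <;>
      first | exact hB.nonempty_iso hB' | omega
  · linarith
  · linarith
  · rcases h with ⟨s, hB⟩ | ⟨s, hB⟩ <;> rcases h' with ⟨s', hB'⟩ | ⟨s', hB'⟩ <;>
      first | exact hB.nonempty_iso hB' | omega

open Classical in
theorem ThirdCase.nonempty_iso {V W : Type*} [Fintype V] [Fintype W] {G : SimpleGraph V}
    {H : SimpleGraph W} {α : ℝ} (hG : ThirdCase G α) (hH : ThirdCase H α)
    (hcard : Fintype.card V = Fintype.card W) (hn : 6 ≤ Fintype.card V)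
    (hd : ∑ v, G.degree v = ∑ w, H.degree w) : Nonempty (G ≃g H) := by
  obtain ⟨-, m, hm, h⟩ := hG.sum_degree hn
  obtain ⟨-, m', hm', h'⟩ := hH.sum_degree (by omega)
  obtain rfl : m' = m := by omega
  generalize m' * m' = q at h h'
  rcases h with ⟨s, hB⟩ | ⟨s, hB⟩ <;> rcases h' with ⟨s', hB'⟩ | ⟨s', hB'⟩ <;>
    first | exact hB.nonempty_iso hB' | omega

open Classical in
theorem HalfOddCase.nonempty_iso {V W : Type*} [Fintype V] [Fintype W] {G : SimpleGraph V}
    {H : SimpleGraph W} {α : ℝ} (hG : HalfOddCase G α) (hH : HalfOddCase H α)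
    (hcard : Fintype.card V = Fintype.card W) (hn : 6 ≤ Fintype.card V)
    (hd : ∑ v, G.degree v = ∑ w, H.degree w) : Nonempty (G ≃g H) := by
  obtain ⟨m, hm, -, h⟩ := hG.sum_degree hn
  obtain ⟨m', hm', -, h'⟩ := hH.sum_degree (by omega)
  obtain rfl : m' = m := by omega
  generalize m' * m' = q at h h'
  rcases h with ⟨s, hB⟩ | ⟨s, hB⟩ <;> rcases h' with ⟨s', hB'⟩ | ⟨s', hB'⟩ <;>
    first | exact hB.nonempty_iso hB' | omega

open Classical in
/-- The two families overlap in order and eigenvalue only for `n = 6`. -/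
theorem SmallCase.sum_degree_ne_thirdCase {V W : Type*} [Fintype V] [Fintype W]
    {G : SimpleGraph V} {H : SimpleGraph W} {α : ℝ} (hG : SmallCase G α) (hH : ThirdCase H α)
    (hcard : Fintype.card V = Fintype.card W) (hn : 6 ≤ Fintype.card V) :
    ∑ v, G.degree v ≠ ∑ w, H.degree w := by
  intro hd
  obtain ⟨k, hk⟩ := Nat.exists_eq_add_of_le' hn
  obtain ⟨hα, m, hm, h'⟩ := hH.sum_degree (by omega)
  have hn' : (Fintype.card V : ℝ) = 3 * m + 6 := by rw [hcard]; exact_mod_cast hm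
  have hm0 : (0 : ℝ) ≤ m := m.cast_nonneg
  rcases hG.sum_degree hk with ⟨h1, h⟩ | ⟨h1, h⟩
  · rw [hα, hn'] at h1
    linarith
  · rw [hα, hn'] at h1
    obtain rfl : m = 0 := by
      have : (m : ℝ) = 0 := by linarith
      exact_mod_cast this
    rcases h with ⟨s, -⟩ | ⟨s, -⟩ <;> rcases h' with ⟨s', -⟩ | ⟨s', -⟩ <;> omega

theorem SmallCase.not_halfOddCase {V W : Type*} [Fintype V] [Fintype W]
    {G : SimpleGraph V} {H : SimpleGraph W} {α : ℝ} (hG : SmallCase G α) (hH : HalfOddCase H α)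
    (hcard : Fintype.card V = Fintype.card W) (hn : 6 ≤ Fintype.card V) : False := by
  obtain ⟨m, hm, hα, -⟩ := hH.sum_degree (by omega)
  rw [← hcard] at hα
  have hm0 : (0 : ℝ) ≤ m := m.cast_nonneg
  rcases hG with ⟨h1, -⟩ | ⟨h1, -⟩ <;> linarith

theorem ThirdCase.not_halfOddCase {V W : Type*} [Fintype V] [Fintype W]
    {G : SimpleGraph V} {H : SimpleGraph W} {α : ℝ} (hG : ThirdCase G α) (hH : HalfOddCase H α)
    (hcard : Fintype.card V = Fintype.card W) (hn : 6 ≤ Fintype.card V) : False := by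
  obtain ⟨m, hm, hα, -⟩ := hH.sum_degree (by omega)
  have hm0 : (0 : ℝ) ≤ m := m.cast_nonneg
  have hm' : (Fintype.card W : ℝ) = 2 * m + 7 := by exact_mod_cast hm
  rw [hG.1, hm'] at hα
  linarith

open Classical in
theorem nonempty_iso_of_lt_half {V W : Type*} [Fintype V] [Fintype W] {G : SimpleGraph V}
    {H : SimpleGraph W} {α : ℝ} {M : V → V → ℝ} {N : W → W → ℝ} (hG : IsRankTwo G α M)
    (hH : IsRankTwo H α N) (hcard : Fintype.card V = Fintype.card W) (hn : 6 ≤ Fintype.card V)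
    (hd : ∑ v, G.degree v = ∑ w, H.degree w) (h0 : α ≠ 0) (hα : α < 1 / 2) :
    Nonempty (G ≃g H) := by
  obtain ⟨k, hk⟩ := Nat.exists_eq_add_of_le' hn
  have hk' : Fintype.card W = k + 6 := by omega
  have hn' : 6 ≤ Fintype.card W := by omega
  rcases hG.classification hn h0 hα with hB | hB | hB <;>
    rcases hH.classification hn' h0 hα with hB' | hB' | hB'
  · exact hB.nonempty_iso hB' hk hk' hd
  · exact absurd hd (hB.sum_degree_ne_thirdCase hB' hcard hn)
  · exact (hB.not_halfOddCase hB' hcard hn).elim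
  · exact absurd hd.symm (hB'.sum_degree_ne_thirdCase hB hcard.symm hn')
  · exact hB.nonempty_iso hB' hcard hn hd
  · exact (hB.not_halfOddCase hB' hcard hn).elim
  · exact (hB'.not_halfOddCase hB hcard.symm hn').elim
  · exact (hB'.not_halfOddCase hB hcard.symm hn').elim
  · exact hB.nonempty_iso hB' hcard hn hd

open Classical in
theorem nonempty_iso_of_eq_half {V W : Type*} [Fintype V] [Fintype W] {G : SimpleGraph V}
    {H : SimpleGraph W} {M : V → V → ℝ} {N : W → W → ℝ} (hG : IsRankTwo G (1 / 2) M)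
    (hH : IsRankTwo H (1 / 2) N) (hcard : Fintype.card V = Fintype.card W)
    (hn : 6 ≤ Fintype.card V) (hd : ∑ v, G.degree v = ∑ w, H.degree w) : Nonempty (G ≃g H) := by
  obtain ⟨m, hm, hB⟩ := (hG.halfCase hn).sum_degree
  obtain ⟨m', hm', hB'⟩ := (hH.halfCase (by omega)).sum_degree
  obtain rfl : m' = m := by omega
  rcases hB with ⟨a, b, hab, hs, hB⟩ | ⟨a, hab, hs, hB⟩ | ⟨a, hab, hs, hB⟩ <;>
    rcases hB' with ⟨a', b', hab', hs', hB'⟩ | ⟨a', hab', hs', hB'⟩ | ⟨a', hab', hs', hB'⟩ <;>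
    rw [hd] at hs <;> generalize m' * m' = q at hs hs'
  · obtain rfl : b' = b := by omega
    obtain rfl : a' = a := by omega
    exact hB.nonempty_iso hB'
  · omega
  · omega
  · omega
  · obtain rfl : a' = a := by omega
    exact hB.nonempty_iso hB'
  · omega
  · omega
  · omega
  · obtain rfl : a' = a := by omega
    exact hB.nonempty_iso hB'

open Classical in
theorem nonempty_iso_of_eq_zero {V W : Type*} [Fintype V] [Fintype W] {G : SimpleGraph V}
    {H : SimpleGraph W} {M : V → V → ℝ} {N : W → W → ℝ} (hG : IsRankTwo G 0 M)
    (hH : IsRankTwo H 0 N) (hcard : Fintype.card V = Fintype.card W)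
    (hn : 6 ≤ Fintype.card V) (hd : ∑ v, G.degree v = ∑ w, H.degree w)
    (hd2 : ∑ v, G.degree v ^ 2 = ∑ w, H.degree w ^ 2) : Nonempty (G ≃g H) := by
  obtain ⟨k, hk⟩ := Nat.exists_eq_add_of_le' hn
  have hk' : Fintype.card W = k + 6 := by omega
  rcases (hG.zeroCase hn).sum_degree hk with
      ⟨s, hB⟩ | ⟨s, hB⟩ | ⟨s, hB⟩ | ⟨s, t, hB⟩ | ⟨s, t, hB⟩ <;>
    rcases (hH.zeroCase (by omega)).sum_degree hk' with
      ⟨s', hB'⟩ | ⟨s', hB'⟩ | ⟨s', hB'⟩ | ⟨s', t', hB'⟩ | ⟨s', t', hB'⟩ <;>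
    first | exact hB.nonempty_iso hB' | omega

theorem nonempty_iso_of_compl {V W : Type*} {G : SimpleGraph V} {H : SimpleGraph W}
    (h : Nonempty (Gᶜ ≃g Hᶜ)) : Nonempty (G ≃g H) := by
  obtain ⟨e⟩ := h
  refine ⟨⟨e.toEquiv, fun {v w} => ?_⟩⟩
  have h1 := e.map_adj_iff (v := v) (w := w)
  simp only [SimpleGraph.compl_adj] at h1
  by_cases hvw : v = w
  · simp [hvw]
  · have hne : e v ≠ e w := e.injective.ne hvw
    have h2 : ¬H.Adj (e v) (e w) ↔ ¬G.Adj v w := by tauto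
    exact not_iff_not.1 h2

open Classical in
theorem sum_degree_compl {V : Type*} [Fintype V] (G : SimpleGraph V) :
    (∑ v, (Gᶜ.degree v : ℤ)) =
      Fintype.card V * (Fintype.card V - 1) - ∑ v, (G.degree v : ℤ) := by
  have h1 : ∀ v, (Gᶜ.degree v : ℤ) = (Fintype.card V - 1) - G.degree v := by
    intro v
    have h1 := G.degree_compl v
    have h2 := G.degree_lt_card_verts v
    omega
  simp only [h1, Finset.sum_sub_distrib, Finset.sum_const, Finset.card_univ, nsmul_eq_mul]
  ring

open Classical in
theorem sum_degree_sq_compl {V : Type*} [Fintype V] (G : SimpleGraph V) :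
    (∑ v, (Gᶜ.degree v : ℤ) ^ 2) = Fintype.card V * (Fintype.card V - 1) ^ 2 -
      2 * (Fintype.card V - 1) * (∑ v, (G.degree v : ℤ)) + ∑ v, (G.degree v : ℤ) ^ 2 := by
  have h1 : ∀ v, (Gᶜ.degree v : ℤ) ^ 2 = (Fintype.card V - 1) ^ 2 -
      2 * (Fintype.card V - 1) * G.degree v + (G.degree v : ℤ) ^ 2 := by
    intro v
    have h1 := G.degree_compl v
    have h2 := G.degree_lt_card_verts v
    have h3 : (Gᶜ.degree v : ℤ) = (Fintype.card V - 1) - G.degree v := by omega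
    rw [h3]; ring
  simp only [h1, Finset.sum_add_distrib, Finset.sum_sub_distrib, Finset.sum_const,
    Finset.card_univ, nsmul_eq_mul, ← Finset.mul_sum]

open Classical in
theorem nonempty_iso_of_le_half {V W : Type*} [Fintype V] [Fintype W] {G : SimpleGraph V}
    {H : SimpleGraph W} {α : ℝ} {M : V → V → ℝ} {N : W → W → ℝ} (hG : IsRankTwo G α M)
    (hH : IsRankTwo H α N) (hcard : Fintype.card V = Fintype.card W)
    (hn : 6 ≤ Fintype.card V) (hd : ∑ v, G.degree v = ∑ w, H.degree w)
    (hd2 : ∑ v, G.degree v ^ 2 = ∑ w, H.degree w ^ 2) (hα : α ≤ 1 / 2) : Nonempty (G ≃g H) := by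
  rcases hα.lt_or_eq with hα | rfl
  · by_cases h0 : α = 0
    · subst h0
      exact hG.nonempty_iso_of_eq_zero hH hcard hn hd hd2
    · exact hG.nonempty_iso_of_lt_half hH hcard hn hd h0 hα
  · exact hG.nonempty_iso_of_eq_half hH hcard hn hd

open Classical in
/-- For at least six vertices, the order, `α`, and the first two power sums of the degrees determine
a graph with a matrix of rank at most two. -/
theorem nonempty_iso {V W : Type*} [Fintype V] [Fintype W] {G : SimpleGraph V}
    {H : SimpleGraph W} {α : ℝ} {M : V → V → ℝ} {N : W → W → ℝ} (hG : IsRankTwo G α M)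
    (hH : IsRankTwo H α N) (hcard : Fintype.card V = Fintype.card W)
    (hn : 6 ≤ Fintype.card V) (hd : ∑ v, G.degree v = ∑ w, H.degree w)
    (hd2 : ∑ v, G.degree v ^ 2 = ∑ w, H.degree w ^ 2) : Nonempty (G ≃g H) := by
  rcases le_total α (1 / 2) with hα | hα
  · exact hG.nonempty_iso_of_le_half hH hcard hn hd hd2 hα
  · have hd' : (∑ v, (G.degree v : ℤ)) = ∑ w, (H.degree w : ℤ) := by exact_mod_cast hd
    have hd2' : (∑ v, (G.degree v : ℤ) ^ 2) = ∑ w, (H.degree w : ℤ) ^ 2 := by exact_mod_cast hd2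
    refine nonempty_iso_of_compl (hG.compl.nonempty_iso_of_le_half hH.compl hcard hn ?_ ?_
      (by linarith))
    · have := sum_degree_compl G
      rw [hcard, hd', ← sum_degree_compl H] at this
      have e : ∑ v, Gᶜ.degree v = ∑ w, Hᶜ.degree w := by exact_mod_cast this
      convert e
    · have := sum_degree_sq_compl G
      rw [hcard, hd', hd2', ← sum_degree_sq_compl H] at this
      have e : ∑ v, Gᶜ.degree v ^ 2 = ∑ w, Hᶜ.degree w ^ 2 := by exact_mod_cast this
      convert e

end IsRankTwo

open Classical in
/-- The multiplicity of the Laplacian eigenvalue `0` is the number of components, hence one. -/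
theorem count_zero_laplacianSpectrum {V : Type*} [Fintype V] {G : SimpleGraph V}
    (hG : G.Connected) : (laplacianSpectrum G).count 0 = 1 := by
  have h1 := rank_lapMatrix_sub G 0
  rw [zero_smul, sub_zero] at h1
  have h2 := LinearMap.finrank_range_add_finrank_ker (G.lapMatrix ℝ).toLin'
  rw [← G.card_connectedComponent_eq_finrank_ker_toLin'_lapMatrix,
    Module.finrank_fintype_fun_eq_card] at h2
  have h3 : Fintype.card G.ConnectedComponent = 1 := by
    have := hG.preconnected.subsingleton_connectedComponent
    have := hG.nonempty
    exact le_antisymm (Fintype.card_le_one_iff_subsingleton.2 inferInstance) Fintype.card_pos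
  have h4 : (G.lapMatrix ℝ).rank = Module.finrank ℝ (LinearMap.range (G.lapMatrix ℝ).toLin') := rfl
  omega

theorem mainTheorem2 {V : Type u} [Fintype V] (G : SimpleGraph V) (n : ℕ) (hn : 4 ≤ n)
    (hG : HasLaplacianMultiplicity G n (n - 3)) : IsDLS.{u, v} G := by
  obtain ⟨hconn, rfl, μ, -, hμ⟩ := hG
  intro W _ H hspec
  have hcard : Fintype.card V = Fintype.card W := by
    rw [← card_eq_card_laplacianSpectrum G, ← card_eq_card_laplacianSpectrum H, hspec]
  by_cases h4 : Fintype.card V = 4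
  · exact nonempty_iso_of_card_eq_four (by omega) h4 hspec
  by_cases h5 : Fintype.card V = 5
  · exact nonempty_iso_of_card_eq_five (by omega) h5 hspec
  have hμ0 : μ ≠ 0 := by
    rintro rfl
    rw [count_zero_laplacianSpectrum hconn] at hμ
    omega
  obtain ⟨M, hM⟩ := exists_isRankTwo G hμ0 (by omega) hμ
  obtain ⟨N, hN⟩ := exists_isRankTwo H hμ0 (by omega) (by rw [hspec, hμ, hcard])
  rw [hcard] at hM
  exact hN.nonempty_iso hM hcard.symm (by omega) (sum_degree_eq_of_laplacianSpectrum_eq hspec)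
    (sum_degree_sq_eq_of_laplacianSpectrum_eq hspec)
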